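/- Let $d\ge 3$ and let $S_0=0$, $S_n=X_1+\dots+X_n$ be the simple symmetric random walk on $\mathbb Z^d$: the steps $X_1,X_2,\dots$ are independent, each taking each of the $2d$ values $\pm e_i$ ($1\le i\le d$, $e_i$ the standard unit vectors) with probability $\frac1{2d}$. For $x\in\mathbb Z^d$ let $$\xi(x,n)=\#\{k: 0<k\le n,\ S_k=x\},\qquad \xi(x,\infty)=\#\{k: k>0,\ S_k=x\}\in\{0,1,\dots,\infty\},$$ and for integers $k,n\ge 1$ let $$Q(k,n)=\#\{x:\ \xi(x,n)=k\},\qquad U(k,n)=\#\{x:\ 0<\xi(x,n)\le\xi(x,\infty)=k\},$$ $$R(k,n)=\sum_{j=k}^{\infty}Q(j,n),\qquad V(k,n)=\sum_{j=k}^{\infty}U(j,n).$$ Let $\gamma=\mathbf P(S_n\ne 0\text{ for all } n\ge 1)$ be the probability that the walk never returns to its starting point, let $\lambda=-1/\log(1-\gamma)$, let $B>2$ be a real number, and put $$\mu(t)=\gamma(1-\gamma)^{t-1},\qquad t_n=\lfloor \lambda\log n-\lambda B\log\log n\rfloor .$$ Then, almost surely, $$\lim_{n\to\infty}\sup_{t\le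 t_n}\left|\frac{U(t,n)}{n\gamma\mu(t)}-1\right|=0,\qquad \lim_{n\to\infty}\sup_{t\le t_n}\left|\frac{Q(t,n)}{n\gamma\mu(t)}-1\right|=0,$$ $$\lim_{n\to\infty}\sup_{t\le t_n}\left|\frac{V(t,n)}{n\mu(t)}-1\right|=0,\qquad \lim_{n\to\infty}\sup_{t\le t_n}\left|\frac{R(t,n)}{n\mu(t)}-1\right|=0,$$ where in each supremum $t$ runs through the positive integers. -/

import Mathlib

open MeasureTheory ProbabilityTheory Filter Topology

noncomputable section

namespace HeavyPoints

/-- `X 0, X 1, …` are the steps of a simple symmetric random walk on `ℤ^d`: independent random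
vectors, each equal to any of the `2 d` vectors `e_i`, `-e_i` with probability `1 / (2 d)`.
The step `X k` here is the `(k + 1)`-st step of the walk. -/
structure IsSimpleWalkSteps {Ω : Type*} [MeasurableSpace Ω] (P : Measure Ω) (d : ℕ)
    (X : ℕ → Ω → (Fin d → ℤ)) : Prop where
  measurable : ∀ k, Measurable (X k)
  indep : iIndepFun X P
  prob_pos : ∀ k (i : Fin d),
    P {ω | X k ω = (Pi.single i 1 : Fin d → ℤ)} = ENNReal.ofReal (1 / (2 * (d : ℝ)))
  prob_neg : ∀ k (i : Fin d),
    P {ω | X k ω = -(Pi.single i 1 : Fin d → ℤ)} = ENNReal.ofReal (1 / (2 * (d : ℝ)))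

/-- The walk `S_n = X_1 + ⋯ + X_n` started at the origin, as a path depending on `ω`. -/
def walk {Ω : Type*} {d : ℕ} (X : ℕ → Ω → (Fin d → ℤ)) (ω : Ω) (n : ℕ) : Fin d → ℤ :=
  ∑ k ∈ Finset.range n, X k ω

/-- The local time `ξ(x, n)`: the number of times `0 < k ≤ n` at which the path `s` is at `x`. -/
def localTime {d : ℕ} (s : ℕ → (Fin d → ℤ)) (x : Fin d → ℤ) (n : ℕ) : ℕ :=
  ((Finset.Ioc 0 n).filter fun k => s k = x).card

/-- The total local time `ξ(x, ∞)`, possibly infinite. -/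
def totalLocalTime {d : ℕ} (s : ℕ → (Fin d → ℤ)) (x : Fin d → ℤ) : ℕ∞ :=
  Set.encard {k : ℕ | 0 < k ∧ s k = x}

/-- `Q(k, n)`: the number of sites visited exactly `k` times up to time `n` (used for `k ≥ 1`,
where the set of these sites is finite). -/
def Q {d : ℕ} (s : ℕ → (Fin d → ℤ)) (k n : ℕ) : ℕ :=
  Set.ncard {x : Fin d → ℤ | localTime s x n = k}

/-- `U(k, n)`: the number of sites visited up to time `n` (a finite set) which are visited exactly
`k` times by the infinite path. -/
def U {d : ℕ} (s : ℕ → (Fin d → ℤ)) (k n : ℕ) : ℕ :=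
  Set.ncard {x : Fin d → ℤ | 0 < localTime s x n ∧ (localTime s x n : ℕ∞) ≤ totalLocalTime s x ∧
    totalLocalTime s x = (k : ℕ∞)}

/-- `R(k, n) = ∑_{j ≥ k} Q(j, n)`; only finitely many terms are non-zero. -/
def R {d : ℕ} (s : ℕ → (Fin d → ℤ)) (k n : ℕ) : ℕ :=
  ∑' j : Set.Ici k, Q s j n

/-- `V(k, n) = ∑_{j ≥ k} U(j, n)`; only finitely many terms are non-zero. -/
def V {d : ℕ} (s : ℕ → (Fin d → ℤ)) (k n : ℕ) : ℕ :=
  ∑' j : Set.Ici k, U s j n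

/-- `γ`: the probability that the walk with steps `X` never returns to its starting point. -/
def nonReturnProb {Ω : Type*} [MeasurableSpace Ω] (P : Measure Ω) {d : ℕ}
    (X : ℕ → Ω → (Fin d → ℤ)) : ℝ :=
  P.real {ω | ∀ n : ℕ, 0 < n → walk X ω n ≠ 0}

/-- `μ(t) = γ (1 - γ)^(t - 1)` for `t ≥ 1`. -/
def mu (γ : ℝ) (t : ℕ) : ℝ := γ * (1 - γ) ^ (t - 1)

/-- `λ = -1 / log (1 - γ)`. -/
def lam (γ : ℝ) : ℝ := -1 / Real.log (1 - γ)

/-- `ψ(n, B) = λ log n - λ B log log n`. -/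
def psi (γ B : ℝ) (n : ℕ) : ℝ :=
  lam γ * Real.log n - lam γ * B * Real.log (Real.log n)

/-- `t_n = [ψ(n, B)]` (replaced by `0` if `ψ(n, B) < 0`; there are no positive integers `t ≤ t_n`
in either case). -/
def tn (γ B : ℝ) (n : ℕ) : ℕ := ⌊psi γ B n⌋₊

/-- `sup_{1 ≤ t ≤ m} |f(t) - 1|`, with `t` running through positive integers. The index set is
finite; the value is `0` if it is empty. -/
def supDev (m : ℕ) (f : ℕ → ℝ) : ℝ := ⨆ t : Set.Icc 1 m, |f t - 1|

end HeavyPoints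

end

/-! Put q = 1 - γ, the return probability, and s = t - 1. Each site counted by R(s+1, n) or V(s+1,
n) can be charged to the time of its first visit. At such a time the walk stands on a site it has
not met before, which has probability about 1 - q, and then returns there at least s times, which
has probability q^s by the Markov property. So both counts should be near n(1-q)q^s = nμ(t).

To make this local, take a window m of polylogarithmic length and call a time tagged if its site is
new within the last m steps and is revisited at least s times in the next m steps. Tagging depends
on 2m steps and is stationary. The heat kernel bound P(S_n = y) ≤ C n^(-3/2), the only deep use of d
≥ 3, shows that windowing costs a relative error of order (s²+1)/√m + m/n: the number of tagged
times bounds R from below and V from above up to errors of small mean (`tagCount_le_R`,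
`V_le_tagCount`).

The variance is the core. Tagged events at distance at least 2m are independent. For closer ones,
let y be the displacement between the two tagged sites; newness of the second site makes the events
with the same y disjoint within each of two ranges of time lags. It remains to sum over y the
probability that 0 has s returns and y has s + 1 visits. Together these are 2s + 1 visits to the
pair {0, y}, whose number has a geometric tail with ratio q + O(|y|^(-1/2)). A bounded set of y
contributes O(q^s), the intermediate y no more in total, and each y with |y| > s² only O(q^(2s))
(`exists_sum_bothVisited_le`). Hence the relative variance is O(1/(n q^s) + m^d/n).

For n q^s ≥ c (log n)^b with 2 < b ≤ 3 this is O((log n)^(-b)). Only O(log n) levels s qualify, so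
the deviations summed over levels have mean O((log n)^(1-b)); weighted by 1/n these means are
summable because b > 2. Almost surely, therefore, each interval [N, (1+η)N] with N large contains a
time at which all levels are good simultaneously. Since R and V are monotone in n and R ≤ V almost
surely, other times follow by comparison (`eventually_R_V`). The bound t ≤ t_n says that (log n)^B ≤
n q^t, and Q and U are differences of consecutive R and V. -/

open MeasureTheory ProbabilityTheory Filter Topology

/-! ### Path space: events of finitely many steps, stationarity and independence -/

namespace HeavyPoints

/-- Sequences of steps. -/
abbrev Path (d : ℕ) : Type := ℕ → (Fin d → ℤ)

/-- The position after `n` steps. -/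
def pos {d : ℕ} (x : Path d) (n : ℕ) : Fin d → ℤ := ∑ k ∈ Finset.range n, x k

/-- The steps from time `a` on. -/
def shift {d : ℕ} (a : ℕ) (x : Path d) : Path d := fun k => x (a + k)

/-- The first `a` steps, continued by zeros. -/
def past {d : ℕ} (a : ℕ) (x : Path d) : Path d := fun k => if k < a then x k else 0

/-- `A` depends on the first `a` steps only. -/
def Determined {d : ℕ} (a : ℕ) (A : Set (Path d)) : Prop :=
  ∀ x y : Path d, (∀ k < a, x k = y k) → x ∈ A → y ∈ A

/-- The law of a sequence of independent identically distributed steps, as it is used here. -/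
structure IsIIDLaw {d : ℕ} (μ : Measure (Path d)) : Prop where
  prob : IsProbabilityMeasure μ
  map_shift : ∀ a, μ.map (shift a) = μ
  indep : ∀ a, IndepFun (past a) (shift a) μ

variable {d : ℕ}

@[simp] lemma pos_zero (x : Path d) : pos x 0 = 0 := by simp [pos]

lemma pos_shift (a : ℕ) (x : Path d) (n : ℕ) : pos (shift a x) n = pos x (a + n) - pos x a := by
  simp [pos, shift, Finset.sum_range_add]

lemma pos_add (a : ℕ) (x : Path d) (n : ℕ) : pos x (a + n) = pos x a + pos (shift a x) n := by
  rw [pos_shift]; abel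

lemma pos_congr {a : ℕ} {x y : Path d} (h : ∀ k < a, x k = y k) {n : ℕ} (hn : n ≤ a) :
    pos x n = pos y n :=
  Finset.sum_congr rfl fun k hk => h k ((Finset.mem_range.1 hk).trans_le hn)

lemma shift_shift (a b : ℕ) (x : Path d) : shift a (shift b x) = shift (b + a) x := by
  ext k; simp [shift, add_assoc]

lemma measurable_shift (a : ℕ) : Measurable (shift a : Path d → Path d) :=
  measurable_pi_lambda _ fun _ => measurable_pi_apply _

lemma measurable_past (a : ℕ) : Measurable (past a : Path d → Path d) := by
  refine measurable_pi_lambda _ fun k => ?_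
  by_cases h : k < a
  · simpa [past, h] using measurable_pi_apply k
  · simp [past, h]

namespace Determined

lemma mono {a b : ℕ} {A : Set (Path d)} (h : Determined a A) (hab : a ≤ b) : Determined b A :=
  fun x y hxy => h x y fun k hk => hxy k (hk.trans_le hab)

lemma inter {a : ℕ} {A B : Set (Path d)} (hA : Determined a A) (hB : Determined a B) :
    Determined a (A ∩ B) :=
  fun x y hxy hx => ⟨hA x y hxy hx.1, hB x y hxy hx.2⟩

lemma preimage_shift {a : ℕ} {A : Set (Path d)} (h : Determined a A) (b : ℕ) :
    Determined (b + a) (shift b ⁻¹' A) :=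
  fun x y hxy hx => h _ _ (fun k hk => hxy (b + k) (by omega)) hx

lemma past_preimage {a : ℕ} {A : Set (Path d)} (h : Determined a A) : past a ⁻¹' A = A := by
  ext x
  exact ⟨h _ _ fun k hk => by simp [past, hk], h _ _ fun k hk => by simp [past, hk]⟩

/-- Such an event is the preimage of a set of initial segments, and there are only countably many
initial segments. -/
lemma measurableSet {a : ℕ} {A : Set (Path d)} (h : Determined a A) : MeasurableSet A := by
  let r : Path d → (Fin a → (Fin d → ℤ)) := fun x k => x k
  have hr : Measurable r := measurable_pi_lambda _ fun _ => measurable_pi_apply _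
  have : A = r ⁻¹' (r '' A) := by
    refine Set.Subset.antisymm (Set.subset_preimage_image _ _) ?_
    rintro x ⟨y, hy, hxy⟩
    exact h y x (fun k hk => congrFun hxy ⟨k, hk⟩) hy
  rw [this]
  exact hr (Set.to_countable _).measurableSet

end Determined

lemma determined_of_pos {a : ℕ} (p : (ℕ → Fin d → ℤ) → Prop)
    (h : ∀ s s' : ℕ → Fin d → ℤ, (∀ k ≤ a, s k = s' k) → p s → p s') :
    Determined a {x : Path d | p (pos x)} :=
  fun _ _ hxy => h _ _ fun _ hk => pos_congr hxy hk

lemma determined_pos_eq (n : ℕ) (y : Fin d → ℤ) : Determined n {x : Path d | pos x n = y} :=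
  determined_of_pos (fun s => s n = y) fun s s' h hs => by rw [← h n le_rfl, hs]

namespace IsIIDLaw

variable {μ : Measure (Path d)}

lemma real_shift (hμ : IsIIDLaw μ) (a : ℕ) {A : Set (Path d)} (hA : MeasurableSet A) :
    μ.real (shift a ⁻¹' A) = μ.real A := by
  rw [← map_measureReal_apply (measurable_shift a) hA, hμ.map_shift]

/-- The Markov property at a deterministic time. Since first-hit events at time r depend on r steps
only, summing this over r replaces the strong Markov property throughout. -/
lemma real_inter_shift (hμ : IsIIDLaw μ) {a : ℕ} {A B : Set (Path d)} (hA : Determined a A)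
    (hB : MeasurableSet B) : μ.real (A ∩ shift a ⁻¹' B) = μ.real A * μ.real B := by
  have := (indepFun_iff_measure_inter_preimage_eq_mul.1 (hμ.indep a)) _ _ hA.measurableSet hB
  rw [hA.past_preimage] at this
  rw [measureReal_def, this, ENNReal.toReal_mul, ← hμ.real_shift a hB]
  rfl

end IsIIDLaw

/-- Stationarity holds because the sequence and its shift both have the product law. Independence
holds because past and future are measurable with respect to disjoint families of steps. -/
lemma isIIDLaw_map {Ω : Type*} [MeasurableSpace Ω] {P : Measure Ω}
    [IsProbabilityMeasure P] {X : ℕ → Ω → (Fin d → ℤ)} (hm : ∀ k, Measurable (X k))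
    (hi : iIndepFun X P) (hid : ∀ k, P.map (X k) = P.map (X 0)) :
    IsIIDLaw (P.map fun ω k => X k ω) := by
  have hX : Measurable fun ω k => X k ω := measurable_pi_lambda _ hm
  refine ⟨Measure.isProbabilityMeasure_map hX.aemeasurable, fun a => ?_, fun a => ?_⟩
  · rw [Measure.map_map (measurable_shift a) hX]
    have h1 := (hi.precomp (add_right_injective a)).map_fun_eq_infinitePi_map fun k => hm (a + k)
    have h2 := hi.map_fun_eq_infinitePi_map hm
    rw [h2]
    change P.map (fun ω i => X (a + i) ω) = _
    rw [h1]
    simp_rw [hid]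
  · have h1 : IndepFun (past a ∘ fun ω k => X k ω) (shift a ∘ fun ω k => X k ω) P := by
      have := indep_iSup_of_disjoint (fun k => (hm k).comap_le) ((iIndepFun_iff_iIndep _ _ _).1 hi)
        (S := {k | k < a}) (T := {k | a ≤ k})
        (Set.disjoint_left.2 fun k hk hk' => absurd hk (not_lt.2 (show a ≤ k from hk')))
      refine indep_of_indep_of_le_left (indep_of_indep_of_le_right this ?_) ?_
      · rw [← measurable_iff_comap_le]
        refine @measurable_pi_lambda _ _ _ (_) _ _ fun k => ?_
        have hk : MeasurableSpace.comap (X (a + k)) inferInstance ≤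
            ⨆ i ∈ {k | a ≤ k}, MeasurableSpace.comap (X i) inferInstance :=
          le_iSup₂_of_le (a + k) (by simp) le_rfl
        exact measurable_iff_comap_le.2 hk
      · rw [← measurable_iff_comap_le]
        refine @measurable_pi_lambda _ _ _ (_) _ _ fun k => ?_
        by_cases h : k < a
        · have hk : MeasurableSpace.comap (X k) inferInstance ≤
              ⨆ i ∈ {k | k < a}, MeasurableSpace.comap (X i) inferInstance :=
            le_iSup₂_of_le k h le_rfl
          simpa [past, h] using measurable_iff_comap_le.2 hk
        · simp [past, h]
    rw [indepFun_iff_measure_inter_preimage_eq_mul] at h1 ⊢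
    intro s t hs ht
    rw [Measure.map_apply hX (((measurable_past a) hs).inter ((measurable_shift a) ht)),
      Measure.map_apply hX ((measurable_past a) hs), Measure.map_apply hX ((measurable_shift a) ht)]
    exact h1 s t hs ht

end HeavyPoints

/-! ### First-hit decomposition and geometric bounds for numbers of visits -/

namespace HeavyPoints

variable {d : ℕ}

/-- The number of visits to `A` at times `0 < k ≤ n` of the walk started at `z`. -/
def visits (A : Finset (Fin d → ℤ)) (z : Fin d → ℤ) (n : ℕ) (x : Path d) : ℕ :=
  ((Finset.Ioc 0 n).filter fun k => z + pos x k ∈ A).card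

/-- The walk started at `z` enters `A` for the first time at time `r`, at the point `w`. -/
def firstHit (A : Finset (Fin d → ℤ)) (z : Fin d → ℤ) (r : ℕ) (w : Fin d → ℤ) : Set (Path d) :=
  {x | z + pos x r = w ∧ ∀ i, 0 < i → i < r → z + pos x i ∉ A}

/-- The number of returns to the origin up to time `n`. -/
abbrev returns (n : ℕ) (x : Path d) : ℕ := visits {0} 0 n x

lemma determined_visits_le (A : Finset (Fin d → ℤ)) (z : Fin d → ℤ) (n s : ℕ) :
    Determined n {x : Path d | s ≤ visits A z n x} := by
  refine determined_of_pos
    (fun p => s ≤ ((Finset.Ioc 0 n).filter fun k => z + p k ∈ A).card) fun p p' h hp => ?_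
  rwa [Finset.filter_congr (q := fun k => z + p k ∈ A)]
  intro k hk
  rw [h k (Finset.mem_Ioc.1 hk).2]

lemma determined_firstHit (A : Finset (Fin d → ℤ)) (z : Fin d → ℤ) (r : ℕ) (w : Fin d → ℤ) :
    Determined r (firstHit A z r w) := by
  refine determined_of_pos
    (fun p => z + p r = w ∧ ∀ i, 0 < i → i < r → z + p i ∉ A) fun p p' h hp => ?_
  refine ⟨by rw [← h r le_rfl]; exact hp.1, fun i h0 hi => ?_⟩
  rw [← h i hi.le]
  exact hp.2 i h0 hi

lemma visits_add (A : Finset (Fin d → ℤ)) (z : Fin d → ℤ) (a b : ℕ) (x : Path d) :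
    visits A z (a + b) x = visits A z a x + visits A (z + pos x a) b (shift a x) := by
  have h1 : Finset.Ioc 0 (a + b) = Finset.Ioc 0 a ∪ (Finset.Ioc 0 b).map (addLeftEmbedding a) := by
    rw [Finset.map_add_left_Ioc, add_zero, Finset.Ioc_union_Ioc_eq_Ioc (by omega) (by omega)]
  have h2 : Disjoint (Finset.Ioc 0 a) ((Finset.Ioc 0 b).map (addLeftEmbedding a)) := by
    rw [Finset.map_add_left_Ioc, add_zero]
    exact Finset.Ioc_disjoint_Ioc_of_le le_rfl
  unfold visits
  rw [h1, Finset.filter_union, Finset.card_union_of_disjoint (Finset.disjoint_filter_filter h2),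
    Finset.filter_map, Finset.card_map]
  congr 2
  refine Finset.filter_congr fun k _ => ?_
  simp [pos_add, add_assoc]

lemma visits_mono (A : Finset (Fin d → ℤ)) (z : Fin d → ℤ) (x : Path d) :
    Monotone fun n => visits A z n x := fun a b hab => by
  obtain ⟨c, rfl⟩ := Nat.exists_eq_add_of_le hab
  simp only [visits_add]; omega

lemma visits_firstHit {A : Finset (Fin d → ℤ)} {z w : Fin d → ℤ} {r : ℕ} (hr : 0 < r) (hw : w ∈ A)
    {x : Path d} (hx : x ∈ firstHit A z r w) : visits A z r x = 1 := by
  unfold visits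
  rw [Finset.card_eq_one]
  refine ⟨r, ?_⟩
  ext k
  simp only [Finset.mem_filter, Finset.mem_Ioc, Finset.mem_singleton]
  refine ⟨fun h => ?_, ?_⟩
  · by_contra hk
    exact hx.2 k h.1.1 (by omega) h.2
  · rintro rfl
    exact ⟨⟨hr, le_rfl⟩, by rw [hx.1]; exact hw⟩

lemma visits_firstHit_add {A : Finset (Fin d → ℤ)} {z w : Fin d → ℤ} {r n : ℕ} (hr : 0 < r)
    (hrn : r ≤ n) (hw : w ∈ A) {x : Path d} (hx : x ∈ firstHit A z r w) :
    visits A z n x = 1 + visits A w (n - r) (shift r x) := by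
  obtain ⟨c, rfl⟩ := Nat.exists_eq_add_of_le hrn
  rw [visits_add, visits_firstHit hr hw hx, hx.1]
  simp

lemma exists_firstHit {A : Finset (Fin d → ℤ)} {z : Fin d → ℤ} {n : ℕ} {x : Path d}
    (hx : 1 ≤ visits A z n x) : ∃ p ∈ Finset.Ioc 0 n ×ˢ A, x ∈ firstHit A z p.1 p.2 := by
  have hex : ∃ k, 0 < k ∧ z + pos x k ∈ A := by
    obtain ⟨k, hk⟩ := Finset.card_pos.1 hx
    rw [Finset.mem_filter, Finset.mem_Ioc] at hk
    exact ⟨k, hk.1.1, hk.2⟩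
  classical
  refine ⟨(Nat.find hex, z + pos x (Nat.find hex)), ?_, rfl, fun i h0 hi h => ?_⟩
  · rw [Finset.mem_product, Finset.mem_Ioc]
    refine ⟨⟨(Nat.find_spec hex).1, ?_⟩, (Nat.find_spec hex).2⟩
    obtain ⟨k, hk⟩ := Finset.card_pos.1 hx
    rw [Finset.mem_filter, Finset.mem_Ioc] at hk
    exact (Nat.find_min' hex ⟨hk.1.1, hk.2⟩).trans hk.1.2
  · exact Nat.find_min hex hi ⟨h0, h⟩

lemma firstHit_disjoint (A : Finset (Fin d → ℤ)) (z : Fin d → ℤ) (n : ℕ) :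
    (↑(Finset.Ioc 0 n ×ˢ A) : Set (ℕ × (Fin d → ℤ))).PairwiseDisjoint
      fun p => firstHit A z p.1 p.2 := by
  rintro ⟨r, w⟩ h ⟨r', w'⟩ h' hne
  simp only [Finset.coe_product, Finset.coe_Ioc, Set.mem_prod, Set.mem_Ioc, Finset.mem_coe] at h h'
  refine Set.disjoint_left.2 fun x hx hx' => hne ?_
  have hrr : r = r' := by
    rcases lt_trichotomy r r' with hlt | heq | hgt
    · exact absurd (by rw [hx.1]; exact h.2) (hx'.2 r h.1.1 hlt)
    · exact heq
    · exact absurd (by rw [hx'.1]; exact h'.2) (hx.2 r' h'.1.1 hgt)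
  subst hrr
  exact Prod.ext rfl (hx.1.symm.trans hx'.1)

/-- The first hitting time and place partition the event that `A` is hit at all. -/
lemma sum_firstHit {μ : Measure (Path d)} [IsProbabilityMeasure μ] (A : Finset (Fin d → ℤ))
    (z : Fin d → ℤ) (n : ℕ) :
    ∑ p ∈ Finset.Ioc 0 n ×ˢ A, μ.real (firstHit A z p.1 p.2) =
      μ.real {x | 1 ≤ visits A z n x} := by
  rw [← measureReal_biUnion_finset (firstHit_disjoint A z n)
    fun p _ => (determined_firstHit A z p.1 p.2).measurableSet]
  congr 1
  ext x
  simp only [Set.mem_iUnion, exists_prop, Set.mem_ofPred_eq]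
  refine ⟨?_, exists_firstHit⟩
  rintro ⟨⟨r, w⟩, hp, hx⟩
  rw [Finset.mem_product, Finset.mem_Ioc] at hp
  rw [visits_firstHit_add hp.1.1 hp.1.2 hp.2 hx]
  omega

lemma measureReal_iUnion_le_of_monotone {α : Type*} [MeasurableSpace α] {μ : Measure α}
    [IsFiniteMeasure μ] {s : ℕ → Set α} (hs : Monotone s) {c : ℝ} (h : ∀ n, μ.real (s n) ≤ c) :
    μ.real (⋃ n, s n) ≤ c := by
  have := tendsto_measure_iUnion_atTop (μ := μ) hs
  exact le_of_tendsto ((ENNReal.tendsto_toReal (measure_ne_top _ _)).comp this)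
    (Eventually.of_forall h)

namespace IsIIDLaw

variable {μ : Measure (Path d)}

/-- Restart the walk at each visit: from any point of `A` another visit has probability at most c.
It is applied to {0} and to pairs {0, y}. -/
lemma visits_le_pow (hμ : IsIIDLaw μ) {A : Finset (Fin d → ℤ)} {c : ℝ} (hc0 : 0 ≤ c)
    (hc : ∀ z ∈ A, ∀ n, μ.real {x | 1 ≤ visits A z n x} ≤ c) (s : ℕ) :
    ∀ z ∈ A, ∀ n, μ.real {x | s ≤ visits A z n x} ≤ c ^ s := by
  have := hμ.prob
  induction s with
  | zero => intro z _ n; simp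
  | succ s ih =>
    intro z hz n
    have hsub : {x | s + 1 ≤ visits A z n x} ⊆ ⋃ p ∈ Finset.Ioc 0 n ×ˢ A,
        firstHit A z p.1 p.2 ∩ shift p.1 ⁻¹' {x | s ≤ visits A p.2 (n - p.1) x} := by
      intro x hx
      obtain ⟨p, hp, hxp⟩ := exists_firstHit (le_trans (Nat.le_add_left 1 s) hx)
      refine Set.mem_biUnion hp ⟨hxp, ?_⟩
      rw [Finset.mem_product, Finset.mem_Ioc] at hp
      have h1 := visits_firstHit_add hp.1.1 hp.1.2 hp.2 hxp
      have h2 : s + 1 ≤ visits A z n x := hx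
      change s ≤ visits A p.2 (n - p.1) (shift p.1 x)
      omega
    calc μ.real {x | s + 1 ≤ visits A z n x}
        ≤ ∑ p ∈ Finset.Ioc 0 n ×ˢ A, μ.real (firstHit A z p.1 p.2 ∩
            shift p.1 ⁻¹' {x | s ≤ visits A p.2 (n - p.1) x}) :=
          (measureReal_mono hsub (measure_ne_top _ _)).trans (measureReal_biUnion_finset_le _ _)
      _ ≤ ∑ p ∈ Finset.Ioc 0 n ×ˢ A, μ.real (firstHit A z p.1 p.2) * c ^ s := by
          refine Finset.sum_le_sum fun p hp => ?_
          rw [hμ.real_inter_shift (determined_firstHit A z p.1 p.2)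
            (determined_visits_le A _ _ s).measurableSet]
          exact mul_le_mul_of_nonneg_left (ih _ (Finset.mem_product.1 hp).2 _) measureReal_nonneg
      _ ≤ c ^ (s + 1) := by
          rw [← Finset.sum_mul, sum_firstHit, pow_succ']
          exact mul_le_mul_of_nonneg_right (hc z hz n) (pow_nonneg hc0 _)

/-- Concatenating s successive first returns, each taking at most n steps, gives s returns within sn
steps. Disjointness of the first-hit events turns the sum into a lower bound. -/
lemma pow_le_returns (hμ : IsIIDLaw μ) (n s : ℕ) :
    μ.real {x | 1 ≤ returns n x} ^ s ≤ μ.real {x | s ≤ returns (s * n) x} := by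
  have := hμ.prob
  induction s with
  | zero => simp
  | succ s ih =>
    have hsub : (⋃ p ∈ Finset.Ioc 0 n ×ˢ ({0} : Finset (Fin d → ℤ)),
        firstHit {0} 0 p.1 p.2 ∩ shift p.1 ⁻¹' {x | s ≤ returns (s * n) x}) ⊆
        {x | s + 1 ≤ returns ((s + 1) * n) x} := by
      refine Set.iUnion₂_subset fun p hp x hx => ?_
      rw [Finset.mem_product, Finset.mem_Ioc, Finset.mem_singleton] at hp
      have h1 := visits_firstHit_add (n := (s + 1) * n) hp.1.1
        (hp.1.2.trans (by nlinarith)) (by simp [hp.2]) hx.1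
      have h2 : s ≤ visits {0} 0 (s * n) (shift p.1 x) := hx.2
      have h3 := visits_mono {0} 0 (shift p.1 x)
        (show s * n ≤ (s + 1) * n - p.1 by rw [add_mul]; omega)
      simp only [hp.2] at h1 h3
      change s + 1 ≤ visits {0} 0 ((s + 1) * n) x
      omega
    have hdis : (↑(Finset.Ioc 0 n ×ˢ ({0} : Finset (Fin d → ℤ))) :
        Set (ℕ × (Fin d → ℤ))).PairwiseDisjoint fun p =>
        firstHit {0} 0 p.1 p.2 ∩ shift p.1 ⁻¹' {x | s ≤ returns (s * n) x} :=
      (firstHit_disjoint {0} 0 n).mono fun p => Set.inter_subset_left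
    calc μ.real {x | 1 ≤ returns n x} ^ (s + 1)
        ≤ (∑ p ∈ Finset.Ioc 0 n ×ˢ ({0} : Finset (Fin d → ℤ)),
            μ.real (firstHit {0} 0 p.1 p.2)) * μ.real {x | s ≤ returns (s * n) x} := by
          rw [sum_firstHit, pow_succ']
          exact mul_le_mul_of_nonneg_left ih measureReal_nonneg
      _ = ∑ p ∈ Finset.Ioc 0 n ×ˢ ({0} : Finset (Fin d → ℤ)), μ.real (firstHit {0} 0 p.1 p.2 ∩
            shift p.1 ⁻¹' {x | s ≤ returns (s * n) x}) := by
          rw [Finset.sum_mul]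
          refine Finset.sum_congr rfl fun p _ => ?_
          rw [hμ.real_inter_shift (determined_firstHit _ _ _ _)
            (determined_visits_le _ _ _ s).measurableSet]
      _ = μ.real (⋃ p ∈ Finset.Ioc 0 n ×ˢ ({0} : Finset (Fin d → ℤ)),
            firstHit {0} 0 p.1 p.2 ∩ shift p.1 ⁻¹' {x | s ≤ returns (s * n) x}) := by
          refine (measureReal_biUnion_finset hdis fun p _ => ?_).symm
          exact (determined_firstHit _ _ _ _).measurableSet.inter
            (measurable_shift _ (determined_visits_le _ _ _ s).measurableSet)
      _ ≤ _ := measureReal_mono hsub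

end IsIIDLaw

end HeavyPoints

/-! ### Transience and hitting estimates from the heat kernel bound -/

namespace HeavyPoints

variable {d : ℕ}

/-- The maximum norm. -/
def nrm (y : Fin d → ℤ) : ℕ := Finset.univ.sup fun i => (y i).natAbs

/-- What is used of the law of the steps of a simple random walk in dimension at least three. -/
structure IsTransientLaw (μ : Measure (Path d)) (C : ℝ) : Prop extends IsIIDLaw μ where
  heat : ∀ (n : ℕ) (y : Fin d → ℤ),
    μ.real {x | pos x n = y} ≤ C * (1 / ((n + 1 : ℝ) * √(n + 1)))
  range : ∀ (n : ℕ) (y : Fin d → ℤ), n < nrm y → μ.real {x | pos x n = y} = 0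
  return_two : 0 < μ.real {x | pos x 2 = 0}

/-- The probability of a return to the origin. -/
def returnProb (μ : Measure (Path d)) : ℝ := μ.real {x | ∃ n : ℕ, 0 < n ∧ pos x n = 0}

/-- Comparison with a telescoping difference, so that the tail of the series ∑ k^(-3/2) is of order
m^(-1/2). -/
lemma inv_mul_sqrt_le (k : ℕ) (hk : 0 < k) :
    1 / ((k + 1 : ℝ) * √(k + 1)) ≤ 2 * (1 / √k - 1 / √(k + 1)) := by
  have hk' : (0 : ℝ) < k := by exact_mod_cast hk
  set a := √(k : ℝ) with ha
  set b := √((k : ℝ) + 1) with hb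
  have ha0 : 0 < a := Real.sqrt_pos.2 hk'
  have hb0 : 0 < b := Real.sqrt_pos.2 (by linarith)
  have ha2 : a * a = k := Real.mul_self_sqrt hk'.le
  have hb2 : b * b = k + 1 := Real.mul_self_sqrt (by linarith)
  have hab : a ≤ b := Real.sqrt_le_sqrt (by linarith)
  have h1 : 1 / a - 1 / b = 1 / (a * b * (a + b)) := by
    field_simp
    nlinarith
  rw [h1, ← hb2, mul_one_div, div_le_div_iff₀ (by positivity) (by positivity)]
  have : a * b * (a + b) ≤ b * b * (b + b) := by gcongr
  linarith

lemma sum_inv_mul_sqrt_le (m N : ℕ) :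
    ∑ k ∈ Finset.Ico (m + 1) N, 1 / ((k + 1 : ℝ) * √(k + 1)) ≤ 2 / √(m + 1 : ℝ) := by
  rcases le_or_gt (m + 1) N with h | h
  · calc ∑ k ∈ Finset.Ico (m + 1) N, 1 / ((k + 1 : ℝ) * √(k + 1))
        ≤ ∑ k ∈ Finset.Ico (m + 1) N, -(2 * (1 / √((k + 1 : ℕ) : ℝ)) - 2 * (1 / √k)) := by
          refine Finset.sum_le_sum fun k hk => ?_
          have := inv_mul_sqrt_le k (by have := Finset.mem_Ico.1 hk; omega)
          push_cast
          linarith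
      _ = 2 * (1 / √((m + 1 : ℕ) : ℝ)) - 2 * (1 / √(N : ℝ)) := by
          rw [Finset.sum_neg_distrib, Finset.sum_Ico_sub (fun k : ℕ => 2 * (1 / √(k : ℝ))) h]
          ring
      _ ≤ 2 / √(m + 1 : ℝ) := by
          have : 0 ≤ 2 * (1 / √(N : ℝ)) := by positivity
          push_cast
          have e := mul_one_div (2 : ℝ) (√(m + 1 : ℝ))
          linarith
  · rw [Finset.Ico_eq_empty (by omega), Finset.sum_empty]
    positivity

lemma mem_union_hit (x : Path d) (y : Fin d → ℤ) (m : ℕ) :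
    (∃ k, m < k ∧ pos x k = y) ↔ x ∈ ⋃ N : ℕ, ⋃ k ∈ Finset.Ico (m + 1) N, {x | pos x k = y} := by
  simp only [Set.mem_iUnion, Finset.mem_Ico, exists_prop]
  constructor
  · rintro ⟨k, hk, hx⟩
    exact ⟨k + 1, k, ⟨hk, Nat.lt_succ_self k⟩, hx⟩
  · rintro ⟨N, k, hk, hx⟩
    exact ⟨k, hk.1, hx⟩

lemma measurableSet_exists_hit (y : Fin d → ℤ) (m : ℕ) :
    MeasurableSet {x : Path d | ∃ k, m < k ∧ pos x k = y} := by
  have : {x : Path d | ∃ k, m < k ∧ pos x k = y} = ⋃ k, ⋃ (_ : m < k), {x | pos x k = y} := by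
    ext x
    simp only [Set.mem_iUnion, exists_prop]
    rfl
  rw [this]
  exact .iUnion fun k => .iUnion fun _ => (determined_pos_eq k y).measurableSet

lemma one_le_returns_iff (n : ℕ) (x : Path d) :
    1 ≤ returns n x ↔ ∃ k, 0 < k ∧ k ≤ n ∧ pos x k = 0 := by
  unfold returns visits
  rw [Nat.one_le_iff_ne_zero, ← Nat.pos_iff_ne_zero, Finset.card_pos]
  simp [Finset.Nonempty, and_assoc]

namespace IsTransientLaw

variable {μ : Measure (Path d)} {C : ℝ}

lemma C_pos (hμ : IsTransientLaw μ C) : 0 < C := by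
  have h := hμ.return_two.trans_le (hμ.heat 2 0)
  by_contra hC
  have : C * (1 / (((2 : ℕ) + 1 : ℝ) * √((2 : ℕ) + 1))) ≤ 0 :=
    mul_nonpos_of_nonpos_of_nonneg (not_lt.1 hC) (by positivity)
  linarith

lemma hit_after (hμ : IsTransientLaw μ C) (y : Fin d → ℤ) (m : ℕ) :
    μ.real {x | ∃ k, m < k ∧ pos x k = y} ≤ 2 * C / √(m + 1 : ℝ) := by
  have := hμ.prob
  have h : {x | ∃ k, m < k ∧ pos x k = y} =
      ⋃ N : ℕ, ⋃ k ∈ Finset.Ico (m + 1) N, {x | pos x k = y} :=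
    Set.ext fun x => mem_union_hit x y m
  rw [h]
  refine measureReal_iUnion_le_of_monotone (fun a b hab => ?_) fun N => ?_
  · exact Set.biUnion_subset_biUnion_left fun k hk => Finset.Ico_subset_Ico le_rfl hab hk
  · calc _ ≤ ∑ k ∈ Finset.Ico (m + 1) N, μ.real {x | pos x k = y} :=
          measureReal_biUnion_finset_le _ _
      _ ≤ ∑ k ∈ Finset.Ico (m + 1) N, C * (1 / ((k + 1 : ℝ) * √(k + 1))) :=
          Finset.sum_le_sum fun k _ => hμ.heat k y
      _ ≤ C * (2 / √(m + 1 : ℝ)) := by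
          rw [← Finset.mul_sum]
          exact mul_le_mul_of_nonneg_left (sum_inv_mul_sqrt_le m N) hμ.C_pos.le
      _ = _ := by ring

/-- The walk needs at least |y| steps to reach y, so only the tail of the heat kernel series from
time |y| on contributes. -/
lemma hit_far (hμ : IsTransientLaw μ C) {y : Fin d → ℤ} (hy : 0 < nrm y) :
    μ.real {x | ∃ k, 0 < k ∧ pos x k = y} ≤ 2 * C / √(nrm y : ℝ) := by
  have := hμ.prob
  have h : {x | ∃ k, 0 < k ∧ pos x k = y} ⊆
      (⋃ k ∈ Finset.range (nrm y), {x | pos x k = y}) ∪ {x | ∃ k, nrm y - 1 < k ∧ pos x k = y} := by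
    rintro x ⟨k, hk, hx⟩
    by_cases hlt : k < nrm y
    · exact Or.inl (Set.mem_biUnion (Finset.mem_range.2 hlt) hx)
    · exact Or.inr ⟨k, by omega, hx⟩
  have h0 : μ.real (⋃ k ∈ Finset.range (nrm y), {x | pos x k = y}) ≤ 0 :=
    (measureReal_biUnion_finset_le _ _).trans
      (Finset.sum_nonpos fun k hk => (hμ.range k y (Finset.mem_range.1 hk)).le)
  have h1 := hμ.hit_after y (nrm y - 1)
  have h2 : ((nrm y - 1 : ℕ) : ℝ) + 1 = nrm y := by
    exact_mod_cast Nat.succ_pred_eq_of_pos hy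
  rw [h2] at h1
  have h3 := (measureReal_mono h (measure_ne_top μ _)).trans (measureReal_union_le _ _)
  linarith

lemma returns_le (hμ : IsTransientLaw μ C) (n : ℕ) :
    μ.real {x | 1 ≤ returns n x} ≤ returnProb μ := by
  have := hμ.prob
  refine measureReal_mono (fun x hx => ?_)
  obtain ⟨k, h0, _, hk⟩ := (one_le_returns_iff n x).1 hx
  exact ⟨k, h0, hk⟩

lemma returnProb_sub_le (hμ : IsTransientLaw μ C) (n : ℕ) :
    returnProb μ - μ.real {x | 1 ≤ returns n x} ≤ 2 * C / √(n + 1 : ℝ) := by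
  have := hμ.prob
  have h : {x : Path d | ∃ k, 0 < k ∧ pos x k = 0} ⊆
      {x | 1 ≤ returns n x} ∪ {x | ∃ k, n < k ∧ pos x k = 0} := by
    rintro x ⟨k, hk, hx⟩
    by_cases hkn : k ≤ n
    · exact Or.inl ((one_le_returns_iff n x).2 ⟨k, hk, hkn, hx⟩)
    · exact Or.inr ⟨k, by omega, hx⟩
  have h1 := (measureReal_mono h (measure_ne_top μ _)).trans (measureReal_union_le _ _)
  have h2 := hμ.hit_after 0 n
  unfold returnProb
  linarith

lemma returnProb_pos (hμ : IsTransientLaw μ C) : 0 < returnProb μ := by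
  have := hμ.prob
  refine hμ.return_two.trans_le (measureReal_mono fun x hx => ⟨2, by norm_num, hx⟩)

/-- Markov's inequality; the expected number of returns is bounded by the sum of the heat kernel at
0. -/
lemma mul_returns_le (hμ : IsTransientLaw μ C) (s n : ℕ) :
    s * μ.real {x | s ≤ returns n x} ≤ 2 * C := by
  have := hμ.prob
  have hcount : ∀ x : Path d, (returns n x : ℝ) =
      ∑ k ∈ Finset.Ioc 0 n, Set.indicator {x | pos x k = 0} (fun _ => (1 : ℝ)) x := by
    intro x
    unfold returns visits
    rw [Finset.card_filter]
    push_cast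
    refine Finset.sum_congr rfl fun k _ => ?_
    by_cases h : pos x k = 0
    · rw [Set.indicator_of_mem (show x ∈ {x | pos x k = 0} from h)]; simp [h]
    · rw [Set.indicator_of_notMem (show x ∉ {x | pos x k = 0} from h)]; simp [h]
  have hint : ∀ k, Integrable (Set.indicator {x : Path d | pos x k = 0} fun _ => (1 : ℝ)) μ :=
    fun k => (integrable_const 1).indicator (determined_pos_eq k 0).measurableSet
  have hI : Integrable (fun x : Path d => (returns n x : ℝ)) μ := by
    simp_rw [hcount]
    exact integrable_finsetSum _ fun k _ => hint k
  have h1 := mul_meas_ge_le_integral_of_nonneg (μ := μ) (f := fun x : Path d => (returns n x : ℝ))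
    (Eventually.of_forall fun x => Nat.cast_nonneg _) hI s
  have h2 : ∫ x, (returns n x : ℝ) ∂μ = ∑ k ∈ Finset.Ioc 0 n, μ.real {x | pos x k = 0} := by
    simp_rw [hcount]
    rw [integral_finsetSum _ fun k _ => hint k]
    refine Finset.sum_congr rfl fun k _ => ?_
    rw [integral_indicator_const _ (determined_pos_eq k 0).measurableSet]
    simp
  have h3 : ∑ k ∈ Finset.Ioc 0 n, μ.real {x : Path d | pos x k = 0} ≤ 2 * C := by
    calc _ ≤ ∑ k ∈ Finset.Ioc 0 n, C * (1 / ((k + 1 : ℝ) * √(k + 1))) :=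
          Finset.sum_le_sum fun k _ => hμ.heat k 0
      _ ≤ C * (2 / √((0 : ℕ) + 1 : ℝ)) := by
          rw [← Finset.mul_sum]
          refine mul_le_mul_of_nonneg_left ?_ hμ.C_pos.le
          have := sum_inv_mul_sqrt_le 0 (n + 1)
          rwa [show Finset.Ico (0 + 1) (n + 1) = Finset.Ioc 0 n by ext; simp; omega] at this
      _ = 2 * C := by simp; ring
  have h4 : {x : Path d | s ≤ returns n x} = {x | (s : ℝ) ≤ (returns n x : ℝ)} := by
    ext x
    exact (Nat.cast_le (α := ℝ)).symm
  rw [h4]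
  exact h1.trans (h2.trans_le h3)

/-- If a return were certain, s returns would occur with probability tending to 1 as the time
allowed grows. For s > 2C this contradicts the bounded expected number of returns. -/
lemma returnProb_lt_one (hμ : IsTransientLaw μ C) : returnProb μ < 1 := by
  have := hμ.prob
  by_contra hq
  obtain ⟨s, hs⟩ := exists_nat_gt (2 * C)
  have hlim : Tendsto (fun n : ℕ => s * (returnProb μ - 2 * C / √(n + 1 : ℝ)) ^ s) atTop
      (𝓝 (s * (returnProb μ - 0) ^ s)) := by
    refine ((tendsto_const_nhds.sub ?_).pow s).const_mul _
    refine Tendsto.div_atTop tendsto_const_nhds ?_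
    exact Real.tendsto_sqrt_atTop.comp
      (tendsto_atTop_add_const_right _ _ tendsto_natCast_atTop_atTop)
  have hev : ∀ᶠ n : ℕ in atTop, 0 ≤ returnProb μ - 2 * C / √(n + 1 : ℝ) := by
    have h : Tendsto (fun n : ℕ => 2 * C / √(n + 1 : ℝ)) atTop (𝓝 0) :=
      Tendsto.div_atTop tendsto_const_nhds (Real.tendsto_sqrt_atTop.comp
        (tendsto_atTop_add_const_right _ _ tendsto_natCast_atTop_atTop))
    filter_upwards [h.eventually (eventually_le_nhds hμ.returnProb_pos)] with n hn
    linarith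
  have h1 : (s : ℝ) * (returnProb μ - 0) ^ s ≤ 2 * C := by
    refine le_of_tendsto hlim ?_
    filter_upwards [hev] with n hn
    refine le_trans ?_ (hμ.mul_returns_le s (s * n))
    refine mul_le_mul_of_nonneg_left (le_trans ?_ (hμ.pow_le_returns n s)) (Nat.cast_nonneg _)
    exact pow_le_pow_left₀ hn (by linarith [hμ.returnProb_sub_le n]) s
  have h2 : (1 : ℝ) ≤ (returnProb μ - 0) ^ s := one_le_pow₀ (by linarith)
  nlinarith [hμ.C_pos]

lemma returns_le_pow (hμ : IsTransientLaw μ C) (s n : ℕ) :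
    μ.real {x | s ≤ returns n x} ≤ returnProb μ ^ s := by
  refine hμ.visits_le_pow hμ.returnProb_pos.le (fun z hz n => ?_) s 0 (by simp) n
  rw [Finset.mem_singleton] at hz
  subst hz
  exact hμ.returns_le n

lemma exists_returns_le_pow (hμ : IsTransientLaw μ C) (s : ℕ) :
    μ.real {x | ∃ n, s ≤ returns n x} ≤ returnProb μ ^ s := by
  have := hμ.prob
  have h : {x : Path d | ∃ n, s ≤ returns n x} = ⋃ n, {x | s ≤ returns n x} := by
    ext x; simp only [Set.mem_iUnion]; rfl
  rw [h]
  exact measureReal_iUnion_le_of_monotone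
    (fun a b hab x hx => le_trans hx (visits_mono _ _ x hab)) fun n => hμ.returns_le_pow s n

/-- From either point of {0, y}, the next visit to the pair is a return, of probability q, or a
passage to the other point at distance |y|. -/
lemma pair_visits_le (hμ : IsTransientLaw μ C) {y : Fin d → ℤ} (hy : 0 < nrm y) (s n : ℕ) :
    μ.real {x | s ≤ visits {0, y} 0 n x} ≤ (returnProb μ + 2 * C / √(nrm y : ℝ)) ^ s := by
  have := hμ.prob
  have hC := hμ.C_pos
  have hneg : nrm (-y) = nrm y := by simp [nrm]
  refine hμ.visits_le_pow (add_nonneg hμ.returnProb_pos.le (by positivity)) (fun z hz n => ?_) s 0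
    (by simp) n
  have hfar : ∀ w : Fin d → ℤ, nrm w = nrm y → (∀ x : Path d, 1 ≤ visits {0, y} z n x →
      ∃ k, 0 < k ∧ (pos x k = 0 ∨ pos x k = w)) →
      μ.real {x | 1 ≤ visits {0, y} z n x} ≤ returnProb μ + 2 * C / √(nrm y : ℝ) := by
    intro w hw h
    have hsub : {x | 1 ≤ visits {0, y} z n x} ⊆
        {x : Path d | ∃ k, 0 < k ∧ pos x k = 0} ∪ {x | ∃ k, 0 < k ∧ pos x k = w} := by
      intro x hx
      obtain ⟨k, h0, hk | hk⟩ := h x hx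
      · exact Or.inl ⟨k, h0, hk⟩
      · exact Or.inr ⟨k, h0, hk⟩
    refine (measureReal_mono hsub (measure_ne_top μ _)).trans ((measureReal_union_le _ _).trans ?_)
    have := hμ.hit_far (y := w) (by omega)
    rw [hw] at this
    exact add_le_add_right this _
  have hvis : ∀ x : Path d, 1 ≤ visits {0, y} z n x →
      ∃ k, 0 < k ∧ (z + pos x k = 0 ∨ z + pos x k = y) := by
    intro x hx
    obtain ⟨k, hk⟩ := Finset.card_pos.1 hx
    simp only [Finset.mem_filter, Finset.mem_Ioc, Finset.mem_insert, Finset.mem_singleton] at hk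
    exact ⟨k, hk.1.1, hk.2⟩
  rw [Finset.mem_insert, Finset.mem_singleton] at hz
  rcases hz with rfl | rfl
  · refine hfar y rfl fun x hx => ?_
    obtain ⟨k, h0, hk⟩ := hvis x hx
    exact ⟨k, h0, by simpa using hk⟩
  · refine hfar (-z) hneg fun x hx => ?_
    obtain ⟨k, h0, hk | hk⟩ := hvis x hx
    · exact ⟨k, h0, Or.inr (eq_neg_of_add_eq_zero_right hk)⟩
    · exact ⟨k, h0, Or.inl (by simpa using hk)⟩

end IsTransientLaw

end HeavyPoints

/-! ### Heat kernel bound for the simple random walk by Fourier integrals -/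

namespace HeavyPoints

variable {d : ℕ}

/-- The vectors `e_i` and `-e_i`. -/
def unitStep (p : Fin d × Bool) : Fin d → ℤ := if p.2 then Pi.single p.1 1 else -Pi.single p.1 1

/-- The law of the steps of the simple random walk. -/
structure IsSimpleLaw (μ : Measure (Path d)) : Prop extends IsIIDLaw μ where
  step : ∀ p, μ.real {x | x 0 = unitStep p} = 1 / (2 * d)

lemma unitStep_injective : Function.Injective (unitStep : Fin d × Bool → Fin d → ℤ) := by
  rintro ⟨i, b⟩ ⟨j, c⟩ h
  have h1 := congrFun h i
  by_cases hij : i = j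
  · subst hij
    cases b <;> cases c <;> simp [unitStep] at h1 ⊢
  · cases b <;> cases c <;> simp [unitStep, hij] at h1

lemma nrm_le_nrm_sub_unitStep (y : Fin d → ℤ) (p : Fin d × Bool) :
    nrm y ≤ nrm (y - unitStep p) + 1 := by
  refine Finset.sup_le fun i _ => ?_
  have h1 : ((y - unitStep p) i).natAbs ≤ nrm (y - unitStep p) :=
    Finset.le_sup (f := fun i => ((y - unitStep p) i).natAbs) (Finset.mem_univ i)
  have h2 : (unitStep p i).natAbs ≤ 1 := by
    unfold unitStep
    split_ifs <;> by_cases h : p.1 = i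
    · subst h; simp
    · simp [Pi.single_eq_of_ne' h]
    · subst h; simp
    · simp [Pi.single_eq_of_ne' h]
  rw [Pi.sub_apply] at h1
  omega

/-- The characteristic function of a step. -/
noncomputable def stepChar (θ : Fin d → ℝ) : ℝ := (1 / d) * ∑ i, Real.cos (θ i)

/-- Lebesgue measure on `(0, π]^d`. -/
noncomputable def cube (d : ℕ) : Measure (Fin d → ℝ) :=
  Measure.pi fun _ => (volume : Measure ℝ).restrict (Set.Ioc 0 Real.pi)

instance : IsFiniteMeasure (cube d) := by
  unfold cube; infer_instance

lemma integral_cos_int_mul (k : ℤ) :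
    ∫ θ in Set.Ioc 0 Real.pi, Real.cos (k * θ) = if k = 0 then Real.pi else 0 := by
  rw [← intervalIntegral.integral_of_le Real.pi_pos.le]
  split_ifs with h
  · simp [h]
  · have hk : (k : ℝ) ≠ 0 := by exact_mod_cast h
    rw [intervalIntegral.integral_comp_mul_left (fun t => Real.cos t) hk, integral_cos]
    simp [Real.sin_int_mul_pi]

/-- Averaging over ±e_i uses cos(a-θ) + cos(a+θ) = 2 cos θ cos a in the i-th factor. Symmetry of the
walk is what allows real cosines on (0, π]^d in place of characters. -/
lemma sum_prod_cos (θ : Fin d → ℝ) (y : Fin d → ℤ) (hd : 0 < d) :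
    ∑ p : Fin d × Bool, 1 / (2 * d : ℝ) * ∏ i, Real.cos (((y - unitStep p) i : ℤ) * θ i) =
      stepChar θ * ∏ i, Real.cos (y i * θ i) := by
  have hd' : (d : ℝ) ≠ 0 := by positivity
  have key : ∀ i : Fin d, ∑ b : Bool, ∏ j, Real.cos (((y - unitStep (i, b)) j : ℤ) * θ j) =
      2 * Real.cos (θ i) * ∏ j, Real.cos (y j * θ j) := by
    intro i
    have hp : ∀ b : Bool, ∏ j, Real.cos (((y - unitStep (i, b)) j : ℤ) * θ j) =
        Real.cos (((y - unitStep (i, b)) i : ℤ) * θ i) *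
          ∏ j ∈ Finset.univ.erase i, Real.cos (y j * θ j) := by
      intro b
      rw [← Finset.mul_prod_erase _ _ (Finset.mem_univ i)]
      congr 1
      refine Finset.prod_congr rfl fun j hj => ?_
      have hji : j ≠ i := Finset.ne_of_mem_erase hj
      cases b <;> simp [unitStep, hji]
    rw [← Finset.mul_prod_erase (Finset.univ) (fun j => Real.cos (y j * θ j)) (Finset.mem_univ i),
      Fintype.sum_bool, hp, hp, ← add_mul, ← mul_assoc]
    congr 1
    have e1 : (((y - unitStep (i, true)) i : ℤ) : ℝ) * θ i = y i * θ i - θ i := by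
      simp [unitStep]; ring
    have e2 : (((y - unitStep (i, false)) i : ℤ) : ℝ) * θ i = y i * θ i + θ i := by
      simp [unitStep]; ring
    rw [e1, e2, Real.cos_sub, Real.cos_add]
    ring
  rw [← Finset.mul_sum, Fintype.sum_prod_type]
  simp_rw [key]
  rw [stepChar, ← Finset.sum_mul, ← Finset.mul_sum]
  field_simp

/-- By Cauchy–Schwarz φ² ≤ (1/d)∑cos² = 1 - (1/d)∑sin², and 1 - u ≤ e^(-u). The sine vanishes at
both 0 and π, so the bound also covers the second peak of |φ| at (π, …, π). -/
lemma abs_stepChar_le (hd : 0 < d) (θ : Fin d → ℝ) :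
    |stepChar θ| ≤ Real.exp (-(1 / (2 * d)) * ∑ i, Real.sin (θ i) ^ 2) := by
  have hd' : (0 : ℝ) < d := by positivity
  refine abs_le_of_sq_le_sq ?_ (Real.exp_pos _).le
  have h1 : stepChar θ ^ 2 ≤ (1 / d) * ∑ i, Real.cos (θ i) ^ 2 := by
    have := sq_sum_le_card_mul_sum_sq (s := (Finset.univ : Finset (Fin d)))
      (f := fun i => Real.cos (θ i))
    rw [Finset.card_univ, Fintype.card_fin] at this
    calc stepChar θ ^ 2 = (1 / d) ^ 2 * (∑ i, Real.cos (θ i)) ^ 2 := by rw [stepChar, mul_pow]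
      _ ≤ (1 / d) ^ 2 * (d * ∑ i, Real.cos (θ i) ^ 2) := by gcongr
      _ = _ := by field_simp
  have h2 : (1 / d) * ∑ i, Real.cos (θ i) ^ 2 = 1 - (1 / d) * ∑ i, Real.sin (θ i) ^ 2 := by
    simp_rw [Real.cos_sq', Finset.sum_sub_distrib]
    simp
    field_simp
  rw [← Real.exp_nat_mul]
  refine h1.trans (h2.le.trans ?_)
  refine (Real.one_sub_le_exp_neg _).trans (Real.exp_le_exp.2 (le_of_eq ?_))
  push_cast
  field_simp

lemma two_div_pi_sq_mul_le {θ : ℝ} (h0 : 0 ≤ θ) (h1 : θ ≤ Real.pi / 2) :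
    4 / Real.pi ^ 2 * θ ^ 2 ≤ Real.sin θ ^ 2 := by
  have h := Real.mul_le_sin h0 h1
  calc 4 / Real.pi ^ 2 * θ ^ 2 = (2 / Real.pi * θ) ^ 2 := by ring
    _ ≤ _ := pow_le_pow_left₀ (by positivity) h 2

/-- On each half of (0, π] Jordan's inequality bounds the integrand by a Gaussian centred at the
nearer endpoint. -/
lemma integral_exp_neg_sin_sq_le {a : ℝ} (ha : 0 < a) :
    ∫ θ in Set.Ioc 0 Real.pi, Real.exp (-a * Real.sin θ ^ 2) ≤
      Real.pi * √(Real.pi / a) := by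
  set b : ℝ := a * (4 / Real.pi ^ 2) with hb
  have hb0 : 0 < b := by positivity
  have hG : Integrable fun θ : ℝ => Real.exp (-b * θ ^ 2) := integrable_exp_neg_mul_sq hb0
  have hG' : Integrable fun θ : ℝ => Real.exp (-b * (Real.pi - θ) ^ 2) := hG.comp_sub_left Real.pi
  have hle : ∀ θ ∈ Set.Ioc 0 Real.pi, Real.exp (-a * Real.sin θ ^ 2) ≤
      Real.exp (-b * θ ^ 2) + Real.exp (-b * (Real.pi - θ) ^ 2) := by
    rintro θ ⟨h0, h1⟩
    rcases le_total θ (Real.pi / 2) with h | h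
    · refine le_trans (Real.exp_le_exp.2 ?_) (le_add_of_nonneg_right (Real.exp_pos _).le)
      rw [hb, neg_mul, neg_mul, mul_assoc]
      exact neg_le_neg (mul_le_mul_of_nonneg_left (two_div_pi_sq_mul_le h0.le h) ha.le)
    · refine le_trans (Real.exp_le_exp.2 ?_) (le_add_of_nonneg_left (Real.exp_pos _).le)
      have := two_div_pi_sq_mul_le (θ := Real.pi - θ) (by linarith) (by linarith)
      rw [Real.sin_pi_sub] at this
      rw [hb, neg_mul, neg_mul, mul_assoc]
      exact neg_le_neg (mul_le_mul_of_nonneg_left this ha.le)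
  calc ∫ θ in Set.Ioc 0 Real.pi, Real.exp (-a * Real.sin θ ^ 2)
      ≤ ∫ θ in Set.Ioc 0 Real.pi,
          (Real.exp (-b * θ ^ 2) + Real.exp (-b * (Real.pi - θ) ^ 2)) := by
        refine setIntegral_mono_on ?_ (hG.add hG').integrableOn measurableSet_Ioc hle
        exact (Continuous.integrableOn_Icc (by fun_prop)).mono_set Set.Ioc_subset_Icc_self
    _ ≤ ∫ θ, (Real.exp (-b * θ ^ 2) + Real.exp (-b * (Real.pi - θ) ^ 2)) :=
        setIntegral_le_integral (hG.add hG')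
          (Eventually.of_forall fun θ => add_nonneg (Real.exp_pos _).le (Real.exp_pos _).le)
    _ = 2 * √(Real.pi / b) := by
        rw [integral_add hG hG', integral_sub_left_eq_self (fun θ => Real.exp (-b * θ ^ 2)),
          integral_gaussian]
        ring
    _ = Real.pi * √(Real.pi / a) := by
        have : Real.pi / b = (Real.pi / 2) ^ 2 * (Real.pi / a) := by
          rw [hb]; field_simp; norm_num
        rw [this, Real.sqrt_mul (by positivity), Real.sqrt_sq (by positivity)]
        ring

lemma integrable_cube {f : (Fin d → ℝ) → ℝ} (hf : Continuous f) {c : ℝ} (hc : ∀ θ, |f θ| ≤ c) :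
    Integrable f (cube d) :=
  Integrable.of_bound hf.aestronglyMeasurable c (Eventually.of_forall hc)

@[fun_prop] lemma continuous_stepChar : Continuous (stepChar : (Fin d → ℝ) → ℝ) := by
  unfold stepChar; fun_prop

lemma abs_stepChar_le_one (hd : 0 < d) (θ : Fin d → ℝ) : |stepChar θ| ≤ 1 := by
  refine (abs_stepChar_le hd θ).trans (Real.exp_le_one_iff.2 ?_)
  rw [neg_mul, neg_nonpos]
  positivity

lemma abs_prod_cos_le_one (θ : Fin d → ℝ) (y : Fin d → ℤ) :
    |∏ i, Real.cos (y i * θ i)| ≤ 1 := by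
  rw [Finset.abs_prod]
  exact Finset.prod_le_one (fun _ _ => abs_nonneg _) fun _ _ => Real.abs_cos_le_one _

/-- The Fourier integral of the transition probabilities. -/
noncomputable def fourierInt (n : ℕ) (y : Fin d → ℤ) : ℝ :=
  (1 / Real.pi ^ d) * ∫ θ, stepChar θ ^ n * ∏ i, Real.cos (y i * θ i) ∂cube d

lemma integrable_fourier (hd : 0 < d) (n : ℕ) (y : Fin d → ℤ) :
    Integrable (fun θ => stepChar θ ^ n * ∏ i, Real.cos (y i * θ i)) (cube d) := by
  refine integrable_cube (by fun_prop) (c := 1) fun θ => ?_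
  rw [abs_mul, abs_pow]
  exact mul_le_one₀ (pow_le_one₀ (abs_nonneg _) (abs_stepChar_le_one hd θ)) (abs_nonneg _)
    (abs_prod_cos_le_one θ y)

lemma fourierInt_zero (y : Fin d → ℤ) : fourierInt 0 y = if y = 0 then 1 else 0 := by
  unfold fourierInt cube
  simp only [pow_zero, one_mul]
  rw [integral_fintype_prod_eq_prod (f := fun i t => Real.cos (y i * t))]
  simp_rw [integral_cos_int_mul]
  split_ifs with h
  · subst h
    simp [Real.pi_ne_zero]
  · obtain ⟨i, hi⟩ := Function.ne_iff.1 h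
    rw [Finset.prod_eq_zero (Finset.mem_univ i) (if_neg hi), mul_zero]

lemma fourierInt_succ (hd : 0 < d) (n : ℕ) (y : Fin d → ℤ) :
    fourierInt (n + 1) y =
      ∑ p : Fin d × Bool, 1 / (2 * d : ℝ) * fourierInt n (y - unitStep p) := by
  unfold fourierInt
  have h : ∀ θ : Fin d → ℝ, stepChar θ ^ (n + 1) * ∏ i, Real.cos (y i * θ i) =
      ∑ p : Fin d × Bool, 1 / (2 * d : ℝ) *
        (stepChar θ ^ n * ∏ i, Real.cos (((y - unitStep p) i : ℤ) * θ i)) := by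
    intro θ
    rw [pow_succ, mul_assoc, ← sum_prod_cos θ y hd, Finset.mul_sum]
    exact Finset.sum_congr rfl fun p _ => by ring
  simp_rw [h]
  rw [integral_finsetSum _ fun p _ => (integrable_fourier hd n _).const_mul _, Finset.mul_sum]
  refine Finset.sum_congr rfl fun p _ => ?_
  rw [integral_const_mul]
  ring

/-- After the bound on |φ| the integrand no longer depends on y and factorises into one-dimensional
integrals. -/
lemma fourierInt_le (hd : 0 < d) (n : ℕ) (hn : 0 < n) (y : Fin d → ℤ) :
    fourierInt n y ≤ √(2 * d * Real.pi / n) ^ d := by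
  set a : ℝ := n / (2 * d) with ha
  have ha0 : 0 < a := by positivity
  have hle : ∀ θ : Fin d → ℝ, stepChar θ ^ n * ∏ i, Real.cos (y i * θ i) ≤
      ∏ i, Real.exp (-a * Real.sin (θ i) ^ 2) := by
    intro θ
    calc stepChar θ ^ n * ∏ i, Real.cos (y i * θ i)
        ≤ |stepChar θ| ^ n * |∏ i, Real.cos (y i * θ i)| := by
          rw [← abs_pow, ← abs_mul]; exact le_abs_self _
      _ ≤ |stepChar θ| ^ n := mul_le_of_le_one_right (by positivity) (abs_prod_cos_le_one θ y)
      _ ≤ Real.exp (-(1 / (2 * d)) * ∑ i, Real.sin (θ i) ^ 2) ^ n :=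
          pow_le_pow_left₀ (abs_nonneg _) (abs_stepChar_le hd θ) n
      _ = _ := by
          rw [← Real.exp_nat_mul, ← Real.exp_sum, ← Finset.mul_sum, ha]
          congr 1
          ring
  have hint : Integrable (fun θ : Fin d → ℝ => ∏ i, Real.exp (-a * Real.sin (θ i) ^ 2))
      (cube d) := by
    refine integrable_cube (by fun_prop) (c := 1) fun θ => ?_
    rw [Finset.abs_prod]
    refine Finset.prod_le_one (fun _ _ => abs_nonneg _) fun i _ => ?_
    rw [abs_of_pos (Real.exp_pos _), Real.exp_le_one_iff, neg_mul, neg_nonpos]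
    positivity
  unfold fourierInt
  calc (1 / Real.pi ^ d) * ∫ θ, stepChar θ ^ n * ∏ i, Real.cos (y i * θ i) ∂cube d
      ≤ (1 / Real.pi ^ d) * ∫ θ, ∏ i, Real.exp (-a * Real.sin (θ i) ^ 2) ∂cube d := by
        exact mul_le_mul_of_nonneg_left (integral_mono (integrable_fourier hd n y) hint hle)
          (by positivity)
    _ ≤ (1 / Real.pi ^ d) * (Real.pi * √(Real.pi / a)) ^ d := by
        gcongr
        unfold cube
        rw [integral_fintype_prod_eq_prod (f := fun _ t => Real.exp (-a * Real.sin t ^ 2))]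
        refine (Finset.prod_le_prod (fun _ _ => integral_nonneg fun _ => (Real.exp_pos _).le)
          fun _ _ => integral_exp_neg_sin_sq_le ha0).trans_eq ?_
        simp
    _ = √(2 * d * Real.pi / n) ^ d := by
        rw [mul_pow, ← mul_assoc, one_div_mul_cancel (by positivity), one_mul]
        congr 2
        rw [ha]
        field_simp

namespace IsSimpleLaw

variable {μ : Measure (Path d)}

lemma ae_step (hμ : IsSimpleLaw μ) (hd : 0 < d) :
    μ.real (⋃ p, {x | x 0 = unitStep p})ᶜ = 0 := by
  have := hμ.prob
  have hm : ∀ p : Fin d × Bool, MeasurableSet {x : Path d | x 0 = unitStep p} := fun p =>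
    measurable_pi_apply 0 (measurableSet_singleton _)
  have h : μ.real (⋃ p, {x | x 0 = unitStep p}) = 1 := by
    rw [measureReal_iUnion_fintype ?_ hm]
    · simp_rw [hμ.step]
      simp
      field_simp
    · intro p q hpq
      refine Set.disjoint_left.2 fun x hx hx' => hpq (unitStep_injective ?_)
      exact Eq.trans (Eq.symm hx) hx'
  rw [probReal_compl_eq_one_sub (.iUnion hm), h, sub_self]

lemma real_pos_succ_le (hμ : IsSimpleLaw μ) (hd : 0 < d) (n : ℕ) (y : Fin d → ℤ) :
    μ.real {x | pos x (n + 1) = y} ≤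
      ∑ p : Fin d × Bool, 1 / (2 * d : ℝ) * μ.real {x | pos x n = y - unitStep p} := by
  have := hμ.prob
  have hm : ∀ p : Fin d × Bool, MeasurableSet {x : Path d | x 0 = unitStep p} := fun p =>
    measurable_pi_apply 0 (measurableSet_singleton _)
  have hsub : {x | pos x (n + 1) = y} ⊆ (⋃ p, {x : Path d | pos x n = y - unitStep p} ∩
      shift n ⁻¹' {x | x 0 = unitStep p}) ∪ shift n ⁻¹' (⋃ p, {x | x 0 = unitStep p})ᶜ := by
    intro x hx
    by_cases h : shift n x ∈ ⋃ p : Fin d × Bool, {x : Path d | x 0 = unitStep p}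
    · obtain ⟨p, hp⟩ := Set.mem_iUnion.1 h
      refine Or.inl (Set.mem_iUnion.2 ⟨p, ?_, hp⟩)
      have h1 : pos x (n + 1) = y := hx
      have h2 : x n = unitStep p := hp
      rw [pos, Finset.sum_range_succ, h2] at h1
      exact eq_sub_of_add_eq h1
    · exact Or.inr h
  refine (measureReal_mono hsub (measure_ne_top μ _)).trans ((measureReal_union_le _ _).trans ?_)
  rw [hμ.real_shift n (MeasurableSet.iUnion hm).compl, hμ.ae_step hd, add_zero]
  refine (measureReal_iUnion_fintype_le _).trans (Finset.sum_le_sum fun p _ => ?_)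
  rw [hμ.real_inter_shift (determined_pos_eq n _) (hm p), hμ.step, mul_comm]

/-- Both sides start from δ_0, and the transition probabilities satisfy as an inequality the
recursion of the Fourier integral. Fourier inversion is thus not needed. -/
lemma real_pos_le_fourierInt (hμ : IsSimpleLaw μ) (hd : 0 < d) (n : ℕ) :
    ∀ y : Fin d → ℤ, μ.real {x | pos x n = y} ≤ fourierInt n y := by
  have := hμ.prob
  induction n with
  | zero =>
    intro y
    rw [fourierInt_zero]
    split_ifs with h
    · exact measureReal_le_one
    · simp [Ne.symm h]
  | succ n ih =>
    intro y
    rw [fourierInt_succ hd]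
    refine (hμ.real_pos_succ_le hd n y).trans (Finset.sum_le_sum fun p _ => ?_)
    exact mul_le_mul_of_nonneg_left (ih _) (by positivity)

lemma real_pos_eq_zero (hμ : IsSimpleLaw μ) (hd : 0 < d) (n : ℕ) :
    ∀ y : Fin d → ℤ, n < nrm y → μ.real {x | pos x n = y} = 0 := by
  induction n with
  | zero =>
    intro y hy
    have h : y ≠ 0 := by
      rintro rfl
      simp [nrm] at hy
    simp [Ne.symm h]
  | succ n ih =>
    intro y hy
    refine le_antisymm ((hμ.real_pos_succ_le hd n y).trans (le_of_eq ?_)) measureReal_nonneg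
    refine Finset.sum_eq_zero fun p _ => ?_
    rw [ih _ (by have := nrm_le_nrm_sub_unitStep y p; omega), mul_zero]

lemma isTransientLaw (hμ : IsSimpleLaw μ) (hd : 3 ≤ d) :
    IsTransientLaw μ (√(4 * d * Real.pi) ^ 3) := by
  have hd0 : 0 < d := by omega
  have := hμ.prob
  have hm : ∀ p : Fin d × Bool, MeasurableSet {x : Path d | x 0 = unitStep p} := fun p =>
    measurable_pi_apply 0 (measurableSet_singleton _)
  refine ⟨hμ.toIsIIDLaw, fun n y => ?_, hμ.real_pos_eq_zero hd0, ?_⟩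
  · have hu : √(4 * d * Real.pi) ^ 3 * (1 / ((n + 1 : ℝ) * √(n + 1))) =
        √(4 * d * Real.pi / (n + 1)) ^ 3 := by
      rw [Real.sqrt_div (by positivity), div_pow, pow_succ (√((n : ℝ) + 1)) 2,
        Real.sq_sqrt (by positivity)]
      ring
    rw [hu]
    set u := √(4 * d * Real.pi / (n + 1)) with hu'
    have hu0 : 0 ≤ u := Real.sqrt_nonneg _
    -- For u ≥ 1 the bound is trivial. Otherwise n ≥ 1, the factor 4 in place of 2 absorbs the
    -- passage from n to n + 1, and u < 1 lets the exponent d drop to 3.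
    rcases le_or_gt 1 u with h1 | h1
    · exact measureReal_le_one.trans (one_le_pow₀ h1)
    · have hn : 0 < n := by
        rcases Nat.eq_zero_or_pos n with rfl | h
        · exfalso
          have : (1 : ℝ) ≤ u := by
            rw [hu', Real.one_le_sqrt]
            have h3 : (3 : ℝ) ≤ d := by exact_mod_cast hd
            have := Real.pi_gt_three
            push_cast
            nlinarith
          linarith
        · exact h
      have hn' : (1 : ℝ) ≤ n := by exact_mod_cast hn
      calc μ.real {x | pos x n = y} ≤ fourierInt n y := hμ.real_pos_le_fourierInt hd0 n y
        _ ≤ √(2 * d * Real.pi / n) ^ d := fourierInt_le hd0 n hn y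
        _ ≤ u ^ d := by
            refine pow_le_pow_left₀ (Real.sqrt_nonneg _) (Real.sqrt_le_sqrt ?_) d
            rw [div_le_div_iff₀ (by positivity) (by positivity)]
            have : 0 ≤ (d : ℝ) * Real.pi := by positivity
            nlinarith
        _ ≤ u ^ 3 := pow_le_pow_of_le_one hu0 h1.le hd
  · let i : Fin d := ⟨0, hd0⟩
    have hsub : {x : Path d | pos x 1 = unitStep (i, true)} ∩
        shift 1 ⁻¹' {x | x 0 = unitStep (i, false)} ⊆ {x | pos x 2 = 0} := by
      rintro x ⟨h1, h2⟩
      have h2' : x 1 = unitStep (i, false) := h2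
      have h1' : pos x 1 = unitStep (i, true) := h1
      change ∑ k ∈ Finset.range 2, x k = 0
      rw [Finset.sum_range_succ, h2']
      change pos x 1 + _ = 0
      rw [h1']
      simp [unitStep]
    have h1 : {x : Path d | pos x 1 = unitStep (i, true)} = {x | x 0 = unitStep (i, true)} := by
      simp [pos]
    refine lt_of_lt_of_le ?_ (measureReal_mono hsub (measure_ne_top μ _))
    rw [hμ.real_inter_shift (determined_pos_eq 1 _) (hm _), h1, hμ.step, hμ.step]
    positivity

end IsSimpleLaw

end HeavyPoints

/-! ### Tagged times: probability and correlations -/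

namespace HeavyPoints

variable {d : ℕ}

/-- The position at time `m` is not visited at the times `0, …, m - 1`. -/
def fresh (m : ℕ) : Set (Path d) := {x | ∀ i < m, pos x i ≠ pos x m}

lemma determined_fresh (m : ℕ) : Determined m (fresh m : Set (Path d)) := by
  refine determined_of_pos (fun p => ∀ i < m, p i ≠ p m) fun p p' h hp i hi => ?_
  rw [← h i hi.le, ← h m le_rfl]
  exact hp i hi

/-- The position at time `m` is new and is visited at least `s` times in the next `m` steps. -/
def tagged (m s : ℕ) : Set (Path d) := fresh m ∩ shift m ⁻¹' {x | s ≤ returns m x}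

lemma determined_tagged (m s : ℕ) : Determined (m + m) (tagged m s : Set (Path d)) :=
  ((determined_fresh m).mono (by omega)).inter ((determined_visits_le _ _ _ _).preimage_shift m)

lemma mem_shift_firstHit {m r : ℕ} (hr : r ≤ m) {x : Path d} :
    x ∈ shift (m - r) ⁻¹' firstHit {0} 0 r 0 ↔
      pos x m = pos x (m - r) ∧ ∀ i, m - r < i → i < m → pos x i ≠ pos x (m - r) := by
  have h1 : shift (m - r) x ∈ firstHit {0} 0 r 0 ↔ pos x m = pos x (m - r) ∧
      ∀ i, 0 < i → i < r → pos x (m - r + i) ≠ pos x (m - r) := by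
    simp [firstHit, pos_shift, Nat.sub_add_cancel hr, sub_eq_zero]
  rw [Set.mem_preimage, h1]
  refine and_congr_right fun _ => ⟨fun h i hi him => ?_, fun h i hi hir => h _ (by omega) (by omega)⟩
  have := h (i - (m - r)) (by omega) (by omega)
  rwa [Nat.add_sub_cancel' hi.le] at this

/-- Decompose by the last earlier visit to the site occupied at time m: seen from that visit, time m
is a first return. With stationarity this replaces time reversal in computing P(`fresh m`). -/
lemma compl_fresh (m : ℕ) : (fresh m : Set (Path d))ᶜ =
    ⋃ p ∈ Finset.Ioc 0 m ×ˢ ({0} : Finset (Fin d → ℤ)),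
      shift (m - p.1) ⁻¹' firstHit {0} 0 p.1 p.2 := by
  classical
  ext x
  simp only [Set.mem_iUnion, exists_prop, Finset.mem_product, Finset.mem_Ioc, Finset.mem_singleton]
  constructor
  · intro hx
    -- The least such r corresponds to the last earlier visit.
    have hex : ∃ r, 0 < r ∧ r ≤ m ∧ pos x m = pos x (m - r) := by
      by_contra hne
      push Not at hne
      refine hx fun i hi h => hne (m - i) (by omega) (by omega) ?_
      rw [Nat.sub_sub_self hi.le, h]
    obtain ⟨h0, hm, hp⟩ := Nat.find_spec hex
    refine ⟨(Nat.find hex, 0), ⟨⟨h0, hm⟩, rfl⟩, (mem_shift_firstHit hm).2 ⟨hp, fun i hi him h => ?_⟩⟩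
    refine Nat.find_min hex (m := m - i) (by omega) ⟨by omega, by omega, ?_⟩
    rw [Nat.sub_sub_self him.le, hp, h]
  · rintro ⟨⟨r, w⟩, ⟨⟨h0, hm⟩, hw⟩, hx⟩ hf
    simp only at h0 hm hw hx
    subst hw
    exact hf (m - r) (by omega) ((mem_shift_firstHit hm).1 hx).1.symm

/-- All vectors of norm at most `M`. -/
noncomputable def box (d M : ℕ) : Finset (Fin d → ℤ) := Fintype.piFinset fun _ => Finset.Icc (-(M : ℤ)) M

lemma mem_box {M : ℕ} {y : Fin d → ℤ} : y ∈ box d M ↔ nrm y ≤ M := by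
  simp only [box, Fintype.mem_piFinset, Finset.mem_Icc, nrm, Finset.sup_le_iff, Finset.mem_univ,
    true_imp_iff]
  exact forall_congr' fun i => by omega

lemma card_box (M : ℕ) : (box d M).card = (2 * M + 1) ^ d := by
  simp [box]
  congr 1
  omega

/-- The walk has at least `s` returns to the origin and at least `s + 1` visits to `y`. -/
def bothVisited (n s : ℕ) (y : Fin d → ℤ) : Set (Path d) :=
  {x | s ≤ returns n x} ∩ {x | s + 1 ≤ visits {y} 0 n x}

lemma determined_bothVisited (n s : ℕ) (y : Fin d → ℤ) :
    Determined n (bothVisited n s y) :=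
  (determined_visits_le _ _ _ _).inter (determined_visits_le _ _ _ _)

lemma visits_pair {y : Fin d → ℤ} (hy : y ≠ 0) (n : ℕ) (x : Path d) :
    visits {0, y} 0 n x = returns n x + visits {y} 0 n x := by
  unfold returns visits
  rw [← Finset.card_union_of_disjoint]
  · congr 1
    ext k
    simp only [Finset.mem_filter, Finset.mem_union, Finset.mem_insert, Finset.mem_singleton]
    tauto
  · refine Finset.disjoint_filter.2 fun k _ h1 h2 => hy ?_
    rw [Finset.mem_singleton] at h1 h2
    rw [← h1, ← h2]

/-- Seen from time m, the first tagged site is the origin and has s returns. The second is y: its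
arrival at time h is one visit and s more follow, all before time 3m. -/
lemma tagged_inter_subset {m s h : ℕ} (h0 : 0 < h) (h2 : h < 2 * m) (y : Fin d → ℤ) :
    tagged m s ∩ shift h ⁻¹' tagged m s ∩ shift m ⁻¹' {x : Path d | pos x h = y} ⊆
      shift m ⁻¹' bothVisited (3 * m) s y := by
  rintro x ⟨⟨hx, hx'⟩, hy⟩
  have hy' : pos (shift m x) h = y := hy
  have h1 : s ≤ returns m (shift m x) := hx.2
  have h3 : s ≤ returns m (shift m (shift h x)) := hx'.2
  refine ⟨h1.trans (visits_mono _ _ _ (by omega)), ?_⟩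
  change s + 1 ≤ visits {y} 0 (3 * m) (shift m x)
  refine le_trans ?_ (visits_mono {y} 0 (shift m x) (show h + m ≤ 3 * m by omega))
  simp only [visits_add, zero_add]
  have h4 : 1 ≤ visits {y} 0 h (shift m x) := by
    refine Finset.card_pos.2 ⟨h, ?_⟩
    simp [hy', h0]
  have h5 : visits {y} (pos (shift m x) h) m (shift h (shift m x)) =
      returns m (shift m (shift h x)) := by
    rw [shift_shift, shift_shift, add_comm h m, hy']
    unfold returns visits
    simp
  omega

/-- If both occurred, the second tagged site for lag h' would already have been visited at time m +
h, which lies in the window [h', h' + m) where it must be new. -/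
lemma tagged_inter_disjoint {m s h h' : ℕ} (hlt : h < h') (hm : h' ≤ h + m) (y : Fin d → ℤ) :
    Disjoint (tagged m s ∩ shift h ⁻¹' tagged m s ∩ shift m ⁻¹' {x : Path d | pos x h = y})
      (tagged m s ∩ shift h' ⁻¹' tagged m s ∩ shift m ⁻¹' {x : Path d | pos x h' = y}) := by
  refine Set.disjoint_left.2 fun x hx hx' => ?_
  have h1 : pos (shift m x) h = y := hx.2
  have h2 : pos (shift m x) h' = y := hx'.2
  have h3 : ∀ i < m, pos (shift h' x) i ≠ pos (shift h' x) m := hx'.1.2.1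
  refine h3 (m + h - h') (by omega) ?_
  rw [pos_shift, pos_shift] at *
  rw [show h' + (m + h - h') = m + h by omega, add_comm h' m]
  rw [← h1] at h2
  simpa using h2.symm

/-- Every positive distance from a is attained at most twice, once on each side. -/
lemma sum_dist_le {c : ℕ → ℝ} {L : ℕ} (hc : ∀ h, 0 ≤ c h) (h0 : ∀ h, L ≤ h → c h = 0)
    (N a : ℕ) : ∑ b ∈ Finset.range N, c (Nat.dist a b) ≤ c 0 + 2 * ∑ h ∈ Finset.Ioo 0 L, c h := by
  have key : ∀ S : Finset ℕ, ∀ g : ℕ → ℕ, (∀ b ∈ S, 0 < g b) → Set.InjOn g S →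
      ∑ b ∈ S, c (g b) ≤ ∑ h ∈ Finset.Ioo 0 L, c h := by
    intro S g hg hinj
    rw [← Finset.sum_image hinj, ← Finset.sum_filter_add_sum_filter_not (S.image g) (· < L)]
    have : ∑ x ∈ (S.image g).filter (fun h => ¬ h < L), c x = 0 :=
      Finset.sum_eq_zero fun h hh => h0 h (not_lt.1 (Finset.mem_filter.1 hh).2)
    rw [this, add_zero]
    refine Finset.sum_le_sum_of_subset_of_nonneg (fun h hh => ?_) fun h _ _ => hc h
    rw [Finset.mem_filter, Finset.mem_image] at hh
    obtain ⟨⟨b, hb, rfl⟩, hlt⟩ := hh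
    exact Finset.mem_Ioo.2 ⟨hg b hb, hlt⟩
  have h1 := key ((Finset.range N).filter (a < ·)) (Nat.dist a)
    (fun b hb => by have := (Finset.mem_filter.1 hb).2; simp only [Nat.dist]; omega)
    (fun b hb b' hb' h => by
      have h1 := (Finset.mem_filter.1 hb).2
      have h2 := (Finset.mem_filter.1 hb').2
      simp only [Nat.dist] at h; omega)
  have h2 := key ((Finset.range N).filter (· < a)) (Nat.dist a)
    (fun b hb => by have := (Finset.mem_filter.1 hb).2; simp only [Nat.dist]; omega)
    (fun b hb b' hb' h => by
      have h1 := (Finset.mem_filter.1 hb).2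
      have h2 := (Finset.mem_filter.1 hb').2
      simp only [Nat.dist] at h; omega)
  have h3 : ∑ b ∈ (Finset.range N).filter (· = a), c (Nat.dist a b) ≤ c 0 := by
    rw [Finset.filter_eq']
    split_ifs
    · simp [Nat.dist_self]
    · simpa using hc 0
  have h4 : ∑ b ∈ Finset.range N, c (Nat.dist a b) =
      ∑ b ∈ (Finset.range N).filter (a < ·), c (Nat.dist a b) +
      (∑ b ∈ (Finset.range N).filter (· < a), c (Nat.dist a b) +
      ∑ b ∈ (Finset.range N).filter (· = a), c (Nat.dist a b)) := by
    simp only [Finset.sum_filter, ← Finset.sum_add_distrib]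
    refine Finset.sum_congr rfl fun b _ => ?_
    rcases lt_trichotomy a b with h | h | h
    · simp [h, h.not_gt, h.ne']
    · simp [h]
    · simp [h, h.not_gt, h.ne]
  linarith

namespace IsIIDLaw

variable {μ : Measure (Path d)}

lemma real_fresh (hμ : IsIIDLaw μ) (m : ℕ) :
    μ.real (fresh m) = 1 - μ.real {x | 1 ≤ returns m x} := by
  have := hμ.prob
  have hF : ∀ p : ℕ × (Fin d → ℤ), MeasurableSet (firstHit {0} 0 p.1 p.2) :=
    fun p => (determined_firstHit _ _ _ _).measurableSet
  have h : μ.real (fresh m)ᶜ = μ.real {x | 1 ≤ returns m x} := by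
    rw [compl_fresh, measureReal_biUnion_finset, ← sum_firstHit {0} 0 m]
    · exact Finset.sum_congr rfl fun p _ => hμ.real_shift _ (hF p)
    · rintro ⟨r, w⟩ h ⟨r', w'⟩ h' hne
      simp only [Finset.coe_product, Finset.coe_Ioc, Set.mem_prod, Set.mem_Ioc, Finset.mem_coe,
        Finset.mem_singleton] at h h'
      obtain ⟨⟨h0, hm⟩, rfl⟩ := h
      obtain ⟨⟨h0', hm'⟩, rfl⟩ := h'
      refine Set.disjoint_left.2 fun x hx hx' => ?_
      have h1 := (mem_shift_firstHit hm).1 hx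
      have h2 := (mem_shift_firstHit hm').1 hx'
      rcases lt_trichotomy r r' with hlt | rfl | hlt
      · exact h2.2 (m - r) (by omega) (by omega) (h1.1.symm.trans h2.1)
      · exact hne rfl
      · exact h1.2 (m - r') (by omega) (by omega) (h2.1.symm.trans h1.1)
    · exact fun p _ => measurable_shift _ (hF p)
  rw [← h, probReal_compl_eq_one_sub (determined_fresh m).measurableSet]
  ring

lemma real_tagged (hμ : IsIIDLaw μ) (m s : ℕ) :
    μ.real (tagged m s) = (1 - μ.real {x | 1 ≤ returns m x}) * μ.real {x | s ≤ returns m x} := by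
  rw [tagged, hμ.real_inter_shift (determined_fresh m) (determined_visits_le _ _ _ _).measurableSet,
    hμ.real_fresh]

/-- Variance of a stationary sum with finite range of dependence: covariances vanish at lags h ≥ L,
and at smaller lags the negative term -P(G)² is dropped. -/
lemma integral_sq_sum_indicator_le (hμ : IsIIDLaw μ) {G : Set (Path d)} {L : ℕ} (hL : 0 < L)
    (hG : Determined L G) (N : ℕ) :
    ∫ x, (∑ a ∈ Finset.range N, (Set.indicator G (fun _ => (1 : ℝ)) (shift a x) - μ.real G)) ^ 2 ∂μ ≤
      N * (μ.real G + 2 * ∑ h ∈ Finset.Ioo 0 L, μ.real (G ∩ shift h ⁻¹' G)) := by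
  have := hμ.prob
  set p := μ.real G with hp
  have hGm := hG.measurableSet
  set f : ℕ → Path d → ℝ := fun a x => Set.indicator G (fun _ => (1 : ℝ)) (shift a x) with hf
  have hfi : ∀ a, f a = Set.indicator (shift a ⁻¹' G) fun _ => (1 : ℝ) := fun a => rfl
  have hm : ∀ a, MeasurableSet (shift a ⁻¹' G) := fun a => measurable_shift a hGm
  have hint : ∀ a, Integrable (f a) μ := fun a => by
    rw [hfi]; exact (integrable_const 1).indicator (hm a)
  have hmul : ∀ a b, (fun x => f a x * f b x) =
      Set.indicator (shift a ⁻¹' G ∩ shift b ⁻¹' G) fun _ => (1 : ℝ) := fun a b => by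
    ext x
    simp only [hfi]
    rw [← Set.inter_indicator_mul]; simp
  have hint2 : ∀ a b, Integrable (fun x => f a x * f b x) μ := fun a b => by
    rw [hmul]; exact (integrable_const 1).indicator ((hm a).inter (hm b))
  have hE : ∀ a, ∫ x, f a x ∂μ = p := fun a => by
    rw [hfi, integral_indicator_const _ (hm a), hμ.real_shift a hGm]; simp [hp]
  have hexp : ∀ a b x, (f a x - p) * (f b x - p) = f a x * f b x - p * f a x - p * f b x + p * p :=
    fun a b x => by ring
  have hint3 : ∀ a b, Integrable (fun x => (f a x - p) * (f b x - p)) μ := fun a b => by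
    simp_rw [hexp]
    exact (((hint2 a b).sub ((hint a).const_mul p)).sub ((hint b).const_mul p)).add
      (integrable_const _)
  have hcov : ∀ a b, ∫ x, (f a x - p) * (f b x - p) ∂μ =
      μ.real (shift a ⁻¹' G ∩ shift b ⁻¹' G) - p * p := fun a b => by
    simp_rw [hexp]
    have i1 : Integrable (fun x => f a x * f b x - p * f a x) μ :=
      (hint2 a b).sub ((hint a).const_mul p)
    have i2 : Integrable (fun x => f a x * f b x - p * f a x - p * f b x) μ :=
      i1.sub ((hint b).const_mul p)
    rw [integral_add i2 (integrable_const _), integral_sub i1 ((hint b).const_mul p), integral_sub (hint2 a b) ((hint a).const_mul p), integral_const_mul,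
      integral_const_mul, hE, hE, hmul, integral_indicator_const _ ((hm a).inter (hm b))]
    simp
  set c : ℕ → ℝ := fun h => if h < L then μ.real (G ∩ shift h ⁻¹' G) else 0 with hc
  have hle : ∀ a h, μ.real (shift a ⁻¹' G ∩ shift (a + h) ⁻¹' G) - p * p ≤ c h := fun a h => by
    have e : shift a ⁻¹' G ∩ shift (a + h) ⁻¹' G = shift a ⁻¹' (G ∩ shift h ⁻¹' G) := by
      ext x; simp [shift_shift]
    rw [e, hμ.real_shift a (hGm.inter (hm h))]
    simp only [hc]
    split_ifs with hh
    · linarith [mul_self_nonneg p]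
    · rw [hμ.real_inter_shift (hG.mono (not_lt.1 hh)) hGm]
      linarith
  have hle' : ∀ a b, μ.real (shift a ⁻¹' G ∩ shift b ⁻¹' G) - p * p ≤ c (Nat.dist a b) :=
    fun a b => by
      rcases le_total a b with h | h
      · obtain ⟨k, rfl⟩ := Nat.exists_eq_add_of_le h
        rw [Nat.dist_eq_sub_of_le h, Nat.add_sub_cancel_left]
        exact hle a k
      · obtain ⟨k, rfl⟩ := Nat.exists_eq_add_of_le h
        rw [Nat.dist_eq_sub_of_le_right h, Nat.add_sub_cancel_left, Set.inter_comm]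
        exact hle b k
  calc ∫ x, (∑ a ∈ Finset.range N, (f a x - p)) ^ 2 ∂μ
      = ∑ a ∈ Finset.range N, ∑ b ∈ Finset.range N,
          (μ.real (shift a ⁻¹' G ∩ shift b ⁻¹' G) - p * p) := by
        simp_rw [sq, Finset.sum_mul_sum]
        rw [integral_finsetSum _ fun a _ => integrable_finsetSum _ fun b _ => hint3 a b]
        refine Finset.sum_congr rfl fun a _ => ?_
        rw [integral_finsetSum _ fun b _ => hint3 a b]
        exact Finset.sum_congr rfl fun b _ => hcov a b
    _ ≤ ∑ a ∈ Finset.range N, (c 0 + 2 * ∑ h ∈ Finset.Ioo 0 L, c h) := by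
        refine Finset.sum_le_sum fun a _ => (Finset.sum_le_sum fun b _ => hle' a b).trans ?_
        refine sum_dist_le (fun h => ?_) (fun h hh => ?_) N a
        · simp only [hc]; split_ifs
          · exact measureReal_nonneg
          · exact le_rfl
        · simp [hc, not_lt.2 hh]
    _ = _ := by
        rw [Finset.sum_const, Finset.card_range, nsmul_eq_mul]
        have e0 : c 0 = p := by
          simp only [hc, if_pos hL, hp]
          congr 1
          ext x; simp [show shift 0 x = x by ext k; simp [shift]]
        have e1 : ∑ h ∈ Finset.Ioo 0 L, c h = ∑ h ∈ Finset.Ioo 0 L, μ.real (G ∩ shift h ⁻¹' G) :=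
          Finset.sum_congr rfl fun h hh => by simp [hc, (Finset.mem_Ioo.1 hh).2]
        rw [e0, e1]

end IsIIDLaw

namespace IsTransientLaw

variable {μ : Measure (Path d)} {C : ℝ}

lemma ae_nrm_pos_le (hμ : IsTransientLaw μ C) (h : ℕ) : μ.real {x | ¬ nrm (pos x h) ≤ h} = 0 := by
  have := hμ.prob
  have e : {x : Path d | ¬ nrm (pos x h) ≤ h} ⊆
      ⋃ (y : Fin d → ℤ) (_ : h < nrm y), {x | pos x h = y} := fun x hx =>
    Set.mem_iUnion₂.2 ⟨pos x h, not_le.1 hx, rfl⟩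
  have h0 : μ {x : Path d | ¬ nrm (pos x h) ≤ h} = 0 := by
    refine measure_mono_null e (measure_iUnion_null fun y => measure_iUnion_null fun hy => ?_)
    exact (measureReal_eq_zero_iff (measure_ne_top μ _)).1 (hμ.range h y hy)
  rw [measureReal_def, h0]
  rfl

/-- Summing over lags would cost a factor m by a union bound; disjointness for a fixed displacement
y reduces this to 2. -/
lemma sum_tagged_inter_le (hμ : IsTransientLaw μ C) (m s : ℕ) :
    ∑ h ∈ Finset.Ioo 0 (m + m), μ.real (tagged m s ∩ shift h ⁻¹' tagged m s) ≤
      2 * ∑ y ∈ box d (2 * m), μ.real (bothVisited (3 * m) s y) := by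
  have := hμ.prob
  set E : ℕ → (Fin d → ℤ) → Set (Path d) := fun h y =>
    tagged m s ∩ shift h ⁻¹' tagged m s ∩ shift m ⁻¹' {x : Path d | pos x h = y} with hE
  have hTm : MeasurableSet (tagged m s : Set (Path d)) := (determined_tagged m s).measurableSet
  have hEm : ∀ h y, MeasurableSet (E h y) := fun h y =>
    (hTm.inter (measurable_shift h hTm)).inter
      (measurable_shift m (determined_pos_eq h y).measurableSet)
  have hpair : ∀ (H : Finset ℕ), H ⊆ Finset.Ioo 0 (m + m) →
      (∀ h ∈ H, ∀ h' ∈ H, h < h' → h' ≤ h + m) → ∀ y,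
      ∑ h ∈ H, μ.real (E h y) ≤ μ.real (bothVisited (3 * m) s y) := by
    intro H hH hd y
    rw [← hμ.real_shift m (determined_bothVisited _ _ _).measurableSet,
      ← measureReal_biUnion_finset ?_ fun h _ => hEm h y]
    · refine measureReal_mono (Set.iUnion₂_subset fun h hh => ?_)
      have := Finset.mem_Ioo.1 (hH hh)
      exact tagged_inter_subset this.1 (by omega) y
    · intro h hh h' hh' hne
      rcases lt_or_gt_of_ne hne with hlt | hlt
      · exact tagged_inter_disjoint hlt (hd h hh h' hh' hlt) y
      · exact (tagged_inter_disjoint hlt (hd h' hh' h hh hlt) y).symm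
  have hsplit : ∀ h ∈ Finset.Ioo 0 (m + m), μ.real (tagged m s ∩ shift h ⁻¹' tagged m s) ≤
      ∑ y ∈ box d (2 * m), μ.real (E h y) := by
    intro h hh
    have hsub : tagged m s ∩ shift h ⁻¹' tagged m s ⊆ (⋃ y ∈ box d (2 * m), E h y) ∪
        shift m ⁻¹' {x | ¬ nrm (pos x h) ≤ h} := by
      intro x hx
      by_cases hn : nrm (pos (shift m x) h) ≤ h
      · refine Or.inl (Set.mem_biUnion (mem_box.2 (hn.trans ?_)) ⟨hx, rfl⟩)
        have := Finset.mem_Ioo.1 hh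
        omega
      · exact Or.inr hn
    refine (measureReal_mono hsub (measure_ne_top μ _)).trans ((measureReal_union_le _ _).trans ?_)
    rw [hμ.real_shift m, hμ.ae_nrm_pos_le, add_zero]
    · exact measureReal_biUnion_finset_le _ _
    · exact (determined_of_pos (fun p => ¬ nrm (p h) ≤ h)
        fun p p' hp hx => by rwa [← hp h le_rfl]).measurableSet
  calc ∑ h ∈ Finset.Ioo 0 (m + m), μ.real (tagged m s ∩ shift h ⁻¹' tagged m s)
      ≤ ∑ h ∈ Finset.Ioo 0 (m + m), ∑ y ∈ box d (2 * m), μ.real (E h y) :=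
        Finset.sum_le_sum hsplit
    _ = ∑ y ∈ box d (2 * m), ∑ h ∈ Finset.Ioo 0 (m + m), μ.real (E h y) := Finset.sum_comm
    _ ≤ ∑ y ∈ box d (2 * m), 2 * μ.real (bothVisited (3 * m) s y) := by
        refine Finset.sum_le_sum fun y _ => ?_
        -- Within either half of the lags any two differ by at most m, as disjointness requires.
        rw [← Finset.sum_filter_add_sum_filter_not (Finset.Ioo 0 (m + m)) (· < m), two_mul]
        refine add_le_add (hpair _ (Finset.filter_subset _ _) (fun h hh h' hh' _ => ?_) y)
          (hpair _ (Finset.filter_subset _ _) (fun h hh h' hh' _ => ?_) y)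
        · simp only [Finset.mem_filter, Finset.mem_Ioo] at hh hh'; omega
        · simp only [Finset.mem_filter, Finset.mem_Ioo] at hh hh'; omega
    _ = _ := (Finset.mul_sum _ _ _).symm

lemma bothVisited_le_near (hμ : IsTransientLaw μ C) (n s : ℕ) (y : Fin d → ℤ) :
    μ.real (bothVisited n s y) ≤ returnProb μ ^ s := by
  have := hμ.prob
  exact (measureReal_mono Set.inter_subset_left).trans (hμ.returns_le_pow s n)

lemma bothVisited_le_far (hμ : IsTransientLaw μ C) (n s : ℕ) {y : Fin d → ℤ} (hy : 0 < nrm y) :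
    μ.real (bothVisited n s y) ≤ (returnProb μ + 2 * C / √(nrm y : ℝ)) ^ (2 * s + 1) := by
  have := hμ.prob
  refine (measureReal_mono fun x hx => ?_).trans (hμ.pair_visits_le hy (2 * s + 1) n)
  have hy0 : y ≠ 0 := by rintro rfl; simp [nrm] at hy
  have h1 : s ≤ returns n x := hx.1
  have h2 : s + 1 ≤ visits {y} 0 n x := hx.2
  change 2 * s + 1 ≤ visits {0, y} 0 n x
  rw [visits_pair hy0]
  omega

end IsTransientLaw

end HeavyPoints

/-! ### Variance, mean and error terms of the number of tagged times -/

namespace HeavyPoints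

variable {d : ℕ}

/-- Used with r = ρ/q: the polynomially many points with |y| ≤ s², each contributing ρ^s, together
cost only a constant times q^s. -/
lemma exists_pow_mul_geom_le (d : ℕ) {r : ℝ} (h0 : 0 ≤ r) (h1 : r < 1) :
    ∃ K : ℝ, 0 < K ∧ ∀ s : ℕ, ((2 * s ^ 2 + 1 : ℕ) : ℝ) ^ d * r ^ s ≤ K := by
  have hlim := tendsto_pow_const_mul_const_pow_of_abs_lt_one (2 * d)
    (show |r| < 1 by rwa [abs_of_nonneg h0])
  obtain ⟨M, hM⟩ := hlim.bddAbove_range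
  refine ⟨1 + 3 ^ d * |M|, by positivity, fun s => ?_⟩
  rcases Nat.eq_zero_or_pos s with rfl | hs
  · simp
  · have hs' : (1 : ℝ) ≤ s := by exact_mod_cast hs
    have h2 : (s : ℝ) ^ (2 * d) * r ^ s ≤ |M| := (hM ⟨s, rfl⟩).trans (le_abs_self _)
    have h3 : ((2 * s ^ 2 + 1 : ℕ) : ℝ) ^ d ≤ (3 * (s : ℝ) ^ 2) ^ d := by
      refine pow_le_pow_left₀ (by positivity) ?_ d
      push_cast
      nlinarith
    calc ((2 * s ^ 2 + 1 : ℕ) : ℝ) ^ d * r ^ s ≤ (3 * (s : ℝ) ^ 2) ^ d * r ^ s := by gcongr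
      _ = 3 ^ d * ((s : ℝ) ^ (2 * d) * r ^ s) := by rw [mul_pow, ← pow_mul]; ring
      _ ≤ 3 ^ d * |M| := by gcongr
      _ ≤ _ := by linarith

lemma sum_indicator_box_le (M M' : ℕ) {c : ℝ} (hc : 0 ≤ c) :
    ∑ y ∈ box d M, (if nrm y ≤ M' then c else 0) ≤ ((2 * M' + 1 : ℕ) : ℝ) ^ d * c := by
  rw [← Finset.sum_filter, Finset.sum_const, nsmul_eq_mul]
  refine mul_le_mul_of_nonneg_right ?_ hc
  have : ((box d M).filter fun y => nrm y ≤ M').card ≤ (box d M').card :=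
    Finset.card_le_card fun y hy => mem_box.2 (Finset.mem_filter.1 hy).2
  rw [card_box] at this
  exact_mod_cast this

lemma pow_sub_pow_le {a b : ℝ} (hb : 0 ≤ b) (hab : b ≤ a) (s : ℕ) :
    a ^ s - b ^ s ≤ s * a ^ (s - 1) * (a - b) := by
  have ha : 0 ≤ a := hb.trans hab
  rw [← Commute.geom_sum₂_mul (Commute.all a b)]
  refine mul_le_mul_of_nonneg_right ?_ (sub_nonneg.2 hab)
  calc ∑ i ∈ Finset.range s, a ^ i * b ^ (s - 1 - i)
      ≤ ∑ i ∈ Finset.range s, a ^ (s - 1) := by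
        refine Finset.sum_le_sum fun i hi => ?_
        have := Finset.mem_range.1 hi
        calc a ^ i * b ^ (s - 1 - i) ≤ a ^ i * a ^ (s - 1 - i) := by gcongr
          _ = a ^ (s - 1) := by rw [← pow_add]; congr 1; omega
    _ = s * a ^ (s - 1) := by simp

/-- The number of `j ∈ J` for which `A j` occurs. -/
noncomputable def count (J : Finset ℕ) (A : ℕ → Set (Path d)) (x : Path d) : ℝ :=
  ∑ j ∈ J, Set.indicator (A j) (fun _ => (1 : ℝ)) x

lemma count_nonneg (J : Finset ℕ) (A : ℕ → Set (Path d)) (x : Path d) : 0 ≤ count J A x :=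
  Finset.sum_nonneg fun _ _ => Set.indicator_nonneg (fun _ _ => zero_le_one) _

lemma integrable_count {μ : Measure (Path d)} [IsFiniteMeasure μ] (J : Finset ℕ)
    {A : ℕ → Set (Path d)} (hA : ∀ j ∈ J, MeasurableSet (A j)) : Integrable (count J A) μ :=
  integrable_finsetSum _ fun j hj => (integrable_const 1).indicator (hA j hj)

lemma integral_count {μ : Measure (Path d)} [IsFiniteMeasure μ] (J : Finset ℕ)
    {A : ℕ → Set (Path d)} (hA : ∀ j ∈ J, MeasurableSet (A j)) :
    ∫ x, count J A x ∂μ = ∑ j ∈ J, μ.real (A j) := by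
  unfold count
  rw [integral_finsetSum _ fun j hj => (integrable_const 1).indicator (hA j hj)]
  refine Finset.sum_congr rfl fun j hj => ?_
  rw [integral_indicator_const _ (hA j hj)]
  simp

/-- There are at least `s` returns to the origin. -/
def everReturns (s : ℕ) : Set (Path d) := {x | ∃ n, s ≤ returns n x}

lemma measurableSet_everReturns (s : ℕ) : MeasurableSet (everReturns s : Set (Path d)) := by
  have : (everReturns s : Set (Path d)) = ⋃ n, {x | s ≤ returns n x} := by
    ext x; simp [everReturns]
  rw [this]
  exact .iUnion fun n => (determined_visits_le _ _ n s).measurableSet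

/-- There are at least `s` returns to the origin, but fewer than `s` before time `m`. -/
def lateReturns (m s : ℕ) : Set (Path d) := everReturns s \ {x | s ≤ returns m x}

lemma measurableSet_lateReturns (m s : ℕ) : MeasurableSet (lateReturns m s : Set (Path d)) :=
  (measurableSet_everReturns s).diff (determined_visits_le _ _ m s).measurableSet

/-- The position at time `j` was visited before, at a time `0 < i < j - m`. -/
def oldSite (m j : ℕ) : Set (Path d) := {x | ∃ i, 0 < i ∧ i + m < j ∧ pos x i = pos x j}

lemma determined_oldSite (m j : ℕ) : Determined j (oldSite m j : Set (Path d)) := by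
  refine determined_of_pos (fun p => ∃ i, 0 < i ∧ i + m < j ∧ p i = p j) fun p p' h hp => ?_
  obtain ⟨i, h0, hi, he⟩ := hp
  exact ⟨i, h0, hi, by rw [← h i (by omega), ← h j le_rfl, he]⟩

/-- The number of tagged times. -/
noncomputable def tagCount (n m s : ℕ) : Path d → ℝ :=
  count (Finset.range (n - 2 * m)) fun a => shift a ⁻¹' tagged m s

/-- The error in the upper bound by the number of tagged times. -/
noncomputable def upperError (n m s : ℕ) (x : Path d) : ℝ :=
  count (Finset.Ioc 0 n) (fun j => shift j ⁻¹' lateReturns m s) x +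
  count ((Finset.Ioc 0 n).filter fun j => ¬ (m < j ∧ j < n - m))
    (fun j => shift j ⁻¹' everReturns s) x

/-- The error in the lower bound by the number of tagged times. -/
noncomputable def lowerError (n m s : ℕ) : Path d → ℝ :=
  count (Finset.Ico m (n - m)) fun j => oldSite m j ∩ shift j ⁻¹' {x | s ≤ returns m x}

namespace IsTransientLaw

variable {μ : Measure (Path d)} {C : ℝ}

lemma exists_sum_bothVisited_le (hμ : IsTransientLaw μ C) :
    ∃ K : ℝ, 0 < K ∧ ∀ m s : ℕ, 1 ≤ m →
      ∑ y ∈ box d (2 * m), μ.real (bothVisited (3 * m) s y) ≤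
        K * (returnProb μ ^ s + m ^ d * returnProb μ ^ (2 * s)) := by
  have := hμ.prob
  have hC := hμ.C_pos
  set q := returnProb μ with hq
  have hq0 : 0 < q := hμ.returnProb_pos
  have hq1 : q < 1 := hμ.returnProb_lt_one
  obtain ⟨ρ, r₀, hr₀, hρ0, hρq, hρ⟩ : ∃ (ρ : ℝ) (r₀ : ℕ), 1 ≤ r₀ ∧ 0 ≤ ρ ∧ ρ < q ∧
      ∀ r : ℕ, r₀ < r → ∀ s : ℕ, (q + 2 * C / √(r : ℝ)) ^ (2 * s + 1) ≤ ρ ^ s := by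
    have hlim : Tendsto (fun r : ℕ => q + 2 * C / √(r : ℝ)) atTop (𝓝 (q + 0)) :=
      tendsto_const_nhds.add (Tendsto.div_atTop tendsto_const_nhds
        (Real.tendsto_sqrt_atTop.comp tendsto_natCast_atTop_atTop))
    rw [add_zero] at hlim
    -- Any v strictly between q and √q dominates q + 2C/√r for large r and still has ρ = v² < q; the
    -- exponent 2s + 1 then gives ρ^s.
    have hsq : q < √q := by
      rw [Real.lt_sqrt hq0.le]; nlinarith
    obtain ⟨v, hv1, hv2⟩ := exists_between hsq
    have hv0 : 0 < v := hq0.trans hv1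
    obtain ⟨r₀, hr₀⟩ := eventually_atTop.1 (hlim.eventually (eventually_le_nhds hv1))
    refine ⟨v ^ 2, max r₀ 1, le_max_right _ _, sq_nonneg _, ?_, fun r hr s => ?_⟩
    · exact (Real.lt_sqrt hv0.le).1 hv2
    · have h1 := hr₀ r ((le_max_left _ _).trans hr.le)
      have hb0 : 0 ≤ q + 2 * C / √(r : ℝ) := by positivity
      have hv1' : v ≤ 1 := by
        have : √q ≤ 1 := Real.sqrt_le_one.2 hq1.le
        linarith
      calc (q + 2 * C / √(r : ℝ)) ^ (2 * s + 1) ≤ v ^ (2 * s + 1) :=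
            pow_le_pow_left₀ hb0 h1 _
        _ ≤ v ^ (2 * s) := pow_le_pow_of_le_one hv0.le hv1' (by omega)
        _ = (v ^ 2) ^ s := by rw [pow_mul]
  obtain ⟨K₁, hK₁, hgeom⟩ := exists_pow_mul_geom_le d (r := ρ / q) (by positivity)
    (by rwa [div_lt_one hq0])
  set e := Real.exp (6 * C / q) with he
  have he1 : 1 ≤ e := Real.one_le_exp (by positivity)
  -- Three regimes: for |y| ≤ r₀ the returns to 0 alone give q^s; for r₀ < |y| ≤ s² the pair gives
  -- ρ^s; for |y| > s² the excess ratio is at most 2C/s, so raising to the power 2s + 1 costs only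
  -- the constant e.
  have hpt : ∀ m s (y : Fin d → ℤ), μ.real (bothVisited (3 * m) s y) ≤
      (if nrm y ≤ r₀ then q ^ s else 0) + (if nrm y ≤ s ^ 2 then ρ ^ s else 0) +
        e * q ^ (2 * s) := by
    intro m s y
    have hnn1 : 0 ≤ (if nrm y ≤ r₀ then q ^ s else 0) := by split_ifs <;> positivity
    have hnn2 : 0 ≤ (if nrm y ≤ s ^ 2 then ρ ^ s else 0) := by split_ifs <;> positivity
    have hnn3 : 0 ≤ e * q ^ (2 * s) := by positivity
    rcases le_or_gt (nrm y) r₀ with h1 | h1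
    · have := hμ.bothVisited_le_near (3 * m) s y
      rw [if_pos h1]
      linarith
    · have hfar := hμ.bothVisited_le_far (3 * m) s (y := y) (by omega)
      rcases le_or_gt (nrm y) (s ^ 2) with h2 | h2
      · have := hfar.trans (hρ _ h1 s)
        rw [if_pos h2]
        rw [if_pos h2] at hnn2
        linarith
      · refine le_trans ?_ (le_add_of_nonneg_left (add_nonneg hnn1 hnn2))
        rcases Nat.eq_zero_or_pos s with rfl | hs
        · simpa using (measureReal_le_one).trans he1
        · have hs' : (1 : ℝ) ≤ s := by exact_mod_cast hs
          have hsq : (s : ℝ) ≤ √(nrm y : ℝ) := by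
            refine Real.le_sqrt_of_sq_le ?_
            exact_mod_cast h2.le
          calc μ.real (bothVisited (3 * m) s y)
              ≤ (q + 2 * C / √(nrm y : ℝ)) ^ (2 * s + 1) := hfar
            _ ≤ (q + 2 * C / s) ^ (2 * s + 1) := by gcongr
            _ = q ^ (2 * s + 1) * (2 * C / (q * s) + 1) ^ (2 * s + 1) := by
                rw [← mul_pow]
                congr 1
                field_simp
                ring
            _ ≤ q ^ (2 * s + 1) * Real.exp (2 * C / (q * s)) ^ (2 * s + 1) := by
                gcongr
                exact Real.add_one_le_exp _
            _ ≤ q ^ (2 * s) * e := by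
                -- The constant 6C/q comes from 2s + 1 ≤ 3s.
                have hexp : Real.exp (2 * C / (q * s)) ^ (2 * s + 1) ≤ e := by
                  rw [← Real.exp_nat_mul, he]
                  refine Real.exp_le_exp.2 ?_
                  push_cast
                  rw [mul_div_assoc', div_le_div_iff₀ (by positivity) hq0]
                  have : 0 < C * q := by positivity
                  nlinarith
                exact mul_le_mul (pow_le_pow_of_le_one hq0.le hq1.le (by omega)) hexp
                  (by positivity) (by positivity)
            _ = e * q ^ (2 * s) := mul_comm _ _
  refine ⟨((2 * r₀ + 1 : ℕ) : ℝ) ^ d + K₁ + 5 ^ d * e, by positivity, fun m s hm => ?_⟩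
  have hm' : (1 : ℝ) ≤ m := by exact_mod_cast hm
  calc ∑ y ∈ box d (2 * m), μ.real (bothVisited (3 * m) s y)
      ≤ ∑ y ∈ box d (2 * m), ((if nrm y ≤ r₀ then q ^ s else 0) +
          (if nrm y ≤ s ^ 2 then ρ ^ s else 0) + e * q ^ (2 * s)) :=
        Finset.sum_le_sum fun y _ => hpt m s y
    _ ≤ ((2 * r₀ + 1 : ℕ) : ℝ) ^ d * q ^ s + ((2 * s ^ 2 + 1 : ℕ) : ℝ) ^ d * ρ ^ s +
          (5 * m) ^ d * (e * q ^ (2 * s)) := by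
        rw [Finset.sum_add_distrib, Finset.sum_add_distrib]
        refine add_le_add (add_le_add (sum_indicator_box_le _ _ (by positivity))
          (sum_indicator_box_le _ _ (by positivity))) ?_
        rw [Finset.sum_const, card_box, nsmul_eq_mul]
        refine mul_le_mul_of_nonneg_right ?_ (by positivity)
        push_cast
        refine pow_le_pow_left₀ (by positivity) (by linarith) d
    _ ≤ ((2 * r₀ + 1 : ℕ) : ℝ) ^ d * q ^ s + K₁ * q ^ s + 5 ^ d * e * (m ^ d * q ^ (2 * s)) := by
        refine add_le_add (add_le_add le_rfl ?_) (le_of_eq ?_)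
        · have := mul_le_mul_of_nonneg_right (hgeom s) (pow_nonneg hq0.le s)
          rwa [div_pow, mul_assoc, div_mul_cancel₀ _ (pow_pos hq0 s).ne'] at this
        · rw [mul_pow]; ring
    _ ≤ _ := by
        have a1 : 0 ≤ q ^ s := by positivity
        have a2 : 0 ≤ (m : ℝ) ^ d * q ^ (2 * s) := by positivity
        have a3 : 0 ≤ ((2 * r₀ + 1 : ℕ) : ℝ) ^ d := by positivity
        have a4 : 0 ≤ 5 ^ d * e := by positivity
        nlinarith [mul_nonneg a4 a1, mul_nonneg a3 a2, mul_nonneg hK₁.le a2]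

lemma real_tagged_le (hμ : IsTransientLaw μ C) (m s : ℕ) :
    μ.real (tagged m s) ≤ returnProb μ ^ s := by
  have := hμ.prob
  rw [hμ.real_tagged]
  refine (mul_le_of_le_one_left measureReal_nonneg ?_).trans (hμ.returns_le_pow s m)
  linarith [measureReal_nonneg (μ := μ) (s := {x : Path d | 1 ≤ returns m x})]

lemma exists_variance_le (hμ : IsTransientLaw μ C) :
    ∃ K : ℝ, 0 < K ∧ ∀ n m s : ℕ, 1 ≤ m →
      ∫ x, (tagCount n m s x - (n - 2 * m : ℕ) * μ.real (tagged m s)) ^ 2 ∂μ ≤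
        K * n * (returnProb μ ^ s + m ^ d * returnProb μ ^ (2 * s)) := by
  have hq0 := hμ.returnProb_pos
  obtain ⟨K, hK, h⟩ := hμ.exists_sum_bothVisited_le
  refine ⟨1 + 4 * K, by positivity, fun n m s hm => ?_⟩
  have h1 := hμ.integral_sq_sum_indicator_le (L := m + m) (by omega) (determined_tagged m s)
    (n - 2 * m)
  have h2 := hμ.sum_tagged_inter_le m s
  have h3 := h m s hm
  have h4 := hμ.real_tagged_le m s
  have e : ∀ x : Path d, tagCount n m s x - (n - 2 * m : ℕ) * μ.real (tagged m s) =
      ∑ a ∈ Finset.range (n - 2 * m),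
        (Set.indicator (tagged m s) (fun _ => (1 : ℝ)) (shift a x) - μ.real (tagged m s)) := by
    intro x
    rw [Finset.sum_sub_distrib, Finset.sum_const, Finset.card_range, nsmul_eq_mul]
    rfl
  simp_rw [e]
  refine h1.trans ?_
  have h5 : ((n - 2 * m : ℕ) : ℝ) ≤ n := by exact_mod_cast Nat.sub_le _ _
  have h6 : 0 ≤ (m : ℝ) ^ d * returnProb μ ^ (2 * s) := by positivity
  rw [mul_comm (1 + 4 * K), mul_assoc]
  refine mul_le_mul h5 ?_ ?_ (Nat.cast_nonneg _)
  · nlinarith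
  · exact add_nonneg measureReal_nonneg
      (mul_nonneg zero_le_two (Finset.sum_nonneg fun _ _ => measureReal_nonneg))

/-- Give each of the s returns its own m/s steps. One return within that time misses q by O(√(s/m)),
here relaxed to O(s/√m); passing to s-th powers costs another factor s. -/
lemma returnProb_pow_sub_le (hμ : IsTransientLaw μ C) (m s : ℕ) (hm : 1 ≤ m) :
    returnProb μ ^ s - μ.real {x | s ≤ returns m x} ≤
      2 * C / returnProb μ * (s ^ 2 / √m) * returnProb μ ^ s := by
  have := hμ.prob
  have hC := hμ.C_pos
  have hq0 := hμ.returnProb_pos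
  set q := returnProb μ with hq
  rcases Nat.eq_zero_or_pos s with rfl | hs
  · simp
  set k := m / s with hk
  set F := μ.real {x | 1 ≤ returns k x} with hF
  have hs' : (1 : ℝ) ≤ s := by exact_mod_cast hs
  have hm' : (1 : ℝ) ≤ m := by exact_mod_cast hm
  have h1 : F ^ s ≤ μ.real {x | s ≤ returns m x} := by
    refine (hμ.pow_le_returns k s).trans (measureReal_mono fun x (hx : s ≤ returns (s * k) x) => ?_)
    exact hx.trans (visits_mono _ _ _ (Nat.mul_div_le m s))
  have h2 : q - F ≤ 2 * C / √(k + 1 : ℝ) := hμ.returnProb_sub_le k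
  have h3 : √(m : ℝ) / s ≤ √(k + 1 : ℝ) := by
    refine Real.le_sqrt_of_sq_le ?_
    rw [div_pow, Real.sq_sqrt (by positivity), div_le_iff₀ (by positivity)]
    have h4 : m < s * (k + 1) := by
      have := Nat.lt_mul_div_succ m hs
      simpa [hk] using this
    have h5 : (m : ℝ) ≤ s * (k + 1) := by exact_mod_cast h4.le
    have : 0 ≤ (k : ℝ) := Nat.cast_nonneg _
    nlinarith
  have h6 : 2 * C / √(k + 1 : ℝ) ≤ 2 * C / (√(m : ℝ) / s) := by gcongr
  calc q ^ s - μ.real {x | s ≤ returns m x} ≤ q ^ s - F ^ s := by linarith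
    _ ≤ s * q ^ (s - 1) * (q - F) :=
        pow_sub_pow_le measureReal_nonneg (hμ.returns_le k) s
    _ ≤ s * q ^ (s - 1) * (2 * C / (√(m : ℝ) / s)) := by gcongr; exact h2.trans h6
    _ = _ := by
        obtain ⟨t, rfl⟩ := Nat.exists_eq_succ_of_ne_zero hs.ne'
        simp only [Nat.succ_eq_add_one, Nat.add_sub_cancel, pow_succ]
        field_simp

lemma real_lateReturns_le (hμ : IsTransientLaw μ C) (m s : ℕ) (hm : 1 ≤ m) :
    μ.real (lateReturns m s) ≤ 2 * C / returnProb μ * (s ^ 2 / √m) * returnProb μ ^ s := by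
  have := hμ.prob
  refine le_trans ?_ (hμ.returnProb_pow_sub_le m s hm)
  have hsub : {x : Path d | s ≤ returns m x} ⊆ everReturns s := fun x hx => ⟨m, hx⟩
  rw [lateReturns, measureReal_sdiff hsub (determined_visits_le _ _ m s).measurableSet]
  exact sub_le_sub_right (hμ.exists_returns_le_pow s) _

/-- By stationarity a coincidence of positions across a gap r has probability P(S_r = 0), and only
gaps r > m enter. -/
lemma real_oldSite_le (hμ : IsTransientLaw μ C) (m j : ℕ) :
    μ.real (oldSite m j) ≤ 2 * C / √(m + 1 : ℝ) := by
  have := hμ.prob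
  have hsub : (oldSite m j : Set (Path d)) ⊆
      ⋃ r ∈ Finset.Ico (m + 1) j, shift (j - r) ⁻¹' {x | pos x r = 0} := by
    rintro x ⟨i, h0, hi, he⟩
    refine Set.mem_biUnion (x := j - i) (Finset.mem_coe.2 (Finset.mem_Ico.2 (by omega))) ?_
    change pos (shift (j - (j - i)) x) (j - i) = 0
    rw [pos_shift, Nat.sub_sub_self (by omega), Nat.add_sub_cancel' (by omega), he, sub_self]
  calc μ.real (oldSite m j)
      ≤ ∑ r ∈ Finset.Ico (m + 1) j, μ.real (shift (j - r) ⁻¹' {x | pos x r = 0}) :=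
        (measureReal_mono hsub (measure_ne_top μ _)).trans (measureReal_biUnion_finset_le _ _)
    _ ≤ ∑ r ∈ Finset.Ico (m + 1) j, C * (1 / ((r + 1 : ℝ) * √(r + 1))) := by
        refine Finset.sum_le_sum fun r _ => ?_
        rw [hμ.real_shift _ (determined_pos_eq r 0).measurableSet]
        exact hμ.heat r 0
    _ ≤ C * (2 / √(m + 1 : ℝ)) := by
        rw [← Finset.mul_sum]
        exact mul_le_mul_of_nonneg_left (sum_inv_mul_sqrt_le m j) hμ.C_pos.le
    _ = _ := by ring

lemma integrable_upperError (hμ : IsTransientLaw μ C) (n m s : ℕ) :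
    Integrable (upperError n m s) μ := by
  have := hμ.prob
  exact (integrable_count _ fun j _ => measurable_shift j (measurableSet_lateReturns m s)).add
    (integrable_count _ fun j _ => measurable_shift j (measurableSet_everReturns s))

lemma integrable_lowerError (hμ : IsTransientLaw μ C) (n m s : ℕ) :
    Integrable (lowerError n m s) μ := by
  have := hμ.prob
  exact integrable_count _ fun j _ => (determined_oldSite m j).measurableSet.inter
    (measurable_shift j (determined_visits_le _ _ m s).measurableSet)

lemma integral_upperError_le (hμ : IsTransientLaw μ C) (n m s : ℕ) (hm : 1 ≤ m) :
    ∫ x, upperError n m s x ∂μ ≤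
      (2 * C / returnProb μ * (n * (s ^ 2 / √m)) + 3 * m) * returnProb μ ^ s := by
  have := hμ.prob
  have hq0 := hμ.returnProb_pos
  have hm1 : ∀ j, MeasurableSet (shift j ⁻¹' (lateReturns m s : Set (Path d))) :=
    fun j => measurable_shift j (measurableSet_lateReturns m s)
  have hm2 : ∀ j, MeasurableSet (shift j ⁻¹' (everReturns s : Set (Path d))) :=
    fun j => measurable_shift j (measurableSet_everReturns s)
  unfold upperError
  rw [integral_add (integrable_count _ fun j _ => hm1 j) (integrable_count _ fun j _ => hm2 j),
    integral_count _ fun j _ => hm1 j, integral_count _ fun j _ => hm2 j]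
  simp_rw [hμ.real_shift _ (measurableSet_lateReturns m s),
    hμ.real_shift _ (measurableSet_everReturns s)]
  rw [Finset.sum_const, Finset.sum_const, nsmul_eq_mul, nsmul_eq_mul, Nat.card_Ioc, Nat.sub_zero,
    add_mul]
  refine add_le_add ?_ ?_
  · calc _ ≤ (n : ℝ) * (2 * C / returnProb μ * (s ^ 2 / √m) * returnProb μ ^ s) := by
          gcongr; exact hμ.real_lateReturns_le m s hm
      _ = _ := by ring
  · refine mul_le_mul ?_ (hμ.exists_returns_le_pow s) measureReal_nonneg (by positivity)
    have hsub : ((Finset.Ioc 0 n).filter fun j => ¬ (m < j ∧ j < n - m)) ⊆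
        Finset.Ioc 0 m ∪ Finset.Icc (n - m) n := by
      intro j hj
      simp only [Finset.mem_filter, Finset.mem_Ioc, Finset.mem_union, Finset.mem_Icc] at hj ⊢
      omega
    have := (Finset.card_le_card hsub).trans (Finset.card_union_le _ _)
    rw [Nat.card_Ioc, Nat.card_Icc] at this
    have h3 : ((Finset.Ioc 0 n).filter fun j => ¬ (m < j ∧ j < n - m)).card ≤ 3 * m := by omega
    exact_mod_cast h3

/-- Being an old site concerns the past of j and having s returns its future, so the factor q^s is
retained. -/
lemma integral_lowerError_le (hμ : IsTransientLaw μ C) (n m s : ℕ) (hm : 1 ≤ m) :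
    ∫ x, lowerError n m s x ∂μ ≤ n * (2 * C / √m) * returnProb μ ^ s := by
  have := hμ.prob
  have hC := hμ.C_pos
  have hm' : (1 : ℝ) ≤ m := by exact_mod_cast hm
  have hmeas : ∀ j, MeasurableSet (oldSite m j ∩ shift j ⁻¹' {x : Path d | s ≤ returns m x}) :=
    fun j => (determined_oldSite m j).measurableSet.inter
      (measurable_shift j (determined_visits_le _ _ m s).measurableSet)
  unfold lowerError
  rw [integral_count _ fun j _ => hmeas j]
  calc _ ≤ ∑ j ∈ Finset.Ico m (n - m), 2 * C / √m * returnProb μ ^ s := by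
        refine Finset.sum_le_sum fun j _ => ?_
        rw [hμ.real_inter_shift (determined_oldSite m j)
          (determined_visits_le _ _ m s).measurableSet]
        refine mul_le_mul ((hμ.real_oldSite_le m j).trans ?_) (hμ.returns_le_pow s m)
          measureReal_nonneg (by positivity)
        gcongr
        linarith
    _ ≤ _ := by
        rw [Finset.sum_const, Nat.card_Ico, nsmul_eq_mul, ← mul_assoc]
        have hq0 := hμ.returnProb_pos
        gcongr
        omega

lemma exists_mean_sub_le (hμ : IsTransientLaw μ C) :
    ∃ K : ℝ, 0 < K ∧ ∀ n m s : ℕ, 1 ≤ m →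
      |(n - 2 * m : ℕ) * μ.real (tagged m s) - n * (1 - returnProb μ) * returnProb μ ^ s| ≤
        K * (n * ((s ^ 2 + 1) / √m) + m) * returnProb μ ^ s := by
  have := hμ.prob
  have hC := hμ.C_pos
  have hq0 := hμ.returnProb_pos
  have hq1 := hμ.returnProb_lt_one
  refine ⟨2 * C / returnProb μ + 2 * C + 2, by positivity, fun n m s hm => ?_⟩
  have hm' : (1 : ℝ) ≤ m := by exact_mod_cast hm
  set q := returnProb μ with hq
  set F := μ.real {x | 1 ≤ returns m x} with hF
  set G := μ.real {x | s ≤ returns m x} with hG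
  have hp : μ.real (tagged m s) = (1 - F) * G := hμ.real_tagged m s
  have h1 : F ≤ q := hμ.returns_le m
  have h2 : q - F ≤ 2 * C / √m := by
    refine (hμ.returnProb_sub_le m).trans ?_
    gcongr
    linarith
  have h3 : G ≤ q ^ s := hμ.returns_le_pow s m
  have h4 : q ^ s - G ≤ 2 * C / q * (s ^ 2 / √m) * q ^ s := hμ.returnProb_pow_sub_le m s hm
  have hF0 : 0 ≤ F := measureReal_nonneg
  have hG0 : 0 ≤ G := measureReal_nonneg
  have hqs : 0 ≤ q ^ s := by positivity
  have h5 : |(1 - F) * G - (1 - q) * q ^ s| ≤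
      (2 * C / q + 2 * C) * ((s ^ 2 + 1) / √m) * q ^ s := by
    -- Both terms on the right are non-negative errors of cutting off at m: one in the probability
    -- of a new site, one in that of s returns.
    have e1 : (1 - F) * G - (1 - q) * q ^ s = (q - F) * G - (1 - q) * (q ^ s - G) := by ring
    have e2 : 0 ≤ (q - F) * G := mul_nonneg (by linarith) hG0
    have e3 : 0 ≤ (1 - q) * (q ^ s - G) := mul_nonneg (by linarith) (by linarith)
    have e4 : (q - F) * G ≤ 2 * C / √m * q ^ s := by gcongr
    have e5 : (1 - q) * (q ^ s - G) ≤ 2 * C / q * (s ^ 2 / √m) * q ^ s :=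
      (mul_le_of_le_one_left (by linarith) (by linarith)).trans h4
    have e6 : (2 * C / q + 2 * C) * ((s ^ 2 + 1) / √m) * q ^ s =
        2 * C / √m * q ^ s + 2 * C / q * (s ^ 2 / √m) * q ^ s +
        (2 * C / q * (1 / √m) * q ^ s + 2 * C * (s ^ 2 / √m) * q ^ s) := by ring
    have e7 : 0 ≤ 2 * C / q * (1 / √m) * q ^ s + 2 * C * (s ^ 2 / √m) * q ^ s := by positivity
    rw [e1, e6, abs_le]
    constructor <;> linarith
  have hN : (n : ℝ) - 2 * m ≤ (n - 2 * m : ℕ) := by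
    have : n ≤ (n - 2 * m) + 2 * m := by omega
    have : (n : ℝ) ≤ (n - 2 * m : ℕ) + 2 * m := by exact_mod_cast this
    linarith
  have hN' : ((n - 2 * m : ℕ) : ℝ) ≤ n := by exact_mod_cast Nat.sub_le _ _
  set N : ℝ := ((n - 2 * m : ℕ) : ℝ) with hNdef
  have hN0 : 0 ≤ N := Nat.cast_nonneg _
  rw [hp]
  have e : N * ((1 - F) * G) - n * (1 - q) * q ^ s =
      N * ((1 - F) * G - (1 - q) * q ^ s) - (n - N) * ((1 - q) * q ^ s) := by ring
  rw [e]
  refine (abs_sub _ _).trans ?_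
  rw [abs_mul, abs_of_nonneg hN0, abs_of_nonneg (mul_nonneg (by linarith)
    (mul_nonneg (by linarith) hqs) : 0 ≤ (n - N) * ((1 - q) * q ^ s))]
  have f1 : N * |(1 - F) * G - (1 - q) * q ^ s| ≤
      n * ((2 * C / q + 2 * C) * ((s ^ 2 + 1) / √m) * q ^ s) := by gcongr
  have f2 : (n - N) * ((1 - q) * q ^ s) ≤ 2 * m * q ^ s := by
    refine mul_le_mul (by linarith) (mul_le_of_le_one_left hqs (by linarith)) ?_ (by positivity)
    exact mul_nonneg (by linarith) hqs
  have f3 : 0 ≤ (2 * C / q + 2 * C) * m * q ^ s := by positivity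
  have f4 : 0 ≤ 2 * (n * ((s ^ 2 + 1) / √m)) * q ^ s := by positivity
  nlinarith

end IsTransientLaw

end HeavyPoints

/-! ### Pathwise comparison of the counts with tagged times -/

namespace HeavyPoints

variable {d : ℕ}

/-- The position at time `j` is not visited at the times `0 < i < j`. -/
def firstVisit (j : ℕ) : Set (Path d) := {x | ∀ i, 0 < i → i < j → pos x i ≠ pos x j}

/-- The sites visited up to time `n`. -/
def visited (x : Path d) (n : ℕ) : Finset (Fin d → ℤ) := (Finset.Ioc 0 n).image (pos x)

lemma localTime_eq_visits (x : Path d) (v : Fin d → ℤ) (n : ℕ) :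
    localTime (pos x) v n = visits {v} 0 n x := by
  simp [localTime, visits]

lemma localTime_pos_iff (x : Path d) (v : Fin d → ℤ) (n : ℕ) :
    0 < localTime (pos x) v n ↔ v ∈ visited x n := by
  rw [localTime, Finset.card_pos, visited, Finset.mem_image, Finset.Nonempty]
  simp only [Finset.mem_filter]

lemma le_totalLocalTime_iff (x : Path d) (v : Fin d → ℤ) (k : ℕ) :
    (k : ℕ∞) ≤ totalLocalTime (pos x) v ↔ ∃ N, k ≤ localTime (pos x) v N := by
  constructor
  · intro h
    obtain ⟨T, hT, hTk⟩ := Set.exists_subset_encard_eq h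
    have hfin : T.Finite := Set.finite_of_encard_eq_coe hTk
    obtain ⟨N, hN⟩ := hfin.bddAbove
    refine ⟨N, ?_⟩
    rw [hfin.encard_eq_coe_toFinset_card, Nat.cast_inj] at hTk
    rw [← hTk]
    refine Finset.card_le_card fun j hj => ?_
    have hj' := hfin.mem_toFinset.1 hj
    have h1 := hT hj'
    exact Finset.mem_filter.2 ⟨Finset.mem_Ioc.2 ⟨h1.1, hN hj'⟩, h1.2⟩
  · rintro ⟨N, hN⟩
    refine (Nat.cast_le.2 hN).trans ?_
    rw [localTime, ← Set.encard_coe_eq_coe_finsetCard]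
    refine Set.encard_le_encard fun j hj => ?_
    have := Finset.mem_filter.1 (Finset.mem_coe.1 hj)
    exact ⟨(Finset.mem_Ioc.1 this.1).1, this.2⟩

lemma localTime_le_totalLocalTime (x : Path d) (v : Fin d → ℤ) (n : ℕ) :
    (localTime (pos x) v n : ℕ∞) ≤ totalLocalTime (pos x) v :=
  (le_totalLocalTime_iff x v _).2 ⟨n, le_rfl⟩

/-- Each element contributes to the single index j = g v, and one with g v = ⊤ to none. This is why
V leaves out sites visited infinitely often. -/
lemma tsum_card_filter_eq {α : Type*} (A : Finset α) (g : α → ℕ∞) (k : ℕ) :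
    ∑' j : Set.Ici k, (A.filter fun v => g v = ((j : ℕ) : ℕ∞)).card =
      (A.filter fun v => (k : ℕ∞) ≤ g v ∧ g v ≠ ⊤).card := by
  classical
  have h1 : ∀ v, HasSum (fun j : Set.Ici k => if g v = ((j : ℕ) : ℕ∞) then 1 else 0)
      (if (k : ℕ∞) ≤ g v ∧ g v ≠ ⊤ then 1 else 0) := by
    intro v
    by_cases h : (k : ℕ∞) ≤ g v ∧ g v ≠ ⊤
    · rw [if_pos h]
      obtain ⟨n, hn⟩ := ENat.ne_top_iff_exists.1 h.2
      have hk : k ≤ n := by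
        have := h.1
        rw [← hn] at this
        exact_mod_cast this
      have := hasSum_single (f := fun j : Set.Ici k => if g v = ((j : ℕ) : ℕ∞) then 1 else 0)
        ⟨n, hk⟩ (fun j hj => if_neg fun hg => hj (Subtype.ext ?_))
      · simpa [hn] using this
      · rw [← hn] at hg
        exact (by exact_mod_cast hg : n = j).symm
    · rw [if_neg h]
      convert hasSum_zero using 2 with j
      refine if_neg fun hg => h ⟨?_, ?_⟩
      · rw [hg]
        exact_mod_cast j.2
      · rw [hg]
        exact ENat.natCast_ne_top _
  simp_rw [Finset.card_filter]
  exact (hasSum_sum fun v _ => h1 v).tsum_eq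

lemma Q_eq (x : Path d) {k : ℕ} (hk : 0 < k) (n : ℕ) : Q (pos x) k n =
    ((visited x n).filter fun v => (localTime (pos x) v n : ℕ∞) = (k : ℕ∞)).card := by
  rw [Q, ← Set.ncard_coe_finset]
  congr 1
  ext v
  simp only [Finset.coe_filter, Set.mem_ofPred_eq, Nat.cast_inj, ← localTime_pos_iff]
  omega

lemma U_eq (x : Path d) (k n : ℕ) : U (pos x) k n =
    ((visited x n).filter fun v => totalLocalTime (pos x) v = (k : ℕ∞)).card := by
  rw [U, ← Set.ncard_coe_finset]
  congr 1
  ext v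
  simp only [Finset.coe_filter, Set.mem_ofPred_eq, ← localTime_pos_iff]
  exact ⟨fun h => ⟨h.1, h.2.2⟩, fun h => ⟨h.1, localTime_le_totalLocalTime x v n, h.2⟩⟩

lemma R_eq (x : Path d) {k : ℕ} (hk : 0 < k) (n : ℕ) : R (pos x) k n =
    ((visited x n).filter fun v => k ≤ localTime (pos x) v n).card := by
  have := tsum_card_filter_eq (visited x n) (fun v => (localTime (pos x) v n : ℕ∞)) k
  rw [R]
  simp_rw [fun j : Set.Ici k => Q_eq x (hk.trans_le j.2) n]
  rw [this]
  simp

lemma V_eq (x : Path d) (k n : ℕ) : V (pos x) k n =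
    ((visited x n).filter fun v => (k : ℕ∞) ≤ totalLocalTime (pos x) v ∧
      totalLocalTime (pos x) v ≠ ⊤).card := by
  rw [V]
  simp_rw [fun j : Set.Ici k => U_eq x j n]
  exact tsum_card_filter_eq (visited x n) (fun v => totalLocalTime (pos x) v) k

lemma R_eq_Q_add (x : Path d) {k : ℕ} (hk : 0 < k) (n : ℕ) :
    R (pos x) k n = Q (pos x) k n + R (pos x) (k + 1) n := by
  rw [R_eq x hk, R_eq x k.succ_pos, Q_eq x hk, ← Finset.card_union_of_disjoint]
  · congr 1
    ext v
    simp only [Finset.mem_filter, Finset.mem_union, Nat.cast_inj, ← and_or_left]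
    exact and_congr_right fun _ => by omega
  · refine Finset.disjoint_filter.2 fun v _ h => ?_
    rw [Nat.cast_inj] at h
    omega

lemma V_eq_U_add (x : Path d) (k n : ℕ) :
    V (pos x) k n = U (pos x) k n + V (pos x) (k + 1) n := by
  rw [V_eq, V_eq, U_eq, ← Finset.card_union_of_disjoint]
  · congr 1
    ext v
    simp only [Finset.mem_filter, Finset.mem_union, ← and_or_left]
    refine and_congr_right fun _ => ?_
    cases h : totalLocalTime (pos x) v with
    | top => simp
    | coe a =>
      simp only [Nat.cast_le, ne_eq, ENat.natCast_ne_top, not_false_eq_true, and_true, Nat.cast_inj]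
      omega
  · refine Finset.disjoint_filter.2 fun v _ h => ?_
    rw [h, Nat.cast_le]
    omega

lemma visited_mono (x : Path d) : Monotone (visited x) := fun _ _ h =>
  Finset.image_subset_image (Finset.Ioc_subset_Ioc le_rfl h)

lemma R_mono (x : Path d) {k : ℕ} (hk : 0 < k) : Monotone fun n => R (pos x) k n := by
  intro a b hab
  simp only [R_eq x hk]
  refine Finset.card_le_card fun v hv => ?_
  rw [Finset.mem_filter] at hv ⊢
  refine ⟨visited_mono x hab hv.1, hv.2.trans ?_⟩
  rw [localTime_eq_visits, localTime_eq_visits]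
  exact visits_mono {v} 0 x hab

lemma V_mono (x : Path d) (k : ℕ) : Monotone fun n => V (pos x) k n := by
  intro a b hab
  simp only [V_eq]
  refine Finset.card_le_card fun v hv => ?_
  rw [Finset.mem_filter] at hv ⊢
  exact ⟨visited_mono x hab hv.1, hv.2⟩

/-- A visited site corresponds to exactly one time, that of its first visit. Time 0 does not count,
so the origin is new at its first return. -/
lemma card_visited_filter (x : Path d) (n : ℕ) (p : (Fin d → ℤ) → Prop) [DecidablePred p] :
    (((visited x n).filter p).card : ℝ) =
      count (Finset.Ioc 0 n) (fun j => firstVisit j ∩ {x | p (pos x j)}) x := by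
  classical
  have h : ((visited x n).filter p) = ((Finset.Ioc 0 n).filter fun j =>
      x ∈ firstVisit j ∩ {x : Path d | p (pos x j)}).image (pos x) := by
    ext v
    simp only [Finset.mem_filter, Finset.mem_image, visited, Finset.mem_Ioc]
    constructor
    · rintro ⟨⟨j, hj, rfl⟩, hp⟩
      have hex : ∃ i, 0 < i ∧ pos x i = pos x j := ⟨j, hj.1, rfl⟩
      obtain ⟨h0, he⟩ := Nat.find_spec hex
      refine ⟨Nat.find hex, ⟨⟨h0, (Nat.find_min' hex ⟨hj.1, rfl⟩).trans hj.2⟩, ?_, ?_⟩, he⟩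
      · exact fun i hi0 hi h => Nat.find_min hex hi ⟨hi0, h.trans he⟩
      · change p (pos x (Nat.find hex))
        rw [he]
        exact hp
    · rintro ⟨j, ⟨hj, hx⟩, rfl⟩
      exact ⟨⟨j, hj, rfl⟩, hx.2⟩
  rw [h, Finset.card_image_of_injOn, count, Finset.card_filter]
  · push_cast
    refine Finset.sum_congr rfl fun j _ => ?_
    rw [Set.indicator_apply]
  · intro i hi j hj hij
    simp only [Finset.coe_filter, Set.mem_ofPred_eq, Finset.mem_Ioc] at hi hj
    rcases lt_trichotomy i j with h | h | h
    · exact absurd hij (hj.2.1 i hi.1.1 h)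
    · exact h
    · exact absurd hij.symm (hi.2.1 j hj.1.1 h)

lemma localTime_firstVisit {x : Path d} {j n : ℕ} (hj : 0 < j) (hjn : j ≤ n)
    (hx : x ∈ firstVisit j) :
    localTime (pos x) (pos x j) n = 1 + returns (n - j) (shift j x) := by
  rw [localTime_eq_visits, visits_firstHit_add hj hjn (Finset.mem_singleton_self (pos x j))]
  · congr 1
    simp [returns, visits]
  · exact ⟨zero_add _, fun i h0 hi => by simpa using hx i h0 hi⟩

lemma le_totalLocalTime_firstVisit {x : Path d} {j s : ℕ} (hj : 0 < j) (hx : x ∈ firstVisit j) :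
    ((s + 1 : ℕ) : ℕ∞) ≤ totalLocalTime (pos x) (pos x j) ↔ shift j x ∈ everReturns s := by
  rw [le_totalLocalTime_iff]
  constructor
  · rintro ⟨N, hN⟩
    refine ⟨N, ?_⟩
    have h1 : localTime (pos x) (pos x j) N ≤ localTime (pos x) (pos x j) (j + N) := by
      rw [localTime_eq_visits, localTime_eq_visits]
      exact visits_mono _ 0 x (by omega)
    have h2 := localTime_firstVisit (n := j + N) hj (by omega) hx
    rw [Nat.add_sub_cancel_left] at h2
    omega
  · rintro ⟨N, hN⟩
    refine ⟨j + N, ?_⟩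
    rw [localTime_firstVisit hj (by omega) hx, Nat.add_sub_cancel_left]
    omega

lemma count_mono {J : Finset ℕ} {A B : ℕ → Set (Path d)} {x : Path d}
    (h : ∀ j ∈ J, x ∈ A j → x ∈ B j) : count J A x ≤ count J B x := by
  classical
  refine Finset.sum_le_sum fun j hj => ?_
  rw [Set.indicator_apply, Set.indicator_apply]
  split_ifs with h1 h2 h2
  · exact le_rfl
  · exact absurd (h j hj h1) h2
  · exact zero_le_one
  · exact le_rfl

lemma count_mono_left {J J' : Finset ℕ} (h : J ⊆ J') (A : ℕ → Set (Path d)) (x : Path d) :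
    count J A x ≤ count J' A x :=
  Finset.sum_le_sum_of_subset_of_nonneg h fun _ _ _ =>
    Set.indicator_nonneg (fun _ _ => zero_le_one) _

lemma count_union_le {J : Finset ℕ} {A B D : ℕ → Set (Path d)} {x : Path d}
    (h : ∀ j ∈ J, x ∈ A j → x ∈ B j ∨ x ∈ D j) : count J A x ≤ count J B x + count J D x := by
  classical
  rw [count, count, count, ← Finset.sum_add_distrib]
  refine Finset.sum_le_sum fun j hj => ?_
  rw [Set.indicator_apply, Set.indicator_apply, Set.indicator_apply]
  by_cases h1 : x ∈ A j
  · rcases h j hj h1 with h2 | h2 <;> simp only [h1, h2, if_true] <;> split_ifs <;> norm_num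
  · rw [if_neg h1]
    split_ifs <;> norm_num

lemma tagCount_eq (n m s : ℕ) (x : Path d) : tagCount n m s x =
    count (Finset.Ico m (n - m)) (fun j => shift (j - m) ⁻¹' tagged m s) x := by
  rw [tagCount, count, count, Finset.sum_Ico_eq_sum_range,
    show n - m - m = n - 2 * m by omega]
  refine Finset.sum_congr rfl fun a _ => ?_
  rw [Nat.add_sub_cancel_left]

lemma mem_shift_tagged {m s j : ℕ} (hj : m ≤ j) {x : Path d} :
    shift (j - m) x ∈ tagged m s ↔
      (∀ i, j - m ≤ i → i < j → pos x i ≠ pos x j) ∧ s ≤ returns m (shift j x) := by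
  have e : shift m (shift (j - m) x) = shift j x := by rw [shift_shift, Nat.sub_add_cancel hj]
  have h2 : shift (j - m) x ∈ shift m ⁻¹' {x : Path d | s ≤ returns m x} ↔
      s ≤ returns m (shift j x) := by rw [Set.mem_preimage, e]; rfl
  rw [tagged, Set.mem_inter_iff, h2]
  refine and_congr_left fun _ => ?_
  have h1 : shift (j - m) x ∈ fresh m ↔ ∀ i < m, pos x (j - m + i) ≠ pos x j := by
    simp only [fresh, Set.mem_ofPred_eq, pos_shift, Nat.sub_add_cancel hj]
    simp
  rw [h1]
  refine ⟨fun h i hi hij => ?_, fun h i hi => h _ (by omega) (by omega)⟩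
  have := h (i - (j - m)) (by omega)
  rwa [Nat.add_sub_cancel' hi] at this

/-- A tagged time either is a first visit, whose s returns happen before n, or its site was met more
than m steps earlier, which the error counts. -/
lemma tagCount_le_R (x : Path d) {m : ℕ} (hm : 1 ≤ m) (n s : ℕ) :
    tagCount n m s x ≤ R (pos x) (s + 1) n + lowerError n m s x := by
  rw [R_eq x s.succ_pos, card_visited_filter, tagCount_eq, lowerError]
  have hsub : Finset.Ico m (n - m) ⊆ Finset.Ioc 0 n := fun j hj => by
    rw [Finset.mem_Ico] at hj
    rw [Finset.mem_Ioc]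
    omega
  refine (count_union_le (B := fun j => firstVisit j ∩
    {y : Path d | s + 1 ≤ localTime (pos x) (pos y j) n}) fun j hj hx => ?_).trans
    (add_le_add (count_mono_left hsub _ x) le_rfl)
  have hj' := Finset.mem_Ico.1 hj
  obtain ⟨h1, h2⟩ := (mem_shift_tagged hj'.1).1 hx
  by_cases hf : x ∈ firstVisit j
  · refine Or.inl ⟨hf, ?_⟩
    change s + 1 ≤ localTime (pos x) (pos x j) n
    rw [localTime_firstVisit (by omega) (by omega) hf]
    have := visits_mono {0} 0 (shift j x) (show m ≤ n - j by omega)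
    simp only at this
    change s ≤ visits {0} 0 m (shift j x) at h2
    change s + 1 ≤ 1 + visits {0} 0 (n - j) (shift j x)
    omega
  · refine Or.inr ⟨?_, h2⟩
    simp only [firstVisit, Set.mem_ofPred_eq, not_forall, not_not] at hf
    obtain ⟨i, h0, hi, he⟩ := hf
    refine ⟨i, h0, ?_, he⟩
    by_contra hlt
    exact h1 i (by omega) hi he

/-- A first visit followed by at least s returns is tagged unless some of these returns come later
than m steps or the time is close to an end of [0, n]; the two parts of the error count these cases.
-/
lemma V_le_tagCount (x : Path d) (m n s : ℕ) :
    (V (pos x) (s + 1) n : ℝ) ≤ tagCount n m s x + upperError n m s x := by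
  classical
  have h1 : (V (pos x) (s + 1) n : ℝ) ≤
      count (Finset.Ioc 0 n) (fun j => firstVisit j ∩ shift j ⁻¹' everReturns s) x := by
    rw [V_eq, card_visited_filter]
    refine count_mono fun j hj hx => ⟨hx.1, ?_⟩
    exact (le_totalLocalTime_firstVisit (Finset.mem_Ioc.1 hj).1 hx.1).1 hx.2.1
  refine h1.trans ?_
  -- The strict m < j keeps the window [j - m, j) away from time 0, about which `firstVisit` says
  -- nothing.
  have h2 : count (Finset.Ioc 0 n) (fun j => firstVisit j ∩ shift j ⁻¹' everReturns s) x =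
      count ((Finset.Ioc 0 n).filter fun j => m < j ∧ j < n - m)
        (fun j => firstVisit j ∩ shift j ⁻¹' everReturns s) x +
      count ((Finset.Ioc 0 n).filter fun j => ¬ (m < j ∧ j < n - m))
        (fun j => firstVisit j ∩ shift j ⁻¹' everReturns s) x :=
    (Finset.sum_filter_add_sum_filter_not _ _ _).symm
  have h3 : count ((Finset.Ioc 0 n).filter fun j => m < j ∧ j < n - m)
        (fun j => firstVisit j ∩ shift j ⁻¹' everReturns s) x ≤
      count ((Finset.Ioc 0 n).filter fun j => m < j ∧ j < n - m)
        (fun j => shift (j - m) ⁻¹' tagged m s) x +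
      count ((Finset.Ioc 0 n).filter fun j => m < j ∧ j < n - m)
        (fun j => shift j ⁻¹' lateReturns m s) x := by
    refine count_union_le fun j hj hx => ?_
    obtain ⟨_, hj1, _⟩ := Finset.mem_filter.1 hj
    by_cases hr : s ≤ returns m (shift j x)
    · exact Or.inl ((mem_shift_tagged hj1.le).2
        ⟨fun i hi hij => hx.1 i (by omega) hij, hr⟩)
    · exact Or.inr ⟨hx.2, hr⟩
  have h4 : count ((Finset.Ioc 0 n).filter fun j => m < j ∧ j < n - m)
        (fun j => shift (j - m) ⁻¹' tagged m s) x ≤ tagCount n m s x := by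
    rw [tagCount_eq]
    refine count_mono_left (fun j hj => ?_) _ x
    obtain ⟨_, hj1, hj2⟩ := Finset.mem_filter.1 hj
    exact Finset.mem_Ico.2 ⟨hj1.le, hj2⟩
  have h5 := count_mono_left (Finset.filter_subset (fun j => m < j ∧ j < n - m) (Finset.Ioc 0 n))
    (fun j => shift j ⁻¹' lateReturns m s) x
  have h6 : count ((Finset.Ioc 0 n).filter fun j => ¬ (m < j ∧ j < n - m))
        (fun j => firstVisit j ∩ shift j ⁻¹' everReturns s) x ≤
      count ((Finset.Ioc 0 n).filter fun j => ¬ (m < j ∧ j < n - m))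
        (fun j => shift j ⁻¹' everReturns s) x := count_mono fun j _ hx => hx.2
  rw [upperError]
  linarith

/-- Finiteness of the number of returns is needed because V omits sites of infinite total local
time; it holds almost surely by transience. -/
lemma R_le_V {x : Path d} (hx : ∀ j, ∃ s, shift j x ∉ everReturns s) {k : ℕ} (hk : 0 < k) (n : ℕ) :
    R (pos x) k n ≤ V (pos x) k n := by
  rw [R_eq x hk, V_eq]
  refine Finset.card_le_card fun v hv => ?_
  rw [Finset.mem_filter] at hv ⊢
  refine ⟨hv.1, (Nat.cast_le.2 hv.2).trans (localTime_le_totalLocalTime x v n), fun htop => ?_⟩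
  have hex : ∃ i, 0 < i ∧ pos x i = v := by
    obtain ⟨j, hj, hjv⟩ := Finset.mem_image.1 hv.1
    exact ⟨j, (Finset.mem_Ioc.1 hj).1, hjv⟩
  classical
  obtain ⟨h0, he⟩ := Nat.find_spec hex
  have hf : x ∈ firstVisit (Nat.find hex) :=
    fun i hi0 hi h => Nat.find_min hex hi ⟨hi0, h.trans he⟩
  obtain ⟨s, hs⟩ := hx (Nat.find hex)
  refine hs ((le_totalLocalTime_firstVisit h0 hf).1 ?_)
  rw [he, htop]
  exact le_top

lemma IsTransientLaw.ae_finite_returns {μ : Measure (Path d)} {C : ℝ} (hμ : IsTransientLaw μ C) :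
    ∀ᵐ x ∂μ, ∀ j, ∃ s, shift j x ∉ everReturns s := by
  have := hμ.prob
  refine ae_all_iff.2 fun j => ?_
  have h0 : μ.real (shift j ⁻¹' ⋂ s, everReturns s) = 0 := by
    rw [hμ.real_shift j (.iInter measurableSet_everReturns)]
    refine le_antisymm (ge_of_tendsto' (tendsto_pow_atTop_nhds_zero_of_lt_one
      hμ.returnProb_pos.le hμ.returnProb_lt_one) fun s => ?_) measureReal_nonneg
    exact (measureReal_mono (Set.iInter_subset _ s)).trans (hμ.exists_returns_le_pow s)
  rw [measureReal_eq_zero_iff] at h0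
  rw [ae_iff]
  refine measure_mono_null (fun x hx => ?_) h0
  refine Set.mem_iInter.2 fun s => ?_
  by_contra h
  exact hx ⟨s, h⟩

end HeavyPoints

/-! ### Deviations: pathwise consequences and expectation -/

namespace HeavyPoints

variable {d : ℕ}

/-- Cauchy condensation reduces this to ∑ k^(-a). The summand 1 keeps the base of the power positive
at n = 1. -/
lemma summable_inv_mul_log_rpow {a : ℝ} (ha : 1 < a) :
    Summable fun n : ℕ => 1 / (n * (1 + Real.log n) ^ a) := by
  have hlog : ∀ n : ℕ, 0 ≤ Real.log n := Real.log_natCast_nonneg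
  rw [← summable_condensed_iff_of_nonneg]
  · have h2 : 0 < Real.log 2 := Real.log_pos one_lt_two
    have hs : Summable fun k : ℕ => (Real.log 2) ^ (-a) * (1 / (k : ℝ) ^ a) :=
      (Real.summable_one_div_nat_rpow.2 ha).mul_left _
    rw [← summable_nat_add_iff 1]
    refine Summable.of_nonneg_of_le (fun k => ?_) (fun k => ?_) ((summable_nat_add_iff 1).2 hs)
    · have := hlog (2 ^ (k + 1))
      positivity
    · have e : Real.log ((2 ^ (k + 1) : ℕ) : ℝ) = (k + 1 : ℕ) * Real.log 2 := by
        push_cast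
        rw [Real.log_pow]
        push_cast
        ring
      rw [e, Real.rpow_neg h2.le, ← one_div, one_div_mul_one_div, ← Real.mul_rpow h2.le (by positivity),
        mul_one_div]
      push_cast
      rw [div_mul_eq_div_div, div_self (by positivity)]
      gcongr
      linarith
  · intro n
    have := hlog n
    positivity
  · intro m n hm hmn
    have h0 : (0 : ℝ) < m := by exact_mod_cast hm
    have h1 := hlog m
    gcongr

lemma ae_summable_of_integral_le {α : Type*} [MeasurableSpace α] {μ : Measure α}
    {f : ℕ → α → ℝ} (h0 : ∀ n x, 0 ≤ f n x) (hi : ∀ n, Integrable (f n) μ) {c : ℕ → ℝ}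
    (hc : Summable c) (hfc : ∀ n, ∫ x, f n x ∂μ ≤ c n) : ∀ᵐ x ∂μ, Summable fun n => f n x := by
  have hm : ∀ n, AEMeasurable (fun x => ENNReal.ofReal (f n x)) μ := fun n =>
    (hi n).aemeasurable.ennreal_ofReal
  have hc0 : ∀ n, 0 ≤ c n := fun n => (integral_nonneg (h0 n)).trans (hfc n)
  have h1 : ∫⁻ x, ∑' n, ENNReal.ofReal (f n x) ∂μ ≠ ⊤ := by
    rw [lintegral_tsum hm]
    have h2 : ∀ n, ∫⁻ x, ENNReal.ofReal (f n x) ∂μ ≤ ENNReal.ofReal (c n) := fun n => by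
      rw [← ofReal_integral_eq_lintegral_ofReal (hi n) (Eventually.of_forall (h0 n))]
      exact ENNReal.ofReal_le_ofReal (hfc n)
    refine ne_top_of_le_ne_top ?_ (ENNReal.tsum_le_tsum h2)
    rw [← ENNReal.ofReal_tsum_of_nonneg hc0 hc]
    exact ENNReal.ofReal_ne_top
  filter_upwards [ae_lt_top' (AEMeasurable.tsum hm) h1] with x hx
  have := ENNReal.summable_toReal hx.ne
  exact this.congr fun n => ENNReal.toReal_ofReal (h0 n x)

/-- The deviation of the number of tagged times from its mean, and the relative errors. -/
noncomputable def deviation (q : ℝ) (n m s : ℕ) (x : Path d) : ℝ :=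
  ((tagCount n m s x - n * (1 - q) * q ^ s) / (n * q ^ s)) ^ 2 +
    (upperError n m s x + lowerError n m s x) / (n * q ^ s)

lemma upperError_nonneg (n m s : ℕ) (x : Path d) : 0 ≤ upperError n m s x :=
  add_nonneg (count_nonneg _ _ _) (count_nonneg _ _ _)

lemma lowerError_nonneg (n m s : ℕ) (x : Path d) : 0 ≤ lowerError n m s x := count_nonneg _ _ _

lemma deviation_nonneg {q : ℝ} (hq : 0 ≤ q) (n m s : ℕ) (x : Path d) :
    0 ≤ deviation q n m s x :=
  add_nonneg (sq_nonneg _) (div_nonneg (add_nonneg (upperError_nonneg n m s x)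
    (lowerError_nonneg n m s x)) (by positivity))

/-- One δ comes from the squared fluctuation, the other from the error terms, which are at most δ² ≤
δ relative to n q^s. -/
lemma bounds_of_deviation_le {q δ : ℝ} (hq : 0 < q) (hδ : 0 ≤ δ) (hδ1 : δ ≤ 1) {n m s : ℕ}
    (hn : 1 ≤ n) (hm : 1 ≤ m) {x : Path d} (h : deviation q n m s x ≤ δ ^ 2) :
    (1 - q - 2 * δ) * (n * q ^ s) ≤ R (pos x) (s + 1) n ∧
      (V (pos x) (s + 1) n : ℝ) ≤ (1 - q + 2 * δ) * (n * q ^ s) := by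
  have hn' : (1 : ℝ) ≤ n := by exact_mod_cast hn
  have hM : 0 < n * q ^ s := by positivity
  have hu := upperError_nonneg n m s x
  have hl := lowerError_nonneg n m s x
  have h1 : ((tagCount n m s x - n * (1 - q) * q ^ s) / (n * q ^ s)) ^ 2 ≤ δ ^ 2 := by
    refine le_trans ?_ h
    exact le_add_of_nonneg_right (by positivity)
  have h2 : (upperError n m s x + lowerError n m s x) / (n * q ^ s) ≤ δ := by
    have : (upperError n m s x + lowerError n m s x) / (n * q ^ s) ≤ δ ^ 2 := by
      refine le_trans ?_ h
      exact le_add_of_nonneg_left (sq_nonneg _)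
    nlinarith
  have h3 := abs_le_of_sq_le_sq h1 hδ
  rw [abs_le, le_div_iff₀ hM, div_le_iff₀ hM] at h3
  rw [div_le_iff₀ hM] at h2
  have h4 := tagCount_le_R x hm n s
  have h5 := V_le_tagCount x m n s
  constructor <;> nlinarith

lemma measurable_tagCount (n m s : ℕ) : Measurable (tagCount n m s : Path d → ℝ) := by
  unfold tagCount count
  exact Finset.measurable_fun_sum _ fun a _ => measurable_const.indicator
    (measurable_shift a (determined_tagged m s).measurableSet)

lemma abs_tagCount_le (n m s : ℕ) (x : Path d) : |tagCount n m s x| ≤ n := by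
  have h0 : 0 ≤ tagCount n m s x := count_nonneg _ _ _
  rw [abs_of_nonneg h0]
  calc tagCount n m s x ≤ ∑ _j ∈ Finset.range (n - 2 * m), (1 : ℝ) := by
        unfold tagCount count
        exact Finset.sum_le_sum fun a _ => Set.indicator_le_self' (fun _ _ => zero_le_one) x
    _ ≤ n := by
        rw [Finset.sum_const, Finset.card_range, nsmul_eq_mul, mul_one]
        exact_mod_cast Nat.sub_le _ _

namespace IsTransientLaw

variable {μ : Measure (Path d)} {C : ℝ}

lemma integrable_sq_tagCount_sub (hμ : IsTransientLaw μ C) (n m s : ℕ) (c : ℝ) :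
    Integrable (fun x => (tagCount n m s x - c) ^ 2) μ := by
  have := hμ.prob
  refine Integrable.of_bound (((measurable_tagCount n m s).sub_const c).pow_const
    2).aestronglyMeasurable ((n + |c|) ^ 2) (Eventually.of_forall fun x => ?_)
  rw [Real.norm_eq_abs, abs_pow]
  refine pow_le_pow_left₀ (abs_nonneg _) ?_ 2
  exact (abs_sub _ _).trans (add_le_add (abs_tagCount_le n m s x) le_rfl)

lemma integrable_deviation (hμ : IsTransientLaw μ C) (q : ℝ) (n m s : ℕ) :
    Integrable (deviation q n m s) μ := by
  unfold deviation
  refine Integrable.add ?_ (((hμ.integrable_upperError n m s).add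
    (hμ.integrable_lowerError n m s)).div_const _)
  simp_rw [div_pow]
  exact (hμ.integrable_sq_tagCount_sub n m s _).div_const _

lemma integral_deviation (hμ : IsTransientLaw μ C) (q : ℝ) (n m s : ℕ) :
    ∫ x, deviation q n m s x ∂μ =
      (∫ x, (tagCount n m s x - n * (1 - q) * q ^ s) ^ 2 ∂μ) / (n * q ^ s) ^ 2 +
      (∫ x, upperError n m s x ∂μ + ∫ x, lowerError n m s x ∂μ) / (n * q ^ s) := by
  have h1 := (hμ.integrable_sq_tagCount_sub n m s (n * (1 - q) * q ^ s)).div_const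
    ((n * q ^ s) ^ 2)
  have h2 : Integrable (fun x => (upperError n m s x + lowerError n m s x) / (n * q ^ s)) μ :=
    ((hμ.integrable_upperError n m s).add (hμ.integrable_lowerError n m s)).div_const _
  unfold deviation
  simp_rw [div_pow]
  rw [integral_add h1 h2, integral_div, integral_div,
    integral_add (hμ.integrable_upperError n m s) (hμ.integrable_lowerError n m s)]

lemma integral_sq_tagCount_sub_le (hμ : IsTransientLaw μ C) (n m s : ℕ) (p e : ℝ) :
    ∫ x, (tagCount n m s x - e) ^ 2 ∂μ ≤
      2 * ∫ x, (tagCount n m s x - p) ^ 2 ∂μ + 2 * (p - e) ^ 2 := by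
  have := hμ.prob
  have hI := (hμ.integrable_sq_tagCount_sub n m s p).const_mul 2
  calc ∫ x, (tagCount n m s x - e) ^ 2 ∂μ
      ≤ ∫ x, (2 * (tagCount n m s x - p) ^ 2 + 2 * (p - e) ^ 2) ∂μ := by
        refine integral_mono (hμ.integrable_sq_tagCount_sub n m s e)
          (hI.add (integrable_const _)) fun x => ?_
        nlinarith [sq_nonneg (tagCount n m s x - p - (p - e))]
    _ = 2 * ∫ x, (tagCount n m s x - p) ^ 2 ∂μ + 2 * (p - e) ^ 2 := by
        rw [integral_add hI (integrable_const _), integral_const_mul]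
        simp

/-- Variance, squared bias and mean errors, divided by the appropriate power of n q^s: the powers of
q^s cancel except in 1/(n q^s), which alone limits the admissible levels. -/
lemma exists_integral_deviation_le (hμ : IsTransientLaw μ C) :
    ∃ K : ℝ, 0 < K ∧ ∀ n m s : ℕ, 1 ≤ n → 1 ≤ m →
      ∫ x, deviation (returnProb μ) n m s x ∂μ ≤
        K * (1 / (n * returnProb μ ^ s) + m ^ d / n + ((s ^ 2 + 1) / √m + m / n) +
          ((s ^ 2 + 1) / √m + m / n) ^ 2) := by
  have := hμ.prob
  have hC := hμ.C_pos
  have hq0 := hμ.returnProb_pos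
  obtain ⟨K₁, hK₁, hvar⟩ := hμ.exists_variance_le
  obtain ⟨K₂, hK₂, hmean⟩ := hμ.exists_mean_sub_le
  refine ⟨2 * K₁ + 2 * K₂ ^ 2 + (2 * C / returnProb μ + 3 + 2 * C), by positivity,
    fun n m s hn hm => ?_⟩
  have hn' : (1 : ℝ) ≤ n := by exact_mod_cast hn
  have hm' : (1 : ℝ) ≤ m := by exact_mod_cast hm
  have hvar := hvar n m s hm
  have hmean := hmean n m s hm
  have hup := hμ.integral_upperError_le n m s hm
  have hlow := hμ.integral_lowerError_le n m s hm
  set q := returnProb μ with hq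
  set p : ℝ := (n - 2 * m : ℕ) * μ.real (tagged m s) with hp
  set e : ℝ := n * (1 - q) * q ^ s with he
  set u : ℝ := (s ^ 2 + 1) / √m + m / n with hu
  have hu0 : 0 ≤ u := by positivity
  have hM : 0 < n * q ^ s := by positivity
  have h1 : ∫ x, (tagCount n m s x - e) ^ 2 ∂μ ≤
      2 * (K₁ * n * (q ^ s + m ^ d * q ^ (2 * s))) + 2 * (p - e) ^ 2 := by
    have := hμ.integral_sq_tagCount_sub_le n m s p e
    linarith
  have h2 : (p - e) ^ 2 ≤ (K₂ * u * (n * q ^ s)) ^ 2 := by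
    refine sq_le_sq' ?_ ?_
    all_goals
      have e1 : K₂ * u * (n * q ^ s) = K₂ * (n * ((s ^ 2 + 1) / √m) + m) * q ^ s := by
        rw [hu]; field_simp
      rw [e1]
      have := abs_le.1 hmean
      linarith [this.1, this.2]
  have h3 : (∫ x, (tagCount n m s x - e) ^ 2 ∂μ) / (n * q ^ s) ^ 2 ≤
      2 * K₁ * (1 / (n * q ^ s) + m ^ d / n) + 2 * K₂ ^ 2 * u ^ 2 := by
    rw [div_le_iff₀ (by positivity)]
    refine (h1.trans (add_le_add le_rfl (mul_le_mul_of_nonneg_left h2 zero_le_two))).trans_eq ?_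
    rw [pow_mul']
    field_simp
  have h4 : (∫ x, upperError n m s x ∂μ + ∫ x, lowerError n m s x ∂μ) / (n * q ^ s) ≤
      (2 * C / q + 3 + 2 * C) * u := by
    rw [div_le_iff₀ hM]
    refine (add_le_add hup hlow).trans ?_
    have e1 : (2 * C / q + 3 + 2 * C) * u * (n * q ^ s) =
        ((2 * C / q * (n * (s ^ 2 / √m)) + 3 * m) * q ^ s + n * (2 * C / √m) * q ^ s) +
        (2 * C / q * (n * (1 / √m)) + 2 * C / q * m + 3 * (n * ((s ^ 2 + 1) / √m)) +
          2 * C * (n * (s ^ 2 / √m)) + 2 * C * m) * q ^ s := by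
      rw [hu]; field_simp; ring
    rw [e1]
    exact le_add_of_nonneg_right (by positivity)
  rw [hμ.integral_deviation]
  refine (add_le_add h3 h4).trans ?_
  have a1 : 0 ≤ 1 / (n * q ^ s) + m ^ d / (n : ℝ) := by positivity
  have a2 : 0 ≤ u ^ 2 := by positivity
  have a3 : 0 ≤ 2 * C / q + 3 + 2 * C := by positivity
  have a4 : 0 ≤ K₂ ^ 2 := by positivity
  nlinarith [mul_nonneg hK₁.le a2, mul_nonneg hK₁.le hu0, mul_nonneg a4 a1, mul_nonneg a4 hu0,
    mul_nonneg a3 a1, mul_nonneg a3 a2]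

end IsTransientLaw

/-- The window used at time `n`. -/
noncomputable def window (n : ℕ) : ℕ := ⌈Real.log n ^ 10⌉₊

/-- The levels that are not too rare at time `n`. -/
def IsLevel (q b : ℝ) (n s : ℕ) : Prop := Real.log n ^ b ≤ 2 ^ b * (n * q ^ s)

open Classical in
/-- The sum of the deviations over the levels that are not too rare at time `n`. -/
noncomputable def totalDeviation (q b A : ℝ) (n : ℕ) (x : Path d) : ℝ :=
  ∑ s ∈ (Finset.range (⌊A * Real.log n⌋₊ + 1)).filter (IsLevel q b n),
    deviation q n (window n) s x

lemma totalDeviation_nonneg {q : ℝ} (hq : 0 ≤ q) (b A : ℝ) (n : ℕ) (x : Path d) :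
    0 ≤ totalDeviation q b A n x :=
  Finset.sum_nonneg fun _ _ => deviation_nonneg hq _ _ _ _

/-- Taking logarithms in 1 ≤ 2^b n q^s; hence only O(log n) levels enter the total deviation. -/
lemma level_le {q b : ℝ} (hq0 : 0 < q) (hq1 : q < 1) (hb : 0 ≤ b) {n : ℕ} (hn : 1 ≤ Real.log n)
    {s : ℕ} (hs : IsLevel q b n s) : s ≤ (1 + b) / Real.log (1 / q) * Real.log n := by
  have hn0 : (0 : ℝ) < n := by
    rcases Nat.eq_zero_or_pos n with rfl | h
    · simp at hn; linarith
    · exact_mod_cast h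
  have hlq : 0 < Real.log (1 / q) := Real.log_pos ((one_lt_div hq0).2 hq1)
  have h1 : (1 : ℝ) ≤ 2 ^ b * (n * q ^ s) := (Real.one_le_rpow hn hb).trans hs
  have h2 := Real.log_nonneg h1
  rw [Real.log_mul (by positivity) (by positivity), Real.log_rpow two_pos,
    Real.log_mul (by positivity) (by positivity), Real.log_pow] at h2
  have h3 : Real.log 2 ≤ 1 := by
    have := Real.log_two_lt_d9
    linarith
  have h4 : Real.log (1 / q) = -Real.log q := by rw [one_div, Real.log_inv]
  rw [div_mul_eq_mul_div, le_div_iff₀ hlq, h4]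
  nlinarith [mul_nonneg hb (sub_nonneg.2 hn), mul_nonneg hb (sub_nonneg.2 h3)]

lemma one_le_window {n : ℕ} (hn : 1 ≤ Real.log n) : 1 ≤ window n :=
  Nat.one_le_ceil_iff.2 (by positivity)

lemma deviation_le_totalDeviation {q b : ℝ} (hq0 : 0 < q) (hq1 : q < 1) (hb : 0 ≤ b) {n : ℕ}
    (hn : 1 ≤ Real.log n) {s : ℕ} (hs : IsLevel q b n s) (x : Path d) :
    deviation q n (window n) s x ≤
      totalDeviation q b ((1 + b) / Real.log (1 / q)) n x := by
  classical
  refine Finset.single_le_sum (f := fun s => deviation q n (window n) s x)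
    (fun _ _ => deviation_nonneg hq0.le _ _ _ _) ?_
  simp only [Finset.mem_filter, Finset.mem_range]
  exact ⟨Nat.lt_succ_of_le (Nat.le_floor (level_le hq0 hq1 hb hn hs)), hs⟩

end HeavyPoints

/-! ### Almost sure convergence: summability and interpolation in n -/

namespace HeavyPoints

variable {d : ℕ}

lemma one_le_log {n : ℕ} (hn : 3 ≤ n) : 1 ≤ Real.log n := by
  have hn' : (3 : ℝ) ≤ n := by exact_mod_cast hn
  rw [Real.le_log_iff_exp_le (by linarith)]
  linarith [Real.exp_one_lt_d9]

lemma eventually_log_pow_le (k : ℕ) : ∀ᶠ n : ℕ in atTop, Real.log n ^ k ≤ n := by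
  have h := (Real.isLittleO_pow_log_id_atTop (n := k)).comp_tendsto tendsto_natCast_atTop_atTop
  filter_upwards [h.bound one_pos, eventually_ge_atTop 1] with n hn _
  simp only [Function.comp, id, Real.norm_eq_abs, one_mul, Nat.abs_cast] at hn
  exact (le_abs_self _).trans hn

/-- With L = log n, the window L^10 gives √m ≥ L^5 against s² = O(L²), so all terms but the first
are O(L^(-3)). For b ≤ 3 they are dominated by the first, which is O(L^(-b)). -/
lemma rate_le {b A : ℝ} (hb3 : b ≤ 3) (d : ℕ) {q : ℝ} (hq0 : 0 < q)
    {n s : ℕ} (hn : 3 ≤ n) (hd : Real.log n ^ (10 * d + 3) ≤ n) (h13 : Real.log n ^ 13 ≤ n)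
    (hs : IsLevel q b n s) (hsA : s ≤ A * Real.log n) :
    1 / (n * q ^ s) + (window n : ℝ) ^ d / n + ((s ^ 2 + 1) / √(window n : ℝ) + window n / n) +
        ((s ^ 2 + 1) / √(window n : ℝ) + window n / n) ^ 2 ≤
      (2 ^ b + 2 ^ d + (A ^ 2 + 3) + (A ^ 2 + 3) ^ 2) * (1 / Real.log n ^ b) := by
  have hL := one_le_log hn
  set L := Real.log n with hLdef
  have hL0 : 0 < L := by linarith
  have hn0 : (0 : ℝ) < n := by positivity
  set m := window n with hm
  have hm1 : L ^ 10 ≤ m := Nat.le_ceil _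
  have hm2 : (m : ℝ) ≤ 2 * L ^ 10 := by
    have := Nat.ceil_lt_add_one (a := L ^ 10) (by positivity)
    have h1 : (1 : ℝ) ≤ L ^ 10 := one_le_pow₀ hL
    exact this.le.trans (by linarith)
  have hsq : L ^ 5 ≤ √(m : ℝ) := by
    refine Real.le_sqrt_of_sq_le ?_
    rw [← pow_mul]
    exact hm1
  have hL3 : 1 / L ^ 3 ≤ 1 / L ^ b := by
    refine one_div_le_one_div_of_le (by positivity) ?_
    rw [← Real.rpow_natCast]
    exact Real.rpow_le_rpow_of_exponent_le hL (by exact_mod_cast hb3)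
  have hL3' : 1 / L ^ 3 ≤ 1 := by
    rw [div_le_one (by positivity)]
    exact one_le_pow₀ hL
  have hL30 : 0 ≤ 1 / L ^ 3 := by positivity
  have e1 : 1 / (n * q ^ s) ≤ 2 ^ b * (1 / L ^ b) := by
    rw [mul_one_div, div_le_div_iff₀ (by positivity) (by positivity), one_mul]
    exact hs
  have e2 : (m : ℝ) ^ d / n ≤ 2 ^ d * (1 / L ^ 3) := by
    rw [mul_one_div, div_le_div_iff₀ hn0 (by positivity)]
    calc (m : ℝ) ^ d * L ^ 3 ≤ (2 * L ^ 10) ^ d * L ^ 3 := by gcongr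
      _ = 2 ^ d * L ^ (10 * d + 3) := by rw [mul_pow, ← pow_mul, pow_add]; ring
      _ ≤ _ := by gcongr
  have e3 : (s ^ 2 + 1) / √(m : ℝ) ≤ (A ^ 2 + 1) * (1 / L ^ 3) := by
    rw [mul_one_div, div_le_div_iff₀ (lt_of_lt_of_le (by positivity) hsq) (by positivity)]
    have h1 : (s : ℝ) ^ 2 + 1 ≤ (A ^ 2 + 1) * L ^ 2 := by
      have h2 : (s : ℝ) ^ 2 ≤ (A * L) ^ 2 := pow_le_pow_left₀ (Nat.cast_nonneg _) hsA 2
      have h3 : (1 : ℝ) ≤ L ^ 2 := one_le_pow₀ hL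
      rw [mul_pow] at h2
      linarith
    calc ((s : ℝ) ^ 2 + 1) * L ^ 3 ≤ (A ^ 2 + 1) * L ^ 2 * L ^ 3 := by gcongr
      _ = (A ^ 2 + 1) * L ^ 5 := by ring
      _ ≤ _ := by gcongr
  have e4 : (m : ℝ) / n ≤ 2 * (1 / L ^ 3) := by
    rw [mul_one_div, div_le_div_iff₀ hn0 (by positivity)]
    calc (m : ℝ) * L ^ 3 ≤ 2 * L ^ 10 * L ^ 3 := by gcongr
      _ = 2 * L ^ 13 := by ring
      _ ≤ _ := by gcongr
  set u : ℝ := (s ^ 2 + 1) / √(m : ℝ) + m / n with hu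
  have hu0 : 0 ≤ u := by positivity
  have e5 : u ≤ (A ^ 2 + 3) * (1 / L ^ 3) := by
    rw [hu]; linarith
  have e6 : u ^ 2 ≤ (A ^ 2 + 3) ^ 2 * (1 / L ^ 3) := by
    calc u ^ 2 ≤ ((A ^ 2 + 3) * (1 / L ^ 3)) ^ 2 := pow_le_pow_left₀ hu0 e5 2
      _ = (A ^ 2 + 3) ^ 2 * ((1 / L ^ 3) * (1 / L ^ 3)) := by ring
      _ ≤ (A ^ 2 + 3) ^ 2 * (1 / L ^ 3) := by
          gcongr
          exact mul_le_of_le_one_left hL30 hL3'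
  have f2 : (2 : ℝ) ^ d * (1 / L ^ 3) ≤ 2 ^ d * (1 / L ^ b) := by gcongr
  have f5 : (A ^ 2 + 3) * (1 / L ^ 3) ≤ (A ^ 2 + 3) * (1 / L ^ b) := by gcongr
  have f6 : (A ^ 2 + 3) ^ 2 * (1 / L ^ 3) ≤ (A ^ 2 + 3) ^ 2 * (1 / L ^ b) := by gcongr
  linarith

namespace IsTransientLaw

variable {μ : Measure (Path d)} {C : ℝ}

lemma integrable_totalDeviation (hμ : IsTransientLaw μ C) (q b A : ℝ) (n : ℕ) :
    Integrable (totalDeviation q b A n) μ :=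
  integrable_finsetSum _ fun s _ => hμ.integrable_deviation q n (window n) s

/-- The sum over O(log n) levels loses one power of the logarithm, whence the exponent b - 1. -/
lemma exists_integral_totalDeviation_le (hμ : IsTransientLaw μ C) {b A : ℝ} (hb : 1 ≤ b)
    (hb3 : b ≤ 3) (hA : 0 ≤ A) : ∃ K : ℝ, ∃ n₀ : ℕ, 1 ≤ n₀ ∧ ∀ n ≥ n₀,
      ∫ x, totalDeviation (returnProb μ) b A n x ∂μ ≤ K * (1 / (1 + Real.log n) ^ (b - 1)) := by
  classical
  have hq0 := hμ.returnProb_pos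
  set q := returnProb μ
  obtain ⟨K, hK, hdev⟩ := hμ.exists_integral_deviation_le
  obtain ⟨n₀, hn₀⟩ := eventually_atTop.1 ((eventually_log_pow_le (10 * d + 3)).and
    ((eventually_log_pow_le 13).and (eventually_ge_atTop 3)))
  set K' := K * (2 ^ b + 2 ^ d + (A ^ 2 + 3) + (A ^ 2 + 3) ^ 2) with hK'
  have hK'0 : 0 < K' := by positivity
  refine ⟨(A + 1) * K' * 2 ^ (b - 1), max n₀ 1, le_max_right _ _, fun n hn => ?_⟩
  obtain ⟨h1, h2, h3⟩ := hn₀ n ((le_max_left _ _).trans hn)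
  have hL := one_le_log h3
  set L := Real.log n with hLdef
  have hL0 : 0 < L := by linarith
  unfold totalDeviation
  rw [integral_finsetSum _ fun s _ => hμ.integrable_deviation q n (window n) s]
  calc _ ≤ ∑ s ∈ (Finset.range (⌊A * L⌋₊ + 1)).filter (IsLevel q b n), K' * (1 / L ^ b) := by
        refine Finset.sum_le_sum fun s hs => ?_
        simp only [Finset.mem_filter, Finset.mem_range] at hs
        refine (hdev n (window n) s (by omega) (one_le_window hL)).trans ?_
        rw [hK', mul_assoc K]
        refine mul_le_mul_of_nonneg_left ?_ hK.le
        refine rate_le hb3 d hq0 h3 h1 h2 hs.2 ?_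
        exact (Nat.cast_le.2 (Nat.lt_succ_iff.1 hs.1)).trans (Nat.floor_le (by positivity))
    _ ≤ ((A + 1) * L) * (K' * (1 / L ^ b)) := by
        rw [Finset.sum_const, nsmul_eq_mul]
        refine mul_le_mul_of_nonneg_right ?_ (by positivity)
        have h4 := Finset.card_filter_le (Finset.range (⌊A * L⌋₊ + 1)) (IsLevel q b n)
        rw [Finset.card_range] at h4
        have h5 : (((Finset.range (⌊A * L⌋₊ + 1)).filter (IsLevel q b n)).card : ℝ) ≤
            ⌊A * L⌋₊ + 1 := by exact_mod_cast h4
        have h6 := Nat.floor_le (a := A * L) (by positivity)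
        linarith
    _ = (A + 1) * K' * (1 / L ^ (b - 1)) := by
        rw [Real.rpow_sub_one hL0.ne']
        field_simp
    _ ≤ (A + 1) * K' * (2 ^ (b - 1) * (1 / (1 + L) ^ (b - 1))) := by
        refine mul_le_mul_of_nonneg_left ?_ (by positivity)
        rw [mul_one_div, div_le_div_iff₀ (by positivity) (by positivity), one_mul,
          ← Real.mul_rpow two_pos.le hL0.le]
        exact Real.rpow_le_rpow (by positivity) (by linarith) (by linarith)
    _ = _ := by ring

lemma ae_summable_totalDeviation (hμ : IsTransientLaw μ C) {b A : ℝ} (hb : 2 < b) (hb3 : b ≤ 3)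
    (hA : 0 ≤ A) :
    ∀ᵐ x ∂μ, Summable fun n : ℕ => totalDeviation (returnProb μ) b A n x / n := by
  have hq0 := hμ.returnProb_pos
  obtain ⟨K, n₀, hn₀, h⟩ := hμ.exists_integral_totalDeviation_le (by linarith : 1 ≤ b) hb3 hA
  have hsum : Summable fun n : ℕ => K * (1 / ((n + n₀ : ℕ) *
      (1 + Real.log (n + n₀ : ℕ)) ^ (b - 1))) :=
    (((summable_nat_add_iff n₀).2 (summable_inv_mul_log_rpow (by linarith : 1 < b - 1)))).mul_left K
  have := ae_summable_of_integral_le (μ := μ)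
    (f := fun n x => totalDeviation (returnProb μ) b A (n + n₀) x / (n + n₀ : ℕ))
    (fun n x => div_nonneg (totalDeviation_nonneg hq0.le _ _ _ _) (Nat.cast_nonneg _))
    (fun n => (hμ.integrable_totalDeviation _ b A _).div_const _) hsum fun n => ?_
  · filter_upwards [this] with x hx
    exact (summable_nat_add_iff (f := fun n : ℕ =>
      totalDeviation (returnProb μ) b A n x / n) n₀).1 hx
  · rw [integral_div]
    have h1 := h (n + n₀) (Nat.le_add_left _ _)
    have h2 : (0 : ℝ) < (n + n₀ : ℕ) := by
      exact_mod_cast (show 0 < n + n₀ by omega)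
    rw [div_le_iff₀ h2]
    refine h1.trans_eq ?_
    field_simp

end IsTransientLaw

/-- If a exceeded ε on all of [N, (1+η)N], that stretch alone would contribute at least εη/(1+η) to
a tail of the series. -/
lemma eventually_exists_le_of_summable_div {a : ℕ → ℝ} (h0 : ∀ n, 0 ≤ a n)
    (hs : Summable fun n : ℕ => a n / n) {η ε : ℝ} (hη : 0 < η) (hε : 0 < ε) :
    ∀ᶠ N : ℕ in atTop, ∃ n : ℕ, N ≤ n ∧ (n : ℝ) ≤ (1 + η) * N ∧ a n ≤ ε := by
  have htail := tendsto_sum_nat_add fun n : ℕ => a n / n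
  have hδ : 0 < ε * η / (1 + η) := by positivity
  filter_upwards [htail.eventually (eventually_lt_nhds hδ), eventually_ge_atTop 1] with N hN hN1
  by_contra! hcon
  have hN0 : (0 : ℝ) < N := by exact_mod_cast hN1
  set M := ⌊(1 + η) * N⌋₊ + 1 with hM
  have hMN : η * N ≤ ((M - N : ℕ) : ℝ) := by
    have h1 : (1 + η) * N < M := by
      rw [hM]; push_cast; exact Nat.lt_floor_add_one _
    have h2 : (M : ℝ) ≤ (M - N : ℕ) + N := by
      exact_mod_cast (show M ≤ M - N + N by omega)
    linarith
  have h1 : ∑ k ∈ Finset.range (M - N), ε / ((1 + η) * N) ≤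
      ∑ k ∈ Finset.range (M - N), a (k + N) / (k + N : ℕ) := by
    refine Finset.sum_le_sum fun k hk => ?_
    have hk' := Finset.mem_range.1 hk
    have h3 : ((k + N : ℕ) : ℝ) ≤ (1 + η) * N :=
      (Nat.cast_le.2 (show k + N ≤ ⌊(1 + η) * N⌋₊ by omega)).trans (Nat.floor_le (by positivity))
    have h4 := hcon (k + N) (by omega) h3
    have h5 : (0 : ℝ) < (k + N : ℕ) := by exact_mod_cast (show 0 < k + N by omega)
    exact div_le_div₀ (h0 _) h4.le h5 h3
  have h2 : ∑ k ∈ Finset.range (M - N), a (k + N) / (k + N : ℕ) ≤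
      ∑' k, a (k + N) / (k + N : ℕ) :=
    Summable.sum_le_tsum _ (fun k _ => div_nonneg (h0 _) (Nat.cast_nonneg _))
      ((summable_nat_add_iff N).2 hs)
  rw [Finset.sum_const, Finset.card_range, nsmul_eq_mul] at h1
  have h6 : ε * η / (1 + η) ≤ ((M - N : ℕ) : ℝ) * (ε / ((1 + η) * N)) := by
    calc ε * η / (1 + η) = η * N * (ε / ((1 + η) * N)) := by field_simp
      _ ≤ _ := by gcongr
  linarith

/-- The factor 2^b in `IsLevel` is the slack for moving to a nearby time: it absorbs n ≤ 2p when p ≤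
n, and log p ≤ 2 log n when p ≥ n. -/
lemma isLevel_of_near {q b : ℝ} (hq : 0 ≤ q) (hb : 1 ≤ b) {n p s : ℕ} (hn : 1 ≤ n)
    (hpn : (p : ℝ) ≤ n ^ 2) (hnp : (n : ℝ) ≤ 2 * p) (h : Real.log n ^ b ≤ n * q ^ s) :
    IsLevel q b p s := by
  have hn' : (1 : ℝ) ≤ n := by exact_mod_cast hn
  have hp0 : (0 : ℝ) < p := by linarith
  have hqs : 0 ≤ q ^ s := pow_nonneg hq s
  unfold IsLevel
  rcases le_total p n with hle | hle
  · have hb2 : (2 : ℝ) ≤ 2 ^ b := by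
      calc (2 : ℝ) = 2 ^ (1 : ℝ) := (Real.rpow_one 2).symm
        _ ≤ 2 ^ b := Real.rpow_le_rpow_of_exponent_le one_le_two hb
    calc Real.log p ^ b ≤ Real.log n ^ b :=
          Real.rpow_le_rpow (Real.log_natCast_nonneg p)
            (Real.log_le_log hp0 (by exact_mod_cast hle)) (by linarith)
      _ ≤ n * q ^ s := h
      _ ≤ 2 * p * q ^ s := by gcongr
      _ ≤ 2 ^ b * (p * q ^ s) := by
          rw [mul_assoc]
          gcongr
  · have h1 : Real.log p ≤ 2 * Real.log n := by
      have := Real.log_le_log hp0 hpn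
      rwa [Real.log_pow, Nat.cast_ofNat] at this
    calc Real.log p ^ b ≤ (2 * Real.log n) ^ b :=
          Real.rpow_le_rpow (Real.log_natCast_nonneg p) h1 (by linarith)
      _ = 2 ^ b * Real.log n ^ b := Real.mul_rpow two_pos.le (Real.log_natCast_nonneg n)
      _ ≤ 2 ^ b * (p * q ^ s) := by
          gcongr
          exact h.trans (by gcongr)

lemma one_sub_mul_le {c ε : ℝ} (hc : 0 < c) (h : 8 * c ≤ ε) :
    (1 - ε) * (1 + c) ^ 2 ≤ 1 - 2 * c := by
  have h1 : (1 - ε) * (1 + c) ^ 2 ≤ (1 - 8 * c) * (1 + c) ^ 2 := by gcongr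
  nlinarith [pow_pos hc 2, pow_pos hc 3]

lemma one_add_mul_le {c ε : ℝ} (hc : 0 < c) (h1 : 8 * c ≤ 1) (h : 8 * c ≤ ε) :
    (1 + 2 * c) * (1 + c) ≤ 1 + ε := by
  nlinarith

/-- For a given path, the numbers of sites visited at least `s + 1` times are asymptotic to their
means, uniformly over the levels that are not too rare. -/
lemma eventually_R_V {q b : ℝ} (hq0 : 0 < q) (hq1 : q < 1) (hb : 1 ≤ b) {x : Path d}
    (hfin : ∀ j, ∃ s, shift j x ∉ everReturns s)
    (hs : Summable fun n : ℕ => totalDeviation q b ((1 + b) / Real.log (1 / q)) n x / n)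
    {ε : ℝ} (hε : 0 < ε) : ∀ᶠ n : ℕ in atTop, ∀ s : ℕ, Real.log n ^ b ≤ n * q ^ s →
      |(R (pos x) (s + 1) n : ℝ) / (n * ((1 - q) * q ^ s)) - 1| ≤ ε ∧
      |(V (pos x) (s + 1) n : ℝ) / (n * ((1 - q) * q ^ s)) - 1| ≤ ε := by
  set c : ℝ := min ε 1 / 8 with hc
  have hc0 : 0 < c := by positivity
  have hcε : 8 * c ≤ ε := by
    have := min_le_left ε 1
    linarith
  have hc1 : 8 * c ≤ 1 := by
    have := min_le_right ε 1
    linarith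
  have hγ : 0 < 1 - q := by linarith
  -- Deviations are measured relative to n q^s but the main term is (1-q) n q^s; the tolerance
  -- (1-q)c makes the relative error 2c.
  have hδ0 : 0 < (1 - q) * c := by positivity
  have hδ1 : (1 - q) * c ≤ 1 := by nlinarith
  have hev := eventually_exists_le_of_summable_div
    (fun n => totalDeviation_nonneg hq0.le b ((1 + b) / Real.log (1 / q)) n x) hs hc0
    (pow_pos hδ0 2)
  have hdiv : Tendsto (fun n : ℕ => ⌊(n : ℝ) / (1 + c)⌋₊) atTop atTop :=
    tendsto_nat_floor_atTop.comp
      (tendsto_natCast_atTop_atTop.atTop_div_const (by positivity))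
  have hlarge : ∀ᶠ n : ℕ in atTop, (n : ℝ) / (1 + c) ^ 2 ≤ ⌊(n : ℝ) / (1 + c)⌋₊ := by
    have h1 : Tendsto (fun n : ℕ => (n : ℝ) * (c / (1 + c) ^ 2)) atTop atTop :=
      tendsto_natCast_atTop_atTop.atTop_mul_const (by positivity)
    filter_upwards [h1.eventually_ge_atTop 1] with n hn
    have h2 := Nat.lt_floor_add_one ((n : ℝ) / (1 + c))
    have h3 : (n : ℝ) / (1 + c) = n / (1 + c) ^ 2 + n * (c / (1 + c) ^ 2) := by field_simp
    linarith
  filter_upwards [hev, hdiv.eventually hev, hlarge, eventually_ge_atTop 6] with n hp hm hl hn6 s hsl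
  have hn6' : (6 : ℝ) ≤ n := by exact_mod_cast hn6
  have hLn := one_le_log (show 3 ≤ n by omega)
  have hqs : 0 < q ^ s := by positivity
  -- A good time p just above n bounds V(n) by V(p), and a good time m just below bounds R(n) by
  -- R(m). Together with R ≤ V this encloses both counts at time n.
  obtain ⟨p, hp1, hp2, hp3⟩ := hp
  obtain ⟨m, hm1, hm2, hm3⟩ := hm
  have hmn : (m : ℝ) ≤ n := by
    refine hm2.trans ?_
    calc (1 + c) * (⌊(n : ℝ) / (1 + c)⌋₊ : ℝ) ≤ (1 + c) * (n / (1 + c)) := by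
          gcongr
          exact Nat.floor_le (by positivity)
      _ = n := by field_simp
  have hm1' : (n : ℝ) / (1 + c) ^ 2 ≤ m := hl.trans (by exact_mod_cast hm1)
  have hnm : (n : ℝ) ≤ 2 * m := by
    rw [div_le_iff₀ (by positivity)] at hm1'
    have : (1 + c) ^ 2 ≤ 2 := by nlinarith
    nlinarith [(Nat.cast_nonneg m : (0 : ℝ) ≤ m)]
  have hm3' : 3 ≤ m := by
    have : (3 : ℝ) ≤ m := by linarith
    exact_mod_cast this
  have hp1' : (n : ℝ) ≤ p := by exact_mod_cast hp1
  have hp2' : (p : ℝ) ≤ n ^ 2 := by nlinarith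
  have hlevp : IsLevel q b p s := isLevel_of_near hq0.le hb (by omega) hp2' (by linarith) hsl
  have hlevm : IsLevel q b m s :=
    isLevel_of_near hq0.le hb (by omega) (hmn.trans (by nlinarith)) hnm hsl
  have hLp := one_le_log (show 3 ≤ p by omega)
  have hLm := one_le_log hm3'
  have Bp := bounds_of_deviation_le hq0 hδ0.le hδ1 (by omega) (one_le_window hLp)
    ((deviation_le_totalDeviation hq0 hq1 (by linarith) hLp hlevp x).trans hp3)
  have Bm := bounds_of_deviation_le hq0 hδ0.le hδ1 (by omega) (one_le_window hLm)
    ((deviation_le_totalDeviation hq0 hq1 (by linarith) hLm hlevm x).trans hm3)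
  have hRV : (R (pos x) (s + 1) n : ℝ) ≤ V (pos x) (s + 1) n := by
    exact_mod_cast R_le_V hfin s.succ_pos n
  have hRm : (R (pos x) (s + 1) m : ℝ) ≤ R (pos x) (s + 1) n := by
    exact_mod_cast R_mono x s.succ_pos (by exact_mod_cast hmn : m ≤ n)
  have hVp : (V (pos x) (s + 1) n : ℝ) ≤ V (pos x) (s + 1) p := by
    exact_mod_cast V_mono x (s + 1) hp1
  set D : ℝ := n * ((1 - q) * q ^ s) with hD
  have hD0 : 0 < D := by positivity
  have hlow : (1 - ε) * D ≤ R (pos x) (s + 1) n := by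
    refine le_trans ?_ (Bm.1.trans hRm)
    have h1 := one_sub_mul_le hc0 hcε
    have h2 : (1 - ε) * n ≤ (1 - 2 * c) * m := by
      have h3 : (1 - 2 * c) * (n / (1 + c) ^ 2) ≤ (1 - 2 * c) * m :=
        mul_le_mul_of_nonneg_left hm1' (by linarith)
      refine le_trans ?_ h3
      rw [mul_div_assoc', le_div_iff₀ (by positivity)]
      calc (1 - ε) * n * (1 + c) ^ 2 = (1 - ε) * (1 + c) ^ 2 * n := by ring
        _ ≤ _ := mul_le_mul_of_nonneg_right h1 (Nat.cast_nonneg n)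
    have h4 : 0 < (1 - q) * q ^ s := by positivity
    calc (1 - ε) * D = (1 - ε) * n * ((1 - q) * q ^ s) := by rw [hD]; ring
      _ ≤ (1 - 2 * c) * m * ((1 - q) * q ^ s) := mul_le_mul_of_nonneg_right h2 h4.le
      _ = _ := by ring
  have hhigh : (V (pos x) (s + 1) n : ℝ) ≤ (1 + ε) * D := by
    refine (hVp.trans Bp.2).trans ?_
    calc (1 - q + 2 * ((1 - q) * c)) * (p * q ^ s) = (1 + 2 * c) * p * ((1 - q) * q ^ s) := by ring
      _ ≤ (1 + 2 * c) * ((1 + c) * n) * ((1 - q) * q ^ s) := by gcongr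
      _ = (1 + 2 * c) * (1 + c) * D := by rw [hD]; ring
      _ ≤ (1 + ε) * D := mul_le_mul_of_nonneg_right (one_add_mul_le hc0 hc1 hcε) hD0.le
  have key : ∀ r : ℝ, (1 - ε) * D ≤ r → r ≤ (1 + ε) * D → |r / D - 1| ≤ ε := by
    intro r h1 h2
    rw [← le_div_iff₀ hD0] at h1
    rw [← div_le_iff₀ hD0] at h2
    rw [abs_le]
    constructor <;> linarith
  exact ⟨key _ hlow (hRV.trans hhigh), key _ (hlow.trans hRV) hhigh⟩

end HeavyPoints

/-! ### From R and V to all four counts, and transfer to the given walk -/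

open MeasureTheory ProbabilityTheory Filter Topology

namespace HeavyPoints

variable {d : ℕ}

lemma tendsto_supDev {m : ℕ → ℕ} {f : ℕ → ℕ → ℝ}
    (h : ∀ ε > 0, ∀ᶠ n in atTop, ∀ t, 1 ≤ t → t ≤ m n → |f n t - 1| ≤ ε) :
    Tendsto (fun n => supDev (m n) (f n)) atTop (𝓝 0) := by
  have h0 : ∀ n, 0 ≤ supDev (m n) (f n) := fun n => Real.iSup_nonneg fun _ => abs_nonneg _
  refine tendsto_order.2 ⟨fun a ha => Eventually.of_forall fun n => ha.trans_le (h0 n),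
    fun a ha => ?_⟩
  filter_upwards [h (a / 2) (half_pos ha)] with n hn
  exact (Real.iSup_le (fun t : Set.Icc 1 (m n) => hn t t.2.1 t.2.2) (half_pos ha).le).trans_lt (half_lt_self ha)

/-- The level t_n is defined by this inequality, in logarithmic form. It bounds q^t, not only
q^(t-1), which leaves room for differences of consecutive levels. -/
lemma log_rpow_le_of_le_tn {q B : ℝ} (hq0 : 0 < q) (hq1 : q < 1) {n t : ℕ} (hn : 3 ≤ n)
    (ht : 1 ≤ t) (htn : t ≤ tn (1 - q) B n) : Real.log n ^ B ≤ n * q ^ t := by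
  have hL := one_le_log hn
  have hL0 : 0 < Real.log n := by linarith
  have hn0 : (0 : ℝ) < n := by positivity
  have hlq : 0 < -Real.log q := neg_pos.2 (Real.log_neg hq0 hq1)
  have h1 : (t : ℝ) ≤ psi (1 - q) B n := (Nat.le_floor_iff' (by omega)).1 htn
  have h2 : lam (1 - q) = 1 / -Real.log q := by
    rw [lam, sub_sub_cancel, div_neg, neg_div]
  have h3 : (t : ℝ) * -Real.log q ≤ Real.log n - B * Real.log (Real.log n) := by
    rw [← le_div_iff₀ hlq]
    refine h1.trans_eq ?_
    rw [psi, h2]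
    ring
  rw [← Real.log_le_log_iff (by positivity) (by positivity), Real.log_rpow hL0,
    Real.log_mul (by positivity) (by positivity), Real.log_pow]
  linarith

/-- For v ≈ D and v' ≈ Dq the difference is D(1-q), a fixed fraction of D, so relative accuracy
survives subtraction. -/
lemma abs_sub_div_le {q ε D u v v' : ℝ} (hq0 : 0 < q) (hq1 : q < 1) (hD : 0 < D) (hv : v = u + v')
    (h : |v / D - 1| ≤ ε * (1 - q) / 2) (h' : |v' / (D * q) - 1| ≤ ε * (1 - q) / 2) :
    |u / (D * (1 - q)) - 1| ≤ ε := by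
  have hγ : 0 < 1 - q := by linarith
  have e : u / (D * (1 - q)) - 1 = ((v / D - 1) - q * (v' / (D * q) - 1)) / (1 - q) := by
    rw [hv]
    field_simp
    ring
  rw [e, abs_div, abs_of_pos hγ, div_le_iff₀ hγ]
  refine (abs_sub _ _).trans ?_
  rw [abs_mul, abs_of_pos hq0]
  have : q * |v' / (D * q) - 1| ≤ 1 * |v' / (D * q) - 1| := by gcongr
  linarith

/-- For a given path, the uniform asymptotics of the four counts follow from those of `R` and `V`
over the levels that are not too rare. -/
lemma tendsto_of_eventually_R_V {q b B : ℝ} (hq0 : 0 < q) (hq1 : q < 1) (hbB : b ≤ B)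
    {x : Path d} (h : ∀ ε > 0, ∀ᶠ n : ℕ in atTop, ∀ s : ℕ, Real.log n ^ b ≤ n * q ^ s →
      |(R (pos x) (s + 1) n : ℝ) / (n * ((1 - q) * q ^ s)) - 1| ≤ ε ∧
      |(V (pos x) (s + 1) n : ℝ) / (n * ((1 - q) * q ^ s)) - 1| ≤ ε) :
    Tendsto (fun n : ℕ => supDev (tn (1 - q) B n) fun t =>
      (U (pos x) t n : ℝ) / (n * (1 - q) * mu (1 - q) t)) atTop (𝓝 0) ∧
    Tendsto (fun n : ℕ => supDev (tn (1 - q) B n) fun t =>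
      (Q (pos x) t n : ℝ) / (n * (1 - q) * mu (1 - q) t)) atTop (𝓝 0) ∧
    Tendsto (fun n : ℕ => supDev (tn (1 - q) B n) fun t =>
      (V (pos x) t n : ℝ) / (n * mu (1 - q) t)) atTop (𝓝 0) ∧
    Tendsto (fun n : ℕ => supDev (tn (1 - q) B n) fun t =>
      (R (pos x) t n : ℝ) / (n * mu (1 - q) t)) atTop (𝓝 0) := by
  have hγ : 0 < 1 - q := by linarith
  have hmu : ∀ s, mu (1 - q) (s + 1) = (1 - q) * q ^ s := fun s => by simp [mu]
  have hmu' : ∀ (n : ℕ) (s : ℕ), n * (1 - q) * mu (1 - q) (s + 1) =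
      n * ((1 - q) * q ^ s) * (1 - q) := fun n s => by rw [hmu]; ring
  have hmu2 : ∀ (n : ℕ) (s : ℕ), (n : ℝ) * ((1 - q) * q ^ s) * q =
      n * ((1 - q) * q ^ (s + 1)) := fun n s => by rw [pow_succ]; ring
  -- With t = s + 1, the counts Q and U need the asymptotics at t and t + 1, that is at the levels s
  -- and s + 1.
  have hlevel : ∀ n s : ℕ, 3 ≤ n → s + 1 ≤ tn (1 - q) B n →
      Real.log n ^ b ≤ n * q ^ s ∧ Real.log n ^ b ≤ n * q ^ (s + 1) := by
    intro n s hn hs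
    have h1 := log_rpow_le_of_le_tn hq0 hq1 hn s.succ_pos hs
    have h2 := (Real.rpow_le_rpow_of_exponent_le (one_le_log hn) hbB).trans h1
    refine ⟨h2.trans ?_, h2⟩
    gcongr ?_ * ?_
    exact pow_le_pow_of_le_one hq0.le hq1.le (Nat.le_succ s)
  refine ⟨tendsto_supDev fun ε hε => ?_, tendsto_supDev fun ε hε => ?_,
    tendsto_supDev fun ε hε => ?_, tendsto_supDev fun ε hε => ?_⟩
  · filter_upwards [h (ε * (1 - q) / 2) (by positivity), eventually_ge_atTop 3] with n hn h3 t ht htn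
    obtain ⟨s, rfl⟩ := Nat.exists_eq_add_of_le' ht
    obtain ⟨l1, l2⟩ := hlevel n s h3 htn
    rw [hmu']
    refine abs_sub_div_le hq0 hq1 (by positivity) ?_ (hn s l1).2 (hmu2 n s ▸ (hn (s + 1) l2).2)
    exact_mod_cast V_eq_U_add x (s + 1) n
  · filter_upwards [h (ε * (1 - q) / 2) (by positivity), eventually_ge_atTop 3] with n hn h3 t ht htn
    obtain ⟨s, rfl⟩ := Nat.exists_eq_add_of_le' ht
    obtain ⟨l1, l2⟩ := hlevel n s h3 htn
    rw [hmu']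
    refine abs_sub_div_le hq0 hq1 (by positivity) ?_ (hn s l1).1 (hmu2 n s ▸ (hn (s + 1) l2).1)
    exact_mod_cast R_eq_Q_add x s.succ_pos n
  · filter_upwards [h ε hε, eventually_ge_atTop 3] with n hn h3 t ht htn
    obtain ⟨s, rfl⟩ := Nat.exists_eq_add_of_le' ht
    rw [hmu]
    exact (hn s (hlevel n s h3 htn).1).2
  · filter_upwards [h ε hε, eventually_ge_atTop 3] with n hn h3 t ht htn
    obtain ⟨s, rfl⟩ := Nat.exists_eq_add_of_le' ht
    rw [hmu]
    exact (hn s (hlevel n s h3 htn).1).1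

lemma IsTransientLaw.ae_tendsto {μ : Measure (Path d)} {C : ℝ} (hμ : IsTransientLaw μ C) {b : ℝ}
    (hb : 2 < b) (hb3 : b ≤ 3) : ∀ᵐ x ∂μ, ∀ ε > 0, ∀ᶠ n : ℕ in atTop, ∀ s : ℕ,
      Real.log n ^ b ≤ n * returnProb μ ^ s →
      |(R (pos x) (s + 1) n : ℝ) / (n * ((1 - returnProb μ) * returnProb μ ^ s)) - 1| ≤ ε ∧
      |(V (pos x) (s + 1) n : ℝ) / (n * ((1 - returnProb μ) * returnProb μ ^ s)) - 1| ≤ ε := by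
  have hq0 := hμ.returnProb_pos
  have hq1 := hμ.returnProb_lt_one
  have hlq : 0 < Real.log (1 / returnProb μ) := Real.log_pos ((one_lt_div hq0).2 hq1)
  have hA : 0 ≤ (1 + b) / Real.log (1 / returnProb μ) := by positivity
  filter_upwards [hμ.ae_finite_returns, hμ.ae_summable_totalDeviation hb hb3 hA] with x h1 h2 ε hε
  exact eventually_R_V hq0 hq1 (by linarith) h1 h2 hε

section Steps

variable {Ω : Type*} [MeasurableSpace Ω] {P : Measure Ω} {X : ℕ → Ω → (Fin d → ℤ)}

lemma IsSimpleWalkSteps.measure_eq (hX : IsSimpleWalkSteps P d X) (k : ℕ) (p : Fin d × Bool) :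
    P {ω | X k ω = unitStep p} = ENNReal.ofReal (1 / (2 * (d : ℝ))) := by
  obtain ⟨i, b⟩ := p
  cases b
  · simpa [unitStep] using hX.prob_neg k i
  · simpa [unitStep] using hX.prob_pos k i

variable [IsProbabilityMeasure P]

lemma IsSimpleWalkSteps.measure_eq_zero (hX : IsSimpleWalkSteps P d X) (hd : 0 < d) (k : ℕ)
    {v : Fin d → ℤ} (hv : ∀ p, unitStep p ≠ v) : P {ω | X k ω = v} = 0 := by
  have hm : ∀ w, MeasurableSet {ω | X k ω = w} := fun w =>
    hX.measurable k (measurableSet_singleton w)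
  have h1 : P.real (⋃ p, {ω | X k ω = unitStep p}) = 1 := by
    rw [measureReal_iUnion_fintype ?_ fun p => hm _]
    · simp_rw [measureReal_def, hX.measure_eq,
        ENNReal.toReal_ofReal (show 0 ≤ 1 / (2 * (d : ℝ)) by positivity)]
      simp
      field_simp
    · intro p p' hpp
      refine Set.disjoint_left.2 fun ω h h' => hpp (unitStep_injective ?_)
      exact Eq.trans (Eq.symm h) h'
  have h2 : P.real (⋃ p, {ω | X k ω = unitStep p})ᶜ = 0 := by
    rw [probReal_compl_eq_one_sub (.iUnion fun p => hm _), h1, sub_self]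
  rw [measureReal_eq_zero_iff] at h2
  refine measure_mono_null (fun ω hω => ?_) h2
  refine fun h => ?_
  obtain ⟨p, hp⟩ := Set.mem_iUnion.1 h
  exact hv p (Eq.trans (Eq.symm hp) hω)

lemma IsSimpleWalkSteps.isSimpleLaw (hX : IsSimpleWalkSteps P d X) (hd : 0 < d) :
    IsSimpleLaw (P.map fun ω k => X k ω) := by
  have hm : Measurable fun ω k => X k ω := measurable_pi_lambda _ hX.measurable
  refine ⟨isIIDLaw_map hX.measurable hX.indep fun k => ?_, fun p => ?_⟩
  · refine Measure.ext_of_singleton fun v => ?_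
    rw [Measure.map_apply (hX.measurable k) (measurableSet_singleton v),
      Measure.map_apply (hX.measurable 0) (measurableSet_singleton v)]
    change P {ω | X k ω = v} = P {ω | X 0 ω = v}
    by_cases h : ∃ p, unitStep p = v
    · obtain ⟨p, rfl⟩ := h
      rw [hX.measure_eq, hX.measure_eq]
    · push Not at h
      rw [hX.measure_eq_zero hd k h, hX.measure_eq_zero hd 0 h]
  · have hms : MeasurableSet {x : Path d | x 0 = unitStep p} :=
      measurable_pi_apply 0 (measurableSet_singleton _)
    rw [map_measureReal_apply hm hms]
    change P.real {ω | X 0 ω = unitStep p} = _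
    rw [measureReal_def, hX.measure_eq, ENNReal.toReal_ofReal (by positivity)]

lemma IsSimpleWalkSteps.nonReturnProb_eq (hX : IsSimpleWalkSteps P d X) :
    nonReturnProb P X = 1 - returnProb (P.map fun ω k => X k ω) := by
  have hm : Measurable fun ω k => X k ω := measurable_pi_lambda _ hX.measurable
  have hms := measurableSet_exists_hit (0 : Fin d → ℤ) 0
  rw [returnProb, map_measureReal_apply hm hms, ← probReal_compl_eq_one_sub (hm hms), nonReturnProb]
  congr 1
  ext ω
  simp only [Set.mem_ofPred_eq, Set.mem_compl_iff, Set.mem_preimage, not_exists, not_and]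
  rfl

end Steps

end HeavyPoints

theorem mainTheorem1 {Ω : Type*} [MeasurableSpace Ω] (P : Measure Ω) [IsProbabilityMeasure P]
    (d : ℕ) (hd : 3 ≤ d) (X : ℕ → Ω → (Fin d → ℤ)) (hX : HeavyPoints.IsSimpleWalkSteps P d X)
    (γ : ℝ) (hγ : γ = HeavyPoints.nonReturnProb P X) (B : ℝ) (hB : 2 < B) :
    (∀ᵐ ω ∂P, Tendsto (fun n : ℕ => HeavyPoints.supDev (HeavyPoints.tn γ B n) fun t =>
      (HeavyPoints.U (HeavyPoints.walk X ω) t n : ℝ) / (n * γ * HeavyPoints.mu γ t))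
      atTop (𝓝 0)) ∧
    (∀ᵐ ω ∂P, Tendsto (fun n : ℕ => HeavyPoints.supDev (HeavyPoints.tn γ B n) fun t =>
      (HeavyPoints.Q (HeavyPoints.walk X ω) t n : ℝ) / (n * γ * HeavyPoints.mu γ t))
      atTop (𝓝 0)) ∧
    (∀ᵐ ω ∂P, Tendsto (fun n : ℕ => HeavyPoints.supDev (HeavyPoints.tn γ B n) fun t =>
      (HeavyPoints.V (HeavyPoints.walk X ω) t n : ℝ) / (n * HeavyPoints.mu γ t))
      atTop (𝓝 0)) ∧
    (∀ᵐ ω ∂P, Tendsto (fun n : ℕ => HeavyPoints.supDev (HeavyPoints.tn γ B n) fun t =>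
      (HeavyPoints.R (HeavyPoints.walk X ω) t n : ℝ) / (n * HeavyPoints.mu γ t))
      atTop (𝓝 0)) := by
  have hμ := (hX.isSimpleLaw (by omega)).isTransientLaw hd
  have hm : Measurable fun ω k => X k ω := measurable_pi_lambda _ hX.measurable
  have hq0 := hμ.returnProb_pos
  have hq1 := hμ.returnProb_lt_one
  rw [hX.nonReturnProb_eq] at hγ
  subst hγ
  -- The rate estimate needs b ≤ 3. Lowering b from B to min B 3 only enlarges the range of levels
  -- and keeps b > 2.
  have hae := ae_of_ae_map hm.aemeasurable
    (hμ.ae_tendsto (b := min B 3) (lt_min hB (by norm_num)) (min_le_right _ _))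
  have key := hae.mono fun ω hω =>
    HeavyPoints.tendsto_of_eventually_R_V hq0 hq1 (min_le_left B 3) hω
  exact ⟨key.mono fun _ h => h.1, key.mono fun _ h => h.2.1, key.mono fun _ h => h.2.2.1,
    key.mono fun _ h => h.2.2.2⟩
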